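/- Fix $\theta>0$ and let $\Theta=\theta\begin{pmatrix}0&1\\-1&0\end{pmatrix}$. On the space $\mathcal S=\mathcal S(\mathbb R^2)$ of complex-valued Schwartz functions let $$(f\star g)(x)=\frac1{(\pi\theta)^2}\int d^2y\,d^2z\,f(x+y)\,g(x+z)\,e^{-i2y^\mu\Theta^{-1}_{\mu\nu}z^\nu}$$ be the Moyal product, and let $\mathcal A=(\mathcal S,\star)$, with complex conjugation as involution $a\mapsto a^\dagger$. For $a\in\mathcal A$ let $L(a)$ be the bounded operator on $L^2(\mathbb R^2)$ extending $\psi\mapsto a\star\psi$, $\psi\in\mathcal S$; it exists. Let $\mathfrak S(\mathcal A)$ be the set of states of $\mathcal A$, i.e. of linear functionals $\omega:\mathcal A\to\mathbb C$ with $\omega(a^\dagger\star a)\ge0$ for all $a$ and $\sup\{|\omega(a)|:\|L(a)\|\le1\}=1$. Put $\tilde x_\mu=2\Theta^{-1}_{\mu\nu}x^\nu$, let $m(\tilde x_\mu)$ be multiplication by $\tilde x_\mu$, and put $\sigma^1=\begin{pmatrix}0&1\\1&0\end{pmatrix}$, $\sigma^2=\begin{pmatrix}0&i\\-i&0\end{pmatrix}$,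 $\sigma^3=i\sigma^1\sigma^2$. (Repeated indices are summed over $1,2$.) A *spectral triple* $(\mathbb A,\pi,H,D)$ consists of an involutive algebra $\mathbb A$, a faithful $*$-representation $\pi$ of $\mathbb A$ by bounded operators on a separable Hilbert space $H$, and a self-adjoint operator $D$ on a dense domain of $H$, such that for every $a\in\mathbb A$: $\pi(a)\,\mathrm{Dom}(D)\subset\mathrm{Dom}(D)$, the commutator $[D,\pi(a)]$ is bounded, and $\pi(a)(D-\lambda)^{-1}$ is compact for every $\lambda\notin\mathrm{sp}(D)$. It is a *spectral metric space* if moreover $\pi$ is non-degenerate and $\{a\in\mathbb A:[D,\pi(a)]=0\}=\{0\}$. The *spectral distance* is $$d_D(\omega_1,\omega_2)=\sup\{|\omega_1(a)-\omega_2(a)|:a\in\mathbb A,\ \|[D,\pi(a)]\|\le1\}\in[0,\infty].$$ Let $D_0$ be the self-adjoint operator on $L^2(\mathbb R^2)\otimes\mathbb C^2$ that is the closure of $-i\sigma^\mu\partial_\mu$ on $\mathcal S\otimes\mathbb C^2$, and let $d_{D_0}$ be the spectral distance of $(\mathcal A,\ L(\cdot)\otimes1_2,\ L^2(\mathbb R^2)\otimes\mathbb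 C^2,\ D_0)$. For $\xi\in\mathbb R$ let $\tilde D_\xi$ be the closure of the operator $$(1_2\otimes\sigma^\mu)(-i\partial_\mu)-\xi(\sigma^3\otimes\sigma^\mu)\,m(\tilde x_\mu)$$ on the domain $\mathcal S\otimes\mathbb C^4\subset L^2(\mathbb R^2)\otimes\mathbb C^4$. **Proposition.** For every $\xi>0$ with $\xi\ne1$, the triple $(\mathcal A,\ \pi,\ L^2(\mathbb R^2)\otimes\mathbb C^4,\ \tilde D_\xi)$ with $\pi(a)=L(a)\otimes1_4$ is a spectral metric space (in particular, $\tilde D_\xi$ is self-adjoint). For the topology on $\mathfrak S(\mathcal A)$ given by $d_{\tilde D_\xi}$, the space $\mathfrak S(\mathcal A)$ has infinitely many connected components, and each of them is path-connected. Moreover $$d_{\tilde D_\xi}(\omega_1,\omega_2)=\frac1{1+\xi}\,d_{D_0}(\omega_1,\omega_2)\qquad\text{for all }\omega_1,\omega_2\in\mathfrak S(\mathcal A).$$ -/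

import Mathlib

open MeasureTheory SchwartzMap Complex
open scoped Matrix Kronecker ENNReal NNReal LineDeriv FourierTransform

namespace Moyal

/-! ### The Moyal product of Schwartz functions on the plane -/

section Product

open scoped ContDiff

/-- The plane `ℝ²`. -/
abbrev Plane : Type := EuclideanSpace ℝ (Fin 2)

theorem hasTemperateGrowth_cexp_I :
    Function.HasTemperateGrowth (fun t : ℝ => cexp (t * I)) := by
  refine ⟨(Complex.ofRealCLM.contDiff.mul contDiff_const).cexp, fun n => ⟨0, 1, fun t => ?_⟩⟩
  have key : ∀ n : ℕ, iteratedDeriv n (fun t : ℝ => cexp (t * I)) =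
      fun t : ℝ => I ^ n * cexp (t * I) := by
    intro n
    induction n with
    | zero => simp
    | succ n ih =>
      rw [iteratedDeriv_succ, ih]
      funext t
      have h : HasDerivAt (fun t : ℝ => cexp (t * I)) (cexp (t * I) * (1 * I)) t :=
        ((Complex.ofRealCLM.hasDerivAt (x := t)).mul_const I).cexp
      have h2 := (h.const_mul (I ^ n)).deriv
      rw [h2]; ring
  rw [norm_iteratedFDeriv_eq_norm_iteratedDeriv, key]
  simp [Complex.norm_exp]

theorem tensor_contDiff (f g : 𝓢(Plane, ℂ)) :
    ContDiff ℝ ∞ (fun p : Plane × Plane => f p.1 * g p.2) :=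
  ((f.smooth ⊤).comp contDiff_fst).mul ((g.smooth ⊤).comp contDiff_snd)

theorem norm_iteratedFDeriv_comp_fst (f : 𝓢(Plane, ℂ)) (n : ℕ) (p : Plane × Plane) :
    ‖iteratedFDeriv ℝ n (fun p : Plane × Plane => f p.1) p‖ ≤ ‖iteratedFDeriv ℝ n f p.1‖ := by
  have h := (ContinuousLinearMap.fst ℝ Plane Plane).iteratedFDeriv_comp_right (f := f)
    (f.smooth ⊤) p (i := n) (mod_cast le_top)
  have h' : (fun p : Plane × Plane => f p.1) = f ∘ (ContinuousLinearMap.fst ℝ Plane Plane) := rfl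
  rw [h', h]
  refine (ContinuousMultilinearMap.norm_compContinuousLinearMap_le _ _).trans ?_
  refine mul_le_of_le_one_right (norm_nonneg _) ?_
  exact Finset.prod_le_one (fun _ _ => norm_nonneg _)
    (fun _ _ => ContinuousLinearMap.norm_fst_le _ _ _)

theorem norm_iteratedFDeriv_comp_snd (f : 𝓢(Plane, ℂ)) (n : ℕ) (p : Plane × Plane) :
    ‖iteratedFDeriv ℝ n (fun p : Plane × Plane => f p.2) p‖ ≤ ‖iteratedFDeriv ℝ n f p.2‖ := by
  have h := (ContinuousLinearMap.snd ℝ Plane Plane).iteratedFDeriv_comp_right (f := f)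
    (f.smooth ⊤) p (i := n) (mod_cast le_top)
  have h' : (fun p : Plane × Plane => f p.2) = f ∘ (ContinuousLinearMap.snd ℝ Plane Plane) := rfl
  rw [h', h]
  refine (ContinuousMultilinearMap.norm_compContinuousLinearMap_le _ _).trans ?_
  refine mul_le_of_le_one_right (norm_nonneg _) ?_
  exact Finset.prod_le_one (fun _ _ => norm_nonneg _)
    (fun _ _ => ContinuousLinearMap.norm_snd_le _ _ _)

/-- The Schwartz function `(x, y) ↦ f x * g y`. -/
noncomputable def tensor (f g : 𝓢(Plane, ℂ)) : 𝓢(Plane × Plane, ℂ) where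
  toFun p := f p.1 * g p.2
  smooth' := tensor_contDiff f g
  decay' k n := by
    have hf : ∀ k i : ℕ, ∃ C, 0 ≤ C ∧ ∀ x, ‖x‖ ^ k * ‖iteratedFDeriv ℝ i f x‖ ≤ C := fun k i =>
      let ⟨C, hC⟩ := f.decay k i; ⟨C, hC.1.le, hC.2⟩
    have hg : ∀ k i : ℕ, ∃ C, 0 ≤ C ∧ ∀ x, ‖x‖ ^ k * ‖iteratedFDeriv ℝ i g x‖ ≤ C := fun k i =>
      let ⟨C, hC⟩ := g.decay k i; ⟨C, hC.1.le, hC.2⟩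
    choose Cf hCf hf using hf
    choose Cg hCg hg using hg
    refine ⟨∑ i ∈ Finset.range (n + 1), (n.choose i : ℝ) *
      (Cf k i * Cg 0 (n - i) + Cf 0 i * Cg k (n - i)), fun p => ?_⟩
    have h := norm_iteratedFDeriv_mul_le (𝕜 := ℝ) (N := ∞)
      ((f.smooth ⊤).comp contDiff_fst : ContDiff ℝ ∞ fun p : Plane × Plane => f p.1)
      ((g.smooth ⊤).comp contDiff_snd : ContDiff ℝ ∞ fun p : Plane × Plane => g p.2) p
      (n := n) (mod_cast le_top)
    refine (mul_le_mul_of_nonneg_left h (by positivity)).trans ?_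
    rw [Finset.mul_sum]
    refine Finset.sum_le_sum fun i _ => ?_
    have h1 := norm_iteratedFDeriv_comp_fst f i p
    have h2 := norm_iteratedFDeriv_comp_snd g (n - i) p
    have hp : ‖p‖ ^ k ≤ ‖p.1‖ ^ k + ‖p.2‖ ^ k := by
      rw [Prod.norm_def]
      rcases max_choice ‖p.1‖ ‖p.2‖ with h | h <;> rw [h]
      · linarith [pow_nonneg (norm_nonneg p.2) k]
      · linarith [pow_nonneg (norm_nonneg p.1) k]
    have e1 := hf k i p.1
    have e2 := hg 0 (n - i) p.2
    have e3 := hf 0 i p.1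
    have e4 := hg k (n - i) p.2
    rw [pow_zero, one_mul] at e2 e3
    replace h1 : ‖iteratedFDeriv ℝ i (f ∘ Prod.fst) p‖ ≤ _ := h1
    replace h2 : ‖iteratedFDeriv ℝ (n - i) (g ∘ Prod.snd) p‖ ≤ _ := h2
    set a := ‖iteratedFDeriv ℝ i f p.1‖
    set b := ‖iteratedFDeriv ℝ (n - i) g p.2‖
    have ha : 0 ≤ a := norm_nonneg _
    have hb : 0 ≤ b := norm_nonneg _
    calc _ ≤ (‖p.1‖ ^ k + ‖p.2‖ ^ k) * ((n.choose i : ℝ) * a * b) := by gcongr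
      _ = (n.choose i : ℝ) * ((‖p.1‖ ^ k * a) * b + a * (‖p.2‖ ^ k * b)) := by ring
      _ ≤ _ := by
        have := hCf k i
        have := hCf 0 i
        gcongr

theorem section_bound {F : Type} [NormedAddCommGroup F] [NormedSpace ℝ F]
    (Φ : 𝓢(Plane × Plane, F)) (k : ℕ) : ∃ C : ℝ, 0 ≤ C ∧ ∀ x y : Plane,
    ‖x‖ ^ k * ‖Φ (x, y)‖ ≤
      C * (1 + ‖y‖) ^ (-((volume : Measure Plane).integrablePower : ℝ)) := by
  set l := (volume : Measure Plane).integrablePower with hl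
  have h := fun p => one_add_le_sup_seminorm_apply (𝕜 := ℝ) (m := (k + l, 0)) (k := k + l) (n := 0)
    le_rfl le_rfl Φ p
  set C := 2 ^ (k + l) * (Finset.Iic (k + l, 0)).sup
    (fun m => SchwartzMap.seminorm ℝ m.1 m.2) Φ with hC
  refine ⟨C, by positivity, fun x y => ?_⟩
  have h1 := h (x, y)
  rw [norm_iteratedFDeriv_zero] at h1
  have hx : ‖x‖ ≤ 1 + ‖(x, y)‖ := (norm_fst_le (x, y)).trans (by simp)
  have hy : 1 + ‖y‖ ≤ 1 + ‖(x, y)‖ := by gcongr; exact norm_snd_le (x, y)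
  have hpos : 0 < 1 + ‖y‖ := by positivity
  rw [Real.rpow_neg hpos.le, Real.rpow_natCast, ← div_eq_mul_inv, le_div_iff₀ (by positivity)]
  calc _ ≤ (1 + ‖(x, y)‖) ^ k * ‖Φ (x, y)‖ * (1 + ‖(x, y)‖) ^ l := by gcongr
    _ = (1 + ‖(x, y)‖) ^ (k + l) * ‖Φ (x, y)‖ := by rw [pow_add]; ring
    _ ≤ _ := h1

theorem section_integrable {F : Type} [NormedAddCommGroup F] [NormedSpace ℝ F]
    (Φ : 𝓢(Plane × Plane, F)) (x : Plane) : Integrable (fun y => Φ (x, y)) := by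
  obtain ⟨C, -, hC⟩ := section_bound Φ 0
  refine ((Measure.integrable_pow_neg_integrablePower (volume : Measure Plane)).const_mul C).mono'
    (by fun_prop) (Filter.Eventually.of_forall fun y => ?_)
  simpa using hC x y

/-- The derivative of `Φ (x, y)` with respect to `x`. -/
noncomputable def derivFst {F : Type} [NormedAddCommGroup F] [NormedSpace ℝ F]
    (Φ : 𝓢(Plane × Plane, F)) : 𝓢(Plane × Plane, Plane →L[ℝ] F) :=
  postcompCLM ((ContinuousLinearMap.compL ℝ Plane (Plane × Plane) F).flip
    (ContinuousLinearMap.inl ℝ Plane Plane)) (fderivCLM ℝ (Plane × Plane) F Φ)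

theorem hasFDerivAt_partialIntegral {F : Type} [NormedAddCommGroup F] [NormedSpace ℝ F]
    (Φ : 𝓢(Plane × Plane, F)) (x : Plane) :
    HasFDerivAt (fun x => ∫ y, Φ (x, y)) (∫ y, derivFst Φ (x, y)) x := by
  obtain ⟨C, -, hC⟩ := section_bound (derivFst Φ) 0
  refine hasFDerivAt_integral_of_dominated_of_fderiv_le (𝕜 := ℝ) (s := Set.univ)
    (F' := fun x y => derivFst Φ (x, y))
    (bound := fun y => C * (1 + ‖y‖) ^ (-((volume : Measure Plane).integrablePower : ℝ)))
    Filter.univ_mem ?_ (section_integrable Φ x) (section_integrable _ x).1 ?_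
    ((Measure.integrable_pow_neg_integrablePower (volume : Measure Plane)).const_mul C) ?_
  · exact Filter.Eventually.of_forall fun x => (section_integrable Φ x).1
  · exact Filter.Eventually.of_forall fun y x _ => by simpa using hC x y
  · refine Filter.Eventually.of_forall fun y x _ => ?_
    exact (Φ.hasFDerivAt (x, y)).comp x (hasFDerivAt_prodMk_left x y)

theorem partialIntegral_aux (n : ℕ) : ∀ {F : Type} [NormedAddCommGroup F] [NormedSpace ℝ F]
    (Φ : 𝓢(Plane × Plane, F)), ContDiff ℝ n (fun x => ∫ y, Φ (x, y)) ∧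
      ∀ k : ℕ, ∃ C : ℝ, ∀ x,
        ‖x‖ ^ k * ‖iteratedFDeriv ℝ n (fun x => ∫ y, Φ (x, y)) x‖ ≤ C := by
  induction n with
  | zero =>
    intro F _ _ Φ
    refine ⟨contDiff_zero.2 (continuous_iff_continuousAt.2 fun x =>
      (hasFDerivAt_partialIntegral Φ x).continuousAt), fun k => ?_⟩
    obtain ⟨C, hC0, hC⟩ := section_bound Φ k
    refine ⟨∫ y : Plane, C * (1 + ‖y‖) ^ (-((volume : Measure Plane).integrablePower : ℝ)),
      fun x => ?_⟩
    rw [norm_iteratedFDeriv_zero]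
    calc _ ≤ ‖x‖ ^ k * ∫ y, ‖Φ (x, y)‖ := by gcongr; exact norm_integral_le_integral_norm _
      _ = ∫ y, ‖x‖ ^ k * ‖Φ (x, y)‖ := (integral_const_mul _ _).symm
      _ ≤ _ := integral_mono ((section_integrable Φ x).norm.const_mul _)
        ((Measure.integrable_pow_neg_integrablePower (volume : Measure Plane)).const_mul C) (hC x)
  | succ n ih =>
    intro F _ _ Φ
    have hd : fderiv ℝ (fun x => ∫ y, Φ (x, y)) = fun x => ∫ y, derivFst Φ (x, y) :=
      funext fun x => (hasFDerivAt_partialIntegral Φ x).fderiv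
    obtain ⟨h1, h2⟩ := ih (derivFst Φ)
    refine ⟨?_, fun k => ?_⟩
    · push_cast
      refine contDiff_succ_iff_fderiv.2
        ⟨fun x => (hasFDerivAt_partialIntegral Φ x).differentiableAt, by simp, hd ▸ h1⟩
    · obtain ⟨C, hC⟩ := h2 k
      refine ⟨C, fun x => ?_⟩
      rw [← norm_iteratedFDeriv_fderiv, hd]
      exact hC x

/-- The Schwartz function `x ↦ ∫ y, Φ (x, y)`. -/
noncomputable def partialIntegral (Φ : 𝓢(Plane × Plane, ℂ)) : 𝓢(Plane, ℂ) where
  toFun x := ∫ y, Φ (x, y)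
  smooth' := contDiff_infty.2 fun n => (partialIntegral_aux n Φ).1
  decay' k n := (partialIntegral_aux n Φ).2 k


/-- The matrix `Θ = θ ((0, 1), (-1, 0))`. -/
noncomputable def thetaMatrix (θ : ℝ) : Matrix (Fin 2) (Fin 2) ℝ := θ • !![0, 1; -1, 0]

/-- The bilinear form `y^μ Θ⁻¹_{μν} z^ν`. -/
noncomputable def thetaInvForm (θ : ℝ) (y z : Plane) : ℝ :=
  ∑ μ, ∑ ν, y μ * (thetaMatrix θ)⁻¹ μ ν * z ν

theorem thetaMatrix_inv (θ : ℝ) : (thetaMatrix θ)⁻¹ = θ⁻¹ • !![0, -1; 1, 0] := by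
  rcases eq_or_ne θ 0 with rfl | h
  · simp [thetaMatrix]
  · refine Matrix.inv_eq_left_inv ?_
    ext i j
    fin_cases i <;> fin_cases j <;> simp [thetaMatrix, Matrix.mul_apply, h]

theorem thetaInvForm_eq (θ : ℝ) (y z : Plane) :
    thetaInvForm θ y z = θ⁻¹ * (y 1 * z 0 - y 0 * z 1) := by
  simp [thetaInvForm, thetaMatrix_inv, Fin.sum_univ_two]; ring

/-- The Moyal product
`(f ⋆ g)(x) = (πθ)⁻² ∫ d²y d²z f(x+y) g(x+z) exp(-i 2 y^μ Θ⁻¹_{μν} z^ν)`, as a function. -/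
noncomputable def moyalFun (θ : ℝ) (f g : Plane → ℂ) (x : Plane) : ℂ :=
  (1 / (Real.pi * θ) ^ 2 : ℂ) * ∫ y : Plane, ∫ z : Plane,
    f (x + y) * g (x + z) * cexp (-I * (2 * thetaInvForm θ y z : ℝ))

/-- The frequency at which the inner integral of the Moyal product is a Fourier transform. -/
noncomputable def freqEquiv (θ : ℝ) (hθ : θ ≠ 0) : Plane ≃L[ℝ] Plane :=
  LinearEquiv.toContinuousLinearEquiv
    { toFun := fun y => !₂[(Real.pi * θ)⁻¹ * y 1, -((Real.pi * θ)⁻¹ * y 0)]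
      map_add' := fun y z => by ext i; fin_cases i <;> simp <;> ring
      map_smul' := fun c y => by ext i; fin_cases i <;> simp <;> ring
      invFun := fun y => !₂[-(Real.pi * θ * y 1), Real.pi * θ * y 0]
      left_inv := fun y => by
        ext i; fin_cases i <;> simp <;> field_simp
      right_inv := fun y => by
        ext i; fin_cases i <;> simp <;> field_simp }

/-- The Schwartz function `y ↦ ∫ d²w g(w) exp(-i 2 y^μ Θ⁻¹_{μν} w^ν)`. -/
noncomputable def moyalKernel (θ : ℝ) (hθ : θ ≠ 0) : 𝓢(Plane, ℂ) →L[ℂ] 𝓢(Plane, ℂ) :=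
  (compCLMOfContinuousLinearEquiv ℂ (freqEquiv θ hθ)).comp (fourierTransformCLM ℂ)

theorem moyalKernel_apply (θ : ℝ) (hθ : θ ≠ 0) (g : 𝓢(Plane, ℂ)) (y : Plane) :
    moyalKernel θ hθ g y =
      ∫ w : Plane, g w * cexp (-I * (2 * thetaInvForm θ y w : ℝ)) := by
  have : moyalKernel θ hθ g y = 𝓕 (g : Plane → ℂ) (freqEquiv θ hθ y) := rfl
  rw [this, Real.fourier_eq']
  refine integral_congr_ae (Filter.Eventually.of_forall fun w => ?_)
  simp only [smul_eq_mul]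
  rw [mul_comm]
  congr 2
  have h : inner ℝ w (freqEquiv θ hθ y) = (Real.pi)⁻¹ * thetaInvForm θ y w := by
    rw [thetaInvForm_eq]
    simp [freqEquiv, PiLp.inner_apply, Fin.sum_univ_two]
    ring
  rw [h]
  push_cast
  have := Real.pi_ne_zero
  field_simp

theorem hasTemperateGrowth_phase (θ : ℝ) :
    Function.HasTemperateGrowth
      (fun p : Plane × Plane => cexp ((2 * thetaInvForm θ p.2 p.1 : ℝ) * I)) := by
  have hc : ∀ i : Fin 2, Function.HasTemperateGrowth (fun p : Plane × Plane => p.1 i) := fun i =>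
    ((EuclideanSpace.proj (𝕜 := ℝ) i).comp
      (ContinuousLinearMap.fst ℝ Plane Plane)).hasTemperateGrowth
  have hd : ∀ i : Fin 2, Function.HasTemperateGrowth (fun p : Plane × Plane => p.2 i) := fun i =>
    ((EuclideanSpace.proj (𝕜 := ℝ) i).comp
      (ContinuousLinearMap.snd ℝ Plane Plane)).hasTemperateGrowth
  refine hasTemperateGrowth_cexp_I.comp
    (f := fun p : Plane × Plane => 2 * thetaInvForm θ p.2 p.1) ?_
  simp only [thetaInvForm_eq]
  exact (Function.HasTemperateGrowth.const 2).mul ((Function.HasTemperateGrowth.const _).mul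
    (((hd 1).mul (hc 0)).sub ((hd 0).mul (hc 1))))

/-- The shear `(x, y) ↦ (x + y, y)`. -/
noncomputable def shearEquiv : (Plane × Plane) ≃L[ℝ] (Plane × Plane) :=
  LinearEquiv.toContinuousLinearEquiv
    { toFun := fun p => (p.1 + p.2, p.2)
      map_add' := fun p q => by ext1 <;> simp; abel
      map_smul' := fun c p => by simp
      invFun := fun p => (p.1 - p.2, p.2)
      left_inv := fun p => by simp
      right_inv := fun p => by simp }

/-- The integrand left in the Moyal product after the inner integration. -/
noncomputable def moyalIntegrand (θ : ℝ) (hθ : θ ≠ 0) (f g : 𝓢(Plane, ℂ)) :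
    𝓢(Plane × Plane, ℂ) :=
  smulLeftCLM ℂ (fun p : Plane × Plane => cexp ((2 * thetaInvForm θ p.2 p.1 : ℝ) * I))
    (compCLMOfContinuousLinearEquiv ℂ shearEquiv (tensor f (moyalKernel θ hθ g)))

theorem moyalIntegrand_apply (θ : ℝ) (hθ : θ ≠ 0) (f g : 𝓢(Plane, ℂ)) (x y : Plane) :
    moyalIntegrand θ hθ f g (x, y) =
      cexp ((2 * thetaInvForm θ y x : ℝ) * I) * (f (x + y) * moyalKernel θ hθ g y) := by
  rw [moyalIntegrand, smulLeftCLM_apply_apply (hasTemperateGrowth_phase θ)]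
  rfl

theorem moyalFun_eq (θ : ℝ) (hθ : θ ≠ 0) (f g : 𝓢(Plane, ℂ)) (x : Plane) :
    moyalFun θ f g x =
      (1 / (Real.pi * θ) ^ 2 : ℂ) * ∫ y, moyalIntegrand θ hθ f g (x, y) := by
  unfold moyalFun
  congr 1
  refine integral_congr_ae (Filter.Eventually.of_forall fun y => ?_)
  simp only
  rw [moyalIntegrand_apply, moyalKernel_apply, ← integral_const_mul, ← integral_const_mul,
    eq_comm, ← integral_add_left_eq_self _ x]
  refine integral_congr_ae (Filter.Eventually.of_forall fun z => ?_)
  have h : thetaInvForm θ y (x + z) = thetaInvForm θ y x + thetaInvForm θ y z := by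
    simp [thetaInvForm_eq]; ring
  simp only [h]
  rw [show cexp (-I * (2 * thetaInvForm θ y z : ℝ)) =
    cexp ((2 * thetaInvForm θ y x : ℝ) * I) *
      cexp (-I * (2 * (thetaInvForm θ y x + thetaInvForm θ y z) : ℝ)) by
    rw [← Complex.exp_add]; congr 1; push_cast; ring]
  ring

/-- The Moyal product of two Schwartz functions, as a Schwartz function. -/
noncomputable def moyalMul (θ : ℝ) [hθ : Fact (0 < θ)] (f g : 𝓢(Plane, ℂ)) : 𝓢(Plane, ℂ) where
  toFun := moyalFun θ f g
  smooth' := by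
    rw [funext (moyalFun_eq θ hθ.out.ne' f g)]
    exact ((1 / (Real.pi * θ) ^ 2 : ℂ) • partialIntegral (moyalIntegrand θ hθ.out.ne' f g)).smooth'
  decay' := by
    rw [funext (moyalFun_eq θ hθ.out.ne' f g)]
    exact ((1 / (Real.pi * θ) ^ 2 : ℂ) • partialIntegral (moyalIntegrand θ hθ.out.ne' f g)).decay'

theorem moyalMul_apply (θ : ℝ) [hθ : Fact (0 < θ)] (f g : 𝓢(Plane, ℂ)) (x : Plane) :
    moyalMul θ f g x =
      (1 / (Real.pi * θ) ^ 2 : ℂ) * ∫ y, moyalIntegrand θ hθ.out.ne' f g (x, y) :=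
  moyalFun_eq θ hθ.out.ne' f g x

theorem moyalMul_add (θ : ℝ) [Fact (0 < θ)] (f g h : 𝓢(Plane, ℂ)) :
    moyalMul θ f (g + h) = moyalMul θ f g + moyalMul θ f h := by
  ext x
  rw [add_apply, moyalMul_apply, moyalMul_apply, moyalMul_apply, ← mul_add,
    ← integral_add (section_integrable _ x) (section_integrable _ x)]
  simp only [moyalIntegrand_apply, map_add, add_apply, mul_add]

theorem moyalMul_smul (θ : ℝ) [Fact (0 < θ)] (c : ℂ) (f g : 𝓢(Plane, ℂ)) :
    moyalMul θ f (c • g) = c • moyalMul θ f g := by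
  ext x
  rw [smul_apply, moyalMul_apply, moyalMul_apply, smul_eq_mul, mul_left_comm,
    ← integral_const_mul c]
  simp only [moyalIntegrand_apply, map_smul, smul_apply, smul_eq_mul]
  congr 1
  refine integral_congr_ae (Filter.Eventually.of_forall fun y => ?_)
  simp only
  ring

end Product

/-- Complex conjugation of Schwartz functions, the involution of the Moyal algebra. -/
noncomputable def conj (a : 𝓢(Plane, ℂ)) : 𝓢(Plane, ℂ) :=
  postcompCLM (𝕜 := ℝ) (F := ℂ) (G := ℂ) (Complex.conjCLE : ℂ →L[ℝ] ℂ) a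

theorem conj_apply (a : 𝓢(Plane, ℂ)) (x : Plane) : conj a x = starRingEnd ℂ (a x) := rfl

/-! ### Left multiplication on `L²(ℝ²)` and on `L²(ℝ²) ⊗ ℂ^ι` -/

/-- The Hilbert space `L²(ℝ²)`. -/
abbrev L2Plane : Type := Lp ℂ 2 (volume : Measure Plane)

/-- The linear map `ψ ↦ a ⋆ ψ` on Schwartz functions. -/
noncomputable def moyalLeft (θ : ℝ) [Fact (0 < θ)] (a : 𝓢(Plane, ℂ)) :
    𝓢(Plane, ℂ) →ₗ[ℂ] 𝓢(Plane, ℂ) where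
  toFun ψ := moyalMul θ a ψ
  map_add' := moyalMul_add θ a
  map_smul' c := moyalMul_smul θ c a

/-- The operator `L(a)` on `L²(ℝ²)`: the continuous extension of `ψ ↦ a ⋆ ψ` from the dense
subspace of Schwartz functions. -/
noncomputable def leftMul (θ : ℝ) [Fact (0 < θ)] (a : 𝓢(Plane, ℂ)) : L2Plane →L[ℂ] L2Plane :=
  ((toLpCLM ℂ ℂ 2 (volume : Measure Plane)).toLinearMap ∘ₗ moyalLeft θ a).extendOfNorm
    (toLpCLM ℂ ℂ 2 (volume : Measure Plane)).toLinearMap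

/-- The Hilbert space `L²(ℝ²) ⊗ ℂ^ι` of square integrable `ι`-component spinors. -/
abbrev Spinors (ι : Type) : Type := PiLp 2 (fun _ : ι => L2Plane)

/-- The operator `T ⊗ 1`, acting by `T` on each component. -/
noncomputable def diagonal {ι : Type} [Fintype ι] (T : L2Plane →L[ℂ] L2Plane) :
    Spinors ι →L[ℂ] Spinors ι :=
  ((PiLp.continuousLinearEquiv 2 ℂ (fun _ : ι => L2Plane)).symm : _ →L[ℂ] Spinors ι) ∘L
    ContinuousLinearMap.piMap (fun _ : ι => T) ∘L
    (PiLp.continuousLinearEquiv 2 ℂ (fun _ : ι => L2Plane) : Spinors ι →L[ℂ] _)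

theorem diagonal_apply {ι : Type} [Fintype ι] (T : L2Plane →L[ℂ] L2Plane) (ψ : Spinors ι) (i : ι) :
    diagonal T ψ i = T (ψ i) := rfl

/-! ### Dirac operators -/

/-- The linear function `x̃_μ = 2 Θ⁻¹_{μν} x^ν`. -/
noncomputable def xTilde (θ : ℝ) (μ : Fin 2) (x : Plane) : ℝ :=
  2 * ∑ ν, (thetaMatrix θ)⁻¹ μ ν * x ν

theorem hasTemperateGrowth_xTilde (θ : ℝ) (μ : Fin 2) :
    Function.HasTemperateGrowth (fun x : Plane => (xTilde θ μ x : ℂ)) := by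
  refine Function.HasTemperateGrowth.comp Function.Complex.hasTemperateGrowth_ofReal (f := xTilde θ μ) ?_
  exact (Function.HasTemperateGrowth.const 2).mul (Function.HasTemperateGrowth.sum fun ν _ =>
    (Function.HasTemperateGrowth.const _).mul
      (EuclideanSpace.proj (𝕜 := ℝ) (ν : Fin 2)).hasTemperateGrowth)

/-- The multiplication operator `m(x̃_μ)` on Schwartz functions. -/
noncomputable def mulXTilde (θ : ℝ) (μ : Fin 2) : 𝓢(Plane, ℂ) →ₗ[ℂ] 𝓢(Plane, ℂ) :=
  (smulLeftCLM ℂ (fun x : Plane => (xTilde θ μ x : ℂ))).toLinearMap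

theorem mulXTilde_apply (θ : ℝ) (μ : Fin 2) (f : 𝓢(Plane, ℂ)) (x : Plane) :
    mulXTilde θ μ f x = xTilde θ μ x * f x :=
  smulLeftCLM_apply_apply (hasTemperateGrowth_xTilde θ μ) f x

/-- The partial derivative `∂_μ` on Schwartz functions. -/
noncomputable def partialDeriv (μ : Fin 2) : 𝓢(Plane, ℂ) →ₗ[ℂ] 𝓢(Plane, ℂ) :=
  (LineDeriv.lineDerivOpCLM ℂ 𝓢(Plane, ℂ) (EuclideanSpace.single μ (1 : ℝ))).toLinearMap

theorem partialDeriv_apply (μ : Fin 2) (f : 𝓢(Plane, ℂ)) (x : Plane) :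
    partialDeriv μ f x = fderiv ℝ f x (EuclideanSpace.single μ 1) :=
  SchwartzMap.lineDerivOp_apply_eq_fderiv _ f x

/-- The operator `Σ_μ γ^μ ⊗ (-i ∂_μ) + δ^μ ⊗ m(x̃_μ)` on `𝓢 ⊗ ℂ^ι`. -/
noncomputable def diracSchwartz {ι : Type} [Fintype ι] (θ : ℝ) (γ δ : Fin 2 → Matrix ι ι ℂ) :
    (ι → 𝓢(Plane, ℂ)) →ₗ[ℂ] (ι → 𝓢(Plane, ℂ)) :=
  LinearMap.pi fun i => ∑ μ, ∑ j,
    (γ μ i j • ((-I) • partialDeriv μ) + δ μ i j • mulXTilde θ μ) ∘ₗ LinearMap.proj j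

theorem diracSchwartz_apply {ι : Type} [Fintype ι] (θ : ℝ) (γ δ : Fin 2 → Matrix ι ι ℂ)
    (ψ : ι → 𝓢(Plane, ℂ)) (i : ι) (x : Plane) :
    diracSchwartz θ γ δ ψ i x = ∑ μ, ∑ j,
      (γ μ i j * (-I * fderiv ℝ (ψ j) x (EuclideanSpace.single μ 1)) +
        δ μ i j * (xTilde θ μ x * ψ j x)) := by
  simp [diracSchwartz, partialDeriv_apply, mulXTilde_apply]

/-- The inclusion of `𝓢 ⊗ ℂ^ι` in `L²(ℝ²) ⊗ ℂ^ι`. -/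
noncomputable def schwartzToSpinors (ι : Type) [Fintype ι] :
    (ι → 𝓢(Plane, ℂ)) →ₗ[ℂ] Spinors ι :=
  (WithLp.linearEquiv 2 ℂ (ι → L2Plane)).symm.toLinearMap ∘ₗ
    LinearMap.pi fun i =>
      (toLpCLM ℂ ℂ 2 (volume : Measure Plane)).toLinearMap ∘ₗ LinearMap.proj i

theorem schwartzToSpinors_apply (ι : Type) [Fintype ι] (ψ : ι → 𝓢(Plane, ℂ)) (i : ι) :
    schwartzToSpinors ι ψ i = (ψ i).toLp 2 := rfl

theorem schwartzToSpinors_injective (ι : Type) [Fintype ι] :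
    Function.Injective (schwartzToSpinors ι) := fun _ _ h =>
  funext fun i => SchwartzMap.injective_toLp 2 (volume : Measure Plane)
    (congrArg (fun χ : Spinors ι => χ i) h)

/-- The operator `Σ_μ γ^μ ⊗ (-i ∂_μ) + δ^μ ⊗ m(x̃_μ)` as an unbounded operator in
`L²(ℝ²) ⊗ ℂ^ι` with domain `𝓢 ⊗ ℂ^ι`. -/
noncomputable def diracCore {ι : Type} [Fintype ι] (θ : ℝ) (γ δ : Fin 2 → Matrix ι ι ℂ) :
    Spinors ι →ₗ.[ℂ] Spinors ι where
  domain := LinearMap.range (schwartzToSpinors ι)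
  toFun := (schwartzToSpinors ι ∘ₗ diracSchwartz θ γ δ) ∘ₗ
    (LinearEquiv.ofInjective _ (schwartzToSpinors_injective ι)).symm.toLinearMap

theorem diracCore_apply {ι : Type} [Fintype ι] (θ : ℝ) (γ δ : Fin 2 → Matrix ι ι ℂ)
    (ψ : ι → 𝓢(Plane, ℂ)) :
    diracCore θ γ δ ⟨schwartzToSpinors ι ψ, LinearMap.mem_range_self _ ψ⟩ =
      schwartzToSpinors ι (diracSchwartz θ γ δ ψ) :=
  congrArg (fun χ => schwartzToSpinors ι (diracSchwartz θ γ δ χ))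
    ((LinearEquiv.ofInjective _ (schwartzToSpinors_injective ι)).symm_apply_apply ψ)

/-- The matrix `σ¹`. -/
def sigma1 : Matrix (Fin 2) (Fin 2) ℂ := !![0, 1; 1, 0]

/-- The matrix `σ²`. -/
def sigma2 : Matrix (Fin 2) (Fin 2) ℂ := !![0, I; -I, 0]

/-- The matrices `σ^μ`, `μ = 1, 2`. -/
def sigma : Fin 2 → Matrix (Fin 2) (Fin 2) ℂ := ![sigma1, sigma2]

/-- The matrix `σ³ = i σ¹ σ²`. -/
noncomputable def sigma3 : Matrix (Fin 2) (Fin 2) ℂ := I • (sigma1 * sigma2)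

/-- The standard Dirac operator `D₀ = -i σ^μ ∂_μ`, the closure of its restriction
to `𝓢 ⊗ ℂ²`. -/
noncomputable def standardDirac (θ : ℝ) : Spinors (Fin 2) →ₗ.[ℂ] Spinors (Fin 2) :=
  (diracCore θ sigma 0).closure

/-- The twisted Dirac operator `(1 ⊗ σ^μ)(-i ∂_μ) - ξ (σ³ ⊗ σ^μ) m(x̃_μ)`, the closure of the
operator with domain `𝓢 ⊗ ℂ⁴`. -/
noncomputable def twistedDirac (θ ξ : ℝ) :
    Spinors (Fin 2 × Fin 2) →ₗ.[ℂ] Spinors (Fin 2 × Fin 2) :=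
  (diracCore θ (fun μ => (1 : Matrix (Fin 2) (Fin 2) ℂ) ⊗ₖ sigma μ)
    (fun μ => -((ξ : ℂ) • (sigma3 ⊗ₖ sigma μ)))).closure

/-! ### Spectral triples and spectral metric spaces -/

/-- The data `(A, π, H, D)` of a candidate spectral triple: a product and an involution on the
vector space `A`, a map `π` from `A` to bounded operators on `H`, and an unbounded operator `D`.
The laws are imposed in `IsSpectralTriple`. -/
structure TripleData (A H : Type) [AddCommGroup A] [Module ℂ A] [NormedAddCommGroup H]
    [InnerProductSpace ℂ H] where
  /-- the product of `A` -/
  mul : A → A → A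
  /-- the involution of `A` -/
  inv : A → A
  /-- the representation `π` -/
  rep : A → H →L[ℂ] H
  /-- the Dirac operator `D` -/
  dirac : H →ₗ.[ℂ] H

/-- `mul` and `inv` make the complex vector space `A` an involutive algebra. -/
structure IsInvolutiveAlgebra {A : Type} [AddCommGroup A] [Module ℂ A]
    (mul : A → A → A) (inv : A → A) : Prop where
  mul_add : ∀ a b c, mul a (b + c) = mul a b + mul a c
  add_mul : ∀ a b c, mul (a + b) c = mul a c + mul b c
  smul_mul : ∀ (z : ℂ) a b, mul (z • a) b = z • mul a b
  mul_smul : ∀ (z : ℂ) a b, mul a (z • b) = z • mul a b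
  mul_assoc : ∀ a b c, mul (mul a b) c = mul a (mul b c)
  inv_add : ∀ a b, inv (a + b) = inv a + inv b
  inv_smul : ∀ (z : ℂ) a, inv (z • a) = starRingEnd ℂ z • inv a
  inv_mul : ∀ a b, inv (mul a b) = mul (inv b) (inv a)
  inv_inv : ∀ a, inv (inv a) = a

/-- The bounded operator `R` is the resolvent `(D - z)⁻¹`. A number `z` for which such an `R`
exists is precisely a number outside the spectrum of `D`. -/
def IsResolvent {H : Type} [NormedAddCommGroup H] [InnerProductSpace ℂ H]
    (D : H →ₗ.[ℂ] H) (z : ℂ) (R : H →L[ℂ] H) : Prop :=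
  (∀ φ : H, ∃ h : R φ ∈ D.domain, D ⟨R φ, h⟩ - z • R φ = φ) ∧
    ∀ ψ : D.domain, R (D ψ - z • (ψ : H)) = ψ

namespace TripleData

variable {A H : Type} [AddCommGroup A] [Module ℂ A] [NormedAddCommGroup H]
  [InnerProductSpace ℂ H]

/-- `π(a)` preserves the domain of `D` and `[D, π(a)]` is bounded there with constant `C`. -/
def CommutatorBound (T : TripleData A H) (a : A) (C : ℝ≥0) : Prop :=
  ∀ ψ : T.dirac.domain, ∃ h : T.rep a ψ ∈ T.dirac.domain,
    ‖T.dirac ⟨T.rep a ψ, h⟩ - T.rep a (T.dirac ψ)‖ ≤ C * ‖(ψ : H)‖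

/-- The seminorm `ℓ_D(a) = ‖[D, π(a)]‖` (with value `∞` where this is not a bounded operator). -/
noncomputable def lip (T : TripleData A H) (a : A) : ℝ≥0∞ :=
  ⨅ (C : ℝ≥0) (_ : T.CommutatorBound a C), (C : ℝ≥0∞)

/-- The spectral distance `d_D(ω₁, ω₂) = sup {|ω₁(a) - ω₂(a)| : ℓ_D(a) ≤ 1}`, with values in
`[0, ∞]`. -/
noncomputable def dist (T : TripleData A H) (ω₁ ω₂ : A →ₗ[ℂ] ℂ) : ℝ≥0∞ :=
  ⨆ (a : A) (_ : T.lip a ≤ 1), ‖ω₁ a - ω₂ a‖ₑ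

/-- The data form a spectral triple: `π` is a faithful `*`-representation of the involutive
algebra `A` on the separable Hilbert space `H`, `D` is self-adjoint on a dense domain that each
`π(a)` preserves, the commutators `[D, π(a)]` are bounded, and `π(a) (D - z)⁻¹` is compact for
all `z` outside the spectrum of `D`. -/
structure IsSpectralTriple [CompleteSpace H] (T : TripleData A H) : Prop where
  separable : TopologicalSpace.SeparableSpace H
  algebra : IsInvolutiveAlgebra T.mul T.inv
  rep_add : ∀ a b, T.rep (a + b) = T.rep a + T.rep b
  rep_smul : ∀ (z : ℂ) a, T.rep (z • a) = z • T.rep a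
  rep_mul : ∀ a b, T.rep (T.mul a b) = T.rep a ∘L T.rep b
  rep_inv : ∀ a, T.rep (T.inv a) = ContinuousLinearMap.adjoint (T.rep a)
  faithful : Function.Injective T.rep
  dense_domain : Dense (T.dirac.domain : Set H)
  selfAdjoint : IsSelfAdjoint T.dirac
  domain_invariant : ∀ (a : A), ∀ ψ ∈ T.dirac.domain, T.rep a ψ ∈ T.dirac.domain
  commutator_bounded : ∀ a, ∃ C, T.CommutatorBound a C
  compact_resolvent : ∀ (a : A) (z : ℂ) (R : H →L[ℂ] H), IsResolvent T.dirac z R →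
    IsCompactOperator (T.rep a ∘L R)

/-- The data form a spectral metric space: a spectral triple whose representation is non
degenerate and whose metric commutant `{a : [D, π(a)] = 0}` is trivial. -/
structure IsSpectralMetricSpace [CompleteSpace H] (T : TripleData A H) : Prop
    extends IsSpectralTriple T where
  nondegenerate : (Submodule.span ℂ {φ : H | ∃ a ψ, T.rep a ψ = φ}).topologicalClosure = ⊤
  commutant_trivial : {a : A | T.CommutatorBound a 0} = {0}

end TripleData

/-! ### The Moyal triples, states, and the topology of the spectral distance -/

/-- The standard Moyal triple `(𝒜, π₀, L²(ℝ²) ⊗ ℂ², D₀)`, with `𝒜 = (𝓢, ⋆)` and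
`π₀(a) = L(a) ⊗ 1`. -/
noncomputable def standardTriple (θ : ℝ) [Fact (0 < θ)] :
    TripleData 𝓢(Plane, ℂ) (Spinors (Fin 2)) where
  mul := moyalMul θ
  inv := conj
  rep a := diagonal (leftMul θ a)
  dirac := standardDirac θ

/-- The triple `(𝒜, π, L²(ℝ²) ⊗ ℂ⁴, D̃_ξ)`, with `𝒜 = (𝓢, ⋆)` and `π(a) = L(a) ⊗ 1`. -/
noncomputable def twistedTriple (θ ξ : ℝ) [Fact (0 < θ)] :
    TripleData 𝓢(Plane, ℂ) (Spinors (Fin 2 × Fin 2)) where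
  mul := moyalMul θ
  inv := conj
  rep a := diagonal (leftMul θ a)
  dirac := twistedDirac θ ξ

/-- `ω` is a state of the pre-C*-algebra `𝒜 = (𝓢, ⋆)`, whose C*-norm is `a ↦ ‖L(a)‖`: a positive
linear functional of norm one. -/
structure IsState (θ : ℝ) [Fact (0 < θ)] (ω : 𝓢(Plane, ℂ) →ₗ[ℂ] ℂ) : Prop where
  nonneg : ∀ a, 0 ≤ (ω (moyalMul θ (conj a) a)).re ∧ (ω (moyalMul θ (conj a) a)).im = 0
  norm_eq_one : IsLUB {r : ℝ | ∃ a, ‖leftMul θ a‖ ≤ 1 ∧ r = ‖ω a‖} 1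

/-- The space of states of `𝒜`, to be equipped with the spectral distance of the triple `T`. -/
def StateSpace (θ : ℝ) [Fact (0 < θ)] {H : Type} [NormedAddCommGroup H] [InnerProductSpace ℂ H]
    (_T : TripleData 𝓢(Plane, ℂ) H) : Type :=
  {ω : 𝓢(Plane, ℂ) →ₗ[ℂ] ℂ // IsState θ ω}

/-- The spectral distance of `T` as an extended (pseudo)metric on the states; it carries the
topology of this distance. -/
noncomputable instance (θ : ℝ) [Fact (0 < θ)] {H : Type} [NormedAddCommGroup H]
    [InnerProductSpace ℂ H] (T : TripleData 𝓢(Plane, ℂ) H) :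
    PseudoEMetricSpace (StateSpace θ T) where
  edist ω₁ ω₂ := T.dist ω₁.1 ω₂.1
  edist_self ω := by simp [TripleData.dist]
  edist_comm ω₁ ω₂ := by
    simp only [TripleData.dist]
    refine iSup_congr fun a => iSup_congr fun _ => ?_
    rw [← enorm_neg, neg_sub]
  edist_triangle ω₁ ω₂ ω₃ := by
    refine iSup₂_le fun a ha => ?_
    calc ‖ω₁.1 a - ω₃.1 a‖ₑ = ‖(ω₁.1 a - ω₂.1 a) + (ω₂.1 a - ω₃.1 a)‖ₑ := by
          rw [sub_add_sub_cancel]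
      _ ≤ ‖ω₁.1 a - ω₂.1 a‖ₑ + ‖ω₂.1 a - ω₃.1 a‖ₑ := enorm_add_le _ _
      _ ≤ _ := add_le_add
        (le_iSup₂ (f := fun (a : 𝓢(Plane, ℂ)) (_ : T.lip a ≤ 1) => ‖ω₁.1 a - ω₂.1 a‖ₑ) a ha)
        (le_iSup₂ (f := fun (a : 𝓢(Plane, ℂ)) (_ : T.lip a ≤ 1) => ‖ω₂.1 a - ω₃.1 a‖ₑ) a ha)

end Moyal

open Moyal

namespace Moyal

/-! ### The phase, the twisted translations and the twisted Fourier transform -/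

/-! Moyal multiplication by `g` on the right is an average of the twisted translations `transRight θ
y`, which are isometric on `L²`, with weight `symbol θ g`, a rescaled Fourier transform of `g`.
Multiplication on the left has a mirror expansion, and complex conjugation exchanges the two.
Associativity, the Leibniz rule and all `L²` bounds follow. Formally, left and right Moyal
multiplication by the coordinate `x̃_μ` are `m(x̃_μ) + i∂_μ` and `m(x̃_μ) - i∂_μ`, so every Dirac
operator here is a matrix combination of `coordLeft` and `coordRight`. Since `coordRight` commutes
with `L(a)`, the commutator of the Dirac operator with `L(a)` involves only the operators `L(∂_μ
a)`.

On the two eigenspaces of `σ³` the commutator of the twisted operator is `1 + ξ` and `1 - ξ` times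
the standard one. As `ξ > 0`, the larger norm is `1 + ξ` times the standard norm
(`norm_leftCommutator_twisted`), and the distances scale by the inverse (`dist_twistedTriple`).

Mollifiers `e`, real elements whose symbol is a probability density close to the point mass at the
origin, give contractions `L(e)` and `R(e)` that tend strongly to the identity and have small
commutators with the Dirac operator. Regularizing by `L(e) R(e)` proves self-adjointness
(`isSelfAdjoint_closure_diracCore`).

For compactness, `L(a) R(b)` is compact (`isCompactOperator_leftMul_rightMul`), so it suffices that
`R(e)` be uniformly close to the identity on the range of `L(a)`, relative to the graph norm of the
Dirac operator. For this the graph norm must control `coordRight θ μ (a ⋆ ψ)`. In the Dirac operator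
these terms carry the factor `1 ∓ ξ`, nonzero exactly because `ξ ≠ 1`, and the remaining terms are
bounded. What is controlled is a ladder operator `coordRight θ 0 ± i coordRight θ 1`, and the
canonical commutation relation recovers both coordinates (`sum_norm_coordRight_le`).

For the topology, points on a segment of states are at distance proportional to their parameter
difference. States at finite distance are therefore joined by a path, while balls of infinite radius
are clopen, so components are exactly the classes of finite distance. One pair at infinite distance
(`exists_dist_eq_top`) yields infinitely many components along its segment. Such a pair consists of
a Schwartz vector state and a mixture of states in which ever more concentrated vectors have slowly
decreasing weights. -/

theorem thetaInvForm_add_right (θ : ℝ) (x y z : Plane) :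
    thetaInvForm θ x (y + z) = thetaInvForm θ x y + thetaInvForm θ x z := by
  simp [thetaInvForm_eq]; ring

theorem thetaInvForm_neg_left (θ : ℝ) (x y : Plane) :
    thetaInvForm θ (-x) y = -thetaInvForm θ x y := by
  simp [thetaInvForm_eq]; ring

theorem thetaInvForm_neg_right (θ : ℝ) (x y : Plane) :
    thetaInvForm θ x (-y) = -thetaInvForm θ x y := by
  simp [thetaInvForm_eq]; ring

theorem thetaInvForm_swap (θ : ℝ) (x y : Plane) : thetaInvForm θ x y = -thetaInvForm θ y x := by
  simp [thetaInvForm_eq]; ring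

/-- The phase `exp (2 i y^μ Θ⁻¹_{μν} x^ν)`. -/
noncomputable def phase (θ : ℝ) (y x : Plane) : ℂ := cexp ((2 * thetaInvForm θ y x : ℝ) * I)

@[simp] theorem norm_phase (θ : ℝ) (y x : Plane) : ‖phase θ y x‖ = 1 :=
  Complex.norm_exp_ofReal_mul_I _

theorem conj_phase (θ : ℝ) (y x : Plane) :
    starRingEnd ℂ (phase θ y x) = phase θ (-y) x := by
  rw [phase, phase, ← Complex.exp_conj, thetaInvForm_neg_left, map_mul, Complex.conj_ofReal,
    Complex.conj_I]
  congr 1; push_cast; ring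

theorem phase_mul_phase_neg (θ : ℝ) (y x : Plane) : phase θ y x * phase θ (-y) x = 1 := by
  rw [phase, phase, ← Complex.exp_add, thetaInvForm_neg_left]
  simp

theorem phase_zero_left (θ : ℝ) (x : Plane) : phase θ 0 x = 1 := by
  simp [phase, thetaInvForm_eq]

theorem phase_add_right (θ : ℝ) (x y z : Plane) :
    phase θ x (y + z) = phase θ x y * phase θ x z := by
  rw [phase, phase, phase, ← Complex.exp_add, thetaInvForm_add_right]
  congr 1; push_cast; ring

theorem phase_swap (θ : ℝ) (x y : Plane) : phase θ x y = phase θ (-y) x := by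
  rw [phase, phase, thetaInvForm_neg_left, thetaInvForm_swap]

theorem phase_neg_right (θ : ℝ) (x y : Plane) : phase θ x (-y) = phase θ (-x) y := by
  rw [phase, phase, thetaInvForm_neg_left, thetaInvForm_neg_right]

theorem phase_self (θ : ℝ) (x : Plane) : phase θ x x = 1 := by
  have : thetaInvForm θ x x = 0 := by simp [thetaInvForm_eq]; ring_nf; simp
  simp [phase, this]

theorem hasTemperateGrowth_thetaInvForm (θ : ℝ) (y : Plane) :
    Function.HasTemperateGrowth (thetaInvForm θ y) := by
  have hc : ∀ i : Fin 2, Function.HasTemperateGrowth (fun x : Plane => x i) := fun i =>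
    (EuclideanSpace.proj (𝕜 := ℝ) i).hasTemperateGrowth
  rw [show thetaInvForm θ y = fun x => θ⁻¹ * (y 1 * x 0 - y 0 * x 1) from
    funext fun x => thetaInvForm_eq θ y x]
  exact (Function.HasTemperateGrowth.const _).mul
    (((Function.HasTemperateGrowth.const _).mul (hc 0)).sub
      ((Function.HasTemperateGrowth.const _).mul (hc 1)))

theorem hasTemperateGrowth_phase_right (θ : ℝ) (y : Plane) :
    Function.HasTemperateGrowth (phase θ y) :=
  hasTemperateGrowth_cexp_I.comp (f := fun x : Plane => 2 * thetaInvForm θ y x)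
    ((Function.HasTemperateGrowth.const 2).mul (hasTemperateGrowth_thetaInvForm θ y))

theorem continuous_phase (θ : ℝ) : Continuous (fun p : Plane × Plane => phase θ p.1 p.2) := by
  have h : Continuous (fun p : Plane × Plane => 2 * (θ⁻¹ * (p.1 1 * p.2 0 - p.1 0 * p.2 1))) := by
    fun_prop
  simp only [phase, thetaInvForm_eq]
  exact Complex.continuous_exp.comp ((Complex.continuous_ofReal.comp h).mul continuous_const)

theorem continuous_phase_comp {X : Type} [TopologicalSpace X] (θ : ℝ) {u v : X → Plane}
    (hu : Continuous u) (hv : Continuous v) : Continuous (fun x => phase θ (u x) (v x)) := by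
  have h : Continuous (fun x => (u x, v x)) := hu.prodMk hv
  have h2 := Continuous.comp (continuous_phase θ) h
  exact h2

/-- The twisted translation `f ↦ exp (2 i y^μ Θ⁻¹_{μν} x^ν) f (x + y)`, out of which the right
Moyal multiplications are built. -/
noncomputable def transRight (θ : ℝ) (y : Plane) : 𝓢(Plane, ℂ) →L[ℂ] 𝓢(Plane, ℂ) :=
  smulLeftCLM ℂ (phase θ y) ∘L compSubConstCLM ℂ (-y)

theorem transRight_apply (θ : ℝ) (y : Plane) (f : 𝓢(Plane, ℂ)) (x : Plane) :
    transRight θ y f x = phase θ y x * f (x + y) := by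
  rw [transRight, ContinuousLinearMap.comp_apply,
    smulLeftCLM_apply_apply (hasTemperateGrowth_phase_right θ y)]
  simp

/-- The symbol of a Moyal multiplication: the coefficient of the twisted translation by `y` in the
multiplication operator of `g`. -/
noncomputable def symbol (θ : ℝ) [hθ : Fact (0 < θ)] : 𝓢(Plane, ℂ) →L[ℂ] 𝓢(Plane, ℂ) :=
  (1 / (Real.pi * θ) ^ 2 : ℂ) • moyalKernel θ hθ.out.ne'

variable {θ : ℝ} [hθ : Fact (0 < θ)]

theorem symbol_apply (g : 𝓢(Plane, ℂ)) (y : Plane) :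
    symbol θ g y = (1 / (Real.pi * θ) ^ 2 : ℂ) * ∫ w : Plane, g w * phase θ (-y) w := by
  have : symbol θ g y = (1 / (Real.pi * θ) ^ 2 : ℂ) * moyalKernel θ hθ.out.ne' g y := rfl
  rw [this, moyalKernel_apply]
  simp only [phase, thetaInvForm_neg_left]
  congr 1
  refine integral_congr_ae (Filter.Eventually.of_forall fun w => ?_)
  simp only
  congr 2
  push_cast
  ring

/-- The right factor enters only through its symbol and the left one only through twisted
translations; all later estimates are read off from this form. -/
theorem moyalMul_eq_integral_transRight (f g : 𝓢(Plane, ℂ)) (x : Plane) :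
    moyalMul θ f g x = ∫ y, symbol θ g y * transRight θ y f x := by
  rw [moyalMul_apply, ← integral_const_mul]
  refine integral_congr_ae (Filter.Eventually.of_forall fun y => ?_)
  have : symbol θ g y = (1 / (Real.pi * θ) ^ 2 : ℂ) * moyalKernel θ hθ.out.ne' g y := rfl
  simp only [moyalIntegrand_apply, transRight_apply, this, phase]
  ring

theorem symbol_conj (f : 𝓢(Plane, ℂ)) (y : Plane) :
    symbol θ (conj f) y = starRingEnd ℂ (symbol θ f (-y)) := by
  rw [symbol_apply, symbol_apply, map_mul, ← integral_conj]
  congr 1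
  · simp
  · simp only [map_mul, conj_apply, conj_phase, neg_neg]

/-! ### Conjugation, the left expansion and associativity -/

theorem conj_conj (f : 𝓢(Plane, ℂ)) : conj (conj f) = f := by
  ext x; simp [conj_apply]

theorem conj_add (f g : 𝓢(Plane, ℂ)) : conj (f + g) = conj f + conj g := map_add _ _ _

theorem conj_sub (f g : 𝓢(Plane, ℂ)) : conj (f - g) = conj f - conj g := map_sub _ _ _

theorem conj_smul (z : ℂ) (f : 𝓢(Plane, ℂ)) : conj (z • f) = starRingEnd ℂ z • conj f := by
  ext x; simp [conj_apply]

theorem exists_norm_le (f : 𝓢(Plane, ℂ)) : ∃ M : ℝ, 0 ≤ M ∧ ∀ x, ‖f x‖ ≤ M :=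
  ⟨SchwartzMap.seminorm ℝ 0 0 f, apply_nonneg _ _, norm_le_seminorm ℝ f⟩

/-- The common justification for exchanging double integrals: phases have modulus one, so the
integrands are dominated by a product of Schwartz functions. -/
theorem integrable_tensor_mul {k l : 𝓢(Plane, ℂ)} {F : Plane × Plane → ℂ} {M : ℝ}
    (hF : Continuous F) (hM : ∀ p, ‖F p‖ ≤ M) :
    Integrable (fun p : Plane × Plane => k p.1 * l p.2 * F p) := by
  refine (((k.integrable (μ := volume)).mul_prod (l.integrable (μ := volume))).norm.const_mul
    M).mono' (by fun_prop) (Filter.Eventually.of_forall fun p => ?_)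
  rw [norm_mul, mul_comm]
  exact mul_le_mul_of_nonneg_right (hM p) (norm_nonneg _)

/-- Carrying out the integration over the argument of `f` first, instead of that of `g`, produces
the symbol of `f`. -/
theorem moyalMul_eq_integral_left (f g : 𝓢(Plane, ℂ)) (x : Plane) :
    moyalMul θ f g x = ∫ z, symbol θ f z * (phase θ z x * g (x - z)) := by
  have h0 : moyalMul θ f g x = (1 / (Real.pi * θ) ^ 2 : ℂ) * ∫ y : Plane, ∫ z : Plane,
    f (x + y) * g (x + z) * phase θ (-y) z := by
    refine congrArg (fun t : ℂ => (1 / (Real.pi * θ) ^ 2 : ℂ) * t)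
      (integral_congr_ae (Filter.Eventually.of_forall fun y =>
      integral_congr_ae (Filter.Eventually.of_forall fun z => ?_)))
    simp only [phase, thetaInvForm_neg_left]
    congr 2
    push_cast
    ring
  have hint := integrable_tensor_mul (k := compSubConstCLM ℂ (-x) f)
    (l := compSubConstCLM ℂ (-x) g) (F := fun p => phase θ (-p.1) p.2) (M := 1)
    (continuous_phase_comp θ (by fun_prop) (by fun_prop)) (fun p => (norm_phase _ _ _).le)
  simp only [compSubConstCLM_apply, sub_neg_eq_add] at hint
  rw [h0, integral_integral_swap (hint.congr (Filter.Eventually.of_forall fun p => by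
      simp only [Function.uncurry, add_comm])),
    ← integral_const_mul, ← integral_neg_eq_self]
  refine integral_congr_ae (Filter.Eventually.of_forall fun z => ?_)
  simp only
  rw [symbol_apply, mul_assoc, ← integral_add_left_eq_self (fun w => f w * phase θ (-z) w) x, ← sub_eq_add_neg]
  congr 1
  rw [← integral_mul_const]
  refine integral_congr_ae (Filter.Eventually.of_forall fun y => ?_)
  simp only
  rw [phase_add_right, phase_neg_right, neg_neg, phase_swap θ y z,
    show f (x + y) * (phase θ (-z) x * phase θ (-z) y) * (phase θ z x * g (x - z)) =
      (phase θ z x * phase θ (-z) x) * (f (x + y) * g (x - z) * phase θ (-z) y) by ring,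
    phase_mul_phase_neg, one_mul]

/-- Conjugation reflects the symbol, and the substitution `y ↦ -y` then turns the left expansion
into the right one. -/
theorem conj_moyalMul (f g : 𝓢(Plane, ℂ)) :
    conj (moyalMul θ f g) = moyalMul θ (conj g) (conj f) := by
  ext x
  rw [conj_apply, moyalMul_eq_integral_left, moyalMul_eq_integral_transRight, ← integral_conj,
    ← integral_neg_eq_self]
  refine integral_congr_ae (Filter.Eventually.of_forall fun y => ?_)
  simp only [map_mul, conj_phase, neg_neg, sub_neg_eq_add, transRight_apply, symbol_conj,
    conj_apply]

/-- Expanding in the symbols of the two outer factors `f` and `h` leaves a left and a right twisted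
translation acting on `g`. These commute, and Fubini finishes. -/
theorem moyalMul_assoc (f g h : 𝓢(Plane, ℂ)) :
    moyalMul θ (moyalMul θ f g) h = moyalMul θ f (moyalMul θ g h) := by
  ext x
  obtain ⟨M, hM0, hM⟩ := exists_norm_le g
  rw [moyalMul_eq_integral_left f, moyalMul_eq_integral_transRight _ h]
  simp only [transRight_apply, moyalMul_eq_integral_left f, moyalMul_eq_integral_transRight _ h,
    ← integral_const_mul]
  have hint := integrable_tensor_mul (k := symbol θ h) (l := symbol θ f) (M := M)
    (F := fun p => phase θ p.1 x * phase θ p.2 (x + p.1) * g (x + p.1 - p.2))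
    (((continuous_phase_comp θ (by fun_prop) (by fun_prop)).mul
      (continuous_phase_comp θ (by fun_prop) (by fun_prop))).mul (by fun_prop))
    (fun p => by simpa using hM _)
  rw [integral_integral_swap
    (hint.congr (Filter.Eventually.of_forall fun p => by
      simp only [Function.uncurry]; ring))]
  refine integral_congr_ae (Filter.Eventually.of_forall fun z =>
    integral_congr_ae (Filter.Eventually.of_forall fun y => ?_))
  simp only
  rw [phase_add_right, sub_eq_add_neg, sub_eq_add_neg, phase_add_right, phase_neg_right, phase_swap θ z y,
    show x + y + -z = x + -z + y by abel]
  ring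

theorem add_moyalMul (f g h : 𝓢(Plane, ℂ)) :
    moyalMul θ (f + g) h = moyalMul θ f h + moyalMul θ g h := by
  rw [← conj_conj (moyalMul θ (f + g) h), conj_moyalMul, conj_add, moyalMul_add, conj_add,
    conj_moyalMul, conj_moyalMul, conj_conj, conj_conj, conj_conj]

theorem smul_moyalMul (c : ℂ) (f g : 𝓢(Plane, ℂ)) :
    moyalMul θ (c • f) g = c • moyalMul θ f g := by
  rw [← conj_conj (moyalMul θ (c • f) g), conj_moyalMul, conj_smul, moyalMul_smul, conj_smul,
    conj_moyalMul, conj_conj, conj_conj, Complex.conj_conj]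

theorem isInvolutiveAlgebra_moyalMul : IsInvolutiveAlgebra (moyalMul θ) conj where
  mul_add := moyalMul_add θ
  add_mul := add_moyalMul
  smul_mul := smul_moyalMul
  mul_smul c f g := moyalMul_smul θ c f g
  mul_assoc := moyalMul_assoc
  inv_add := conj_add
  inv_smul := conj_smul
  inv_mul := conj_moyalMul
  inv_inv := conj_conj

end Moyal

namespace Moyal

variable {θ : ℝ}

/-! ### Coordinates and derivatives -/

theorem xTilde_zero (θ : ℝ) (x : Plane) : xTilde θ 0 x = -(2 * (θ⁻¹ * x 1)) := by
  simp [xTilde, thetaMatrix_inv, Fin.sum_univ_two]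

theorem xTilde_one (θ : ℝ) (x : Plane) : xTilde θ 1 x = 2 * (θ⁻¹ * x 0) := by
  simp [xTilde, thetaMatrix_inv, Fin.sum_univ_two]

theorem xTilde_add (θ : ℝ) (μ : Fin 2) (x y : Plane) :
    xTilde θ μ (x + y) = xTilde θ μ x + xTilde θ μ y := by
  fin_cases μ <;> simp [xTilde_zero, xTilde_one] <;> ring

theorem two_mul_thetaInvForm (θ : ℝ) (y x : Plane) :
    2 * thetaInvForm θ y x = ∑ μ, y μ * xTilde θ μ x := by
  rw [thetaInvForm_eq, Fin.sum_univ_two, xTilde_zero, xTilde_one]; ring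

theorem two_mul_thetaInvForm_single (θ : ℝ) (y : Plane) (μ : Fin 2) :
    2 * thetaInvForm θ y (EuclideanSpace.single μ 1) = -xTilde θ μ y := by
  rw [thetaInvForm_eq]
  fin_cases μ <;> simp [xTilde_zero, xTilde_one]

theorem thetaInvForm_smul_left (θ t : ℝ) (x y : Plane) :
    thetaInvForm θ (t • x) y = t * thetaInvForm θ x y := by
  simp [thetaInvForm_eq]; ring

theorem thetaInvForm_smul_right (θ t : ℝ) (x y : Plane) :
    thetaInvForm θ x (t • y) = t * thetaInvForm θ x y := by
  simp [thetaInvForm_eq]; ring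

theorem hasDerivAt_comp_line (f : 𝓢(Plane, ℂ)) (x e : Plane) (t : ℝ) :
    HasDerivAt (fun t : ℝ => f (x + t • e)) (fderiv ℝ f (x + t • e) e) t := by
  have h : HasDerivAt (fun t : ℝ => x + t • e) e t := by
    simpa using ((hasDerivAt_id t).smul_const e).const_add x
  exact (f.hasFDerivAt (x + t • e)).comp_hasDerivAt t h

theorem hasDerivAt_phase_line (θ : ℝ) (y x e : Plane) (t : ℝ) :
    HasDerivAt (fun t : ℝ => phase θ y (x + t • e))
      (((2 * thetaInvForm θ y e : ℝ) * I) * phase θ y (x + t • e)) t := by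
  have h : HasDerivAt (fun t : ℝ => 2 * thetaInvForm θ y (x + t • e))
      (2 * thetaInvForm θ y e) t := by
    simp only [thetaInvForm_add_right, thetaInvForm_smul_right]
    simpa using (((hasDerivAt_id t).mul_const (thetaInvForm θ y e)).const_add _).const_mul 2
  have h2 := (h.ofReal_comp.mul_const I).cexp
  rw [mul_comm] at h2
  exact h2

theorem partialDeriv_eq_of_hasDerivAt {f : 𝓢(Plane, ℂ)} {μ : Fin 2} {x : Plane} {c : ℂ}
    (h : HasDerivAt (fun t : ℝ => f (x + t • EuclideanSpace.single μ 1)) c 0) :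
    partialDeriv μ f x = c := by
  have h2 := hasDerivAt_comp_line f x (EuclideanSpace.single μ 1) 0
  rw [zero_smul, add_zero, ← partialDeriv_apply] at h2
  exact h2.unique h

theorem fderiv_apply_eq_sum (f : 𝓢(Plane, ℂ)) (x e : Plane) :
    fderiv ℝ f x e = ∑ μ, (e μ : ℂ) * partialDeriv μ f x := by
  have he : e = ∑ μ, e μ • EuclideanSpace.single μ (1 : ℝ) := by
    ext i; fin_cases i <;> simp [Fin.sum_univ_two]
  conv_lhs => rw [he]
  simp [partialDeriv_apply]

/-- The extra term, from differentiating the phase, is what `symbol_partialDeriv` turns into a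
derivative of the other factor. -/
theorem partialDeriv_transRight (y : Plane) (f : 𝓢(Plane, ℂ)) (μ : Fin 2) :
    partialDeriv μ (transRight θ y f) =
      (-(xTilde θ μ y : ℂ) * I) • transRight θ y f + transRight θ y (partialDeriv μ f) := by
  ext x
  refine partialDeriv_eq_of_hasDerivAt ?_
  have h1 := hasDerivAt_phase_line θ y x (EuclideanSpace.single μ 1) 0
  have h2 := hasDerivAt_comp_line f (x + y) (EuclideanSpace.single μ 1) 0
  have h3 := h1.mul h2
  simp only [zero_smul, add_zero, ← partialDeriv_apply, two_mul_thetaInvForm_single] at h3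
  have h4 : (fun t : ℝ => transRight θ y f (x + t • EuclideanSpace.single μ 1)) =
      (fun t : ℝ => phase θ y (x + t • EuclideanSpace.single μ 1)) *
        fun t : ℝ => f (x + y + t • EuclideanSpace.single μ 1) := by
    funext t
    simp only [transRight_apply, Pi.mul_apply]
    rw [show x + t • EuclideanSpace.single μ (1 : ℝ) + y =
      x + y + t • EuclideanSpace.single μ (1 : ℝ) by abel]
  rw [h4]
  refine h3.congr_deriv ?_
  simp only [add_apply, smul_apply, smul_eq_mul, transRight_apply]
  push_cast
  ring

theorem integrable_mul_transRight (f k : 𝓢(Plane, ℂ)) (x : Plane) :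
    Integrable (fun y => k y * transRight θ y f x) := by
  obtain ⟨M, -, hM⟩ := exists_norm_le f
  refine ((k.integrable (μ := volume)).norm.const_mul M).mono' ?_
    (Filter.Eventually.of_forall fun y => ?_)
  · simp only [transRight_apply]
    exact (k.continuous.mul ((continuous_phase_comp θ continuous_id continuous_const).mul
      (f.continuous.comp (by fun_prop)))).aestronglyMeasurable
  · rw [norm_mul, mul_comm, transRight_apply, norm_mul, norm_phase, one_mul]
    exact mul_le_mul_of_nonneg_right (hM _) (norm_nonneg _)

/-- Left Moyal multiplication by the coordinate `x̃_μ`. -/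
noncomputable def coordLeft (θ : ℝ) (μ : Fin 2) : 𝓢(Plane, ℂ) →ₗ[ℂ] 𝓢(Plane, ℂ) :=
  mulXTilde θ μ + I • partialDeriv μ

/-- Right Moyal multiplication by the coordinate `x̃_μ`. -/
noncomputable def coordRight (θ : ℝ) (μ : Fin 2) : 𝓢(Plane, ℂ) →ₗ[ℂ] 𝓢(Plane, ℂ) :=
  mulXTilde θ μ - I • partialDeriv μ

theorem coordLeft_eq (μ : Fin 2) (f : 𝓢(Plane, ℂ)) :
    coordLeft θ μ f = mulXTilde θ μ f + I • partialDeriv μ f := rfl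

theorem coordRight_eq (μ : Fin 2) (f : 𝓢(Plane, ℂ)) :
    coordRight θ μ f = mulXTilde θ μ f - I • partialDeriv μ f := rfl

theorem conj_partialDeriv (μ : Fin 2) (f : 𝓢(Plane, ℂ)) :
    conj (partialDeriv μ f) = partialDeriv μ (conj f) := by
  ext x
  refine (partialDeriv_eq_of_hasDerivAt ?_).symm
  have h := hasDerivAt_comp_line f x (EuclideanSpace.single μ 1) 0
  rw [zero_smul, add_zero, ← partialDeriv_apply] at h
  exact (Complex.conjCLE : ℂ →L[ℝ] ℂ).hasFDerivAt.comp_hasDerivAt 0 h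

theorem conj_mulXTilde (μ : Fin 2) (f : 𝓢(Plane, ℂ)) :
    conj (mulXTilde θ μ f) = mulXTilde θ μ (conj f) := by
  ext x
  simp [conj_apply, mulXTilde_apply]

theorem conj_coordLeft (μ : Fin 2) (f : 𝓢(Plane, ℂ)) :
    conj (coordLeft θ μ f) = coordRight θ μ (conj f) := by
  simp [coordLeft_eq, coordRight_eq, conj_add, conj_smul, conj_partialDeriv, conj_mulXTilde,
    sub_eq_add_neg]

theorem conj_coordRight (μ : Fin 2) (f : 𝓢(Plane, ℂ)) :
    conj (coordRight θ μ f) = coordLeft θ μ (conj f) := by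
  rw [← conj_conj (coordLeft θ μ _), conj_coordLeft, conj_conj]

theorem mulXTilde_eq_left (μ : Fin 2) (f : 𝓢(Plane, ℂ)) :
    mulXTilde θ μ f = coordLeft θ μ f - I • partialDeriv μ f := by
  rw [coordLeft_eq]; abel

theorem mulXTilde_eq_right (μ : Fin 2) (f : 𝓢(Plane, ℂ)) :
    mulXTilde θ μ f = coordRight θ μ f + I • partialDeriv μ f := by
  rw [coordRight_eq]; abel

/-! ### Derivations and coordinate multiplications of the Moyal algebra -/

variable [hθ : Fact (0 < θ)]

/-- The Fourier transform makes `∂_μ` a multiplication by `2πi` times the frequency, and at the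
frequency `freqEquiv` this is `-i x̃_μ(y)`. -/
theorem symbol_partialDeriv (g : 𝓢(Plane, ℂ)) (μ : Fin 2) (y : Plane) :
    symbol θ (partialDeriv μ g) y = (-(xTilde θ μ y : ℂ) * I) * symbol θ g y := by
  have hθ0 : (θ : ℂ) ≠ 0 := by exact_mod_cast hθ.out.ne'
  have hpi : (Real.pi : ℂ) ≠ 0 := by exact_mod_cast Real.pi_ne_zero
  have h : ∀ g : 𝓢(Plane, ℂ), symbol θ g y =
      (1 / (Real.pi * θ) ^ 2 : ℂ) * (𝓕 g) (freqEquiv θ hθ.out.ne' y) := fun g => rfl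
  have hg : (inner ℝ · (EuclideanSpace.single μ (1 : ℝ)) : Plane → ℝ).HasTemperateGrowth :=
    ((innerSL ℝ).flip (EuclideanSpace.single μ (1 : ℝ))).hasTemperateGrowth
  have h2 : partialDeriv μ g = ∂_{EuclideanSpace.single μ (1 : ℝ)} g := rfl
  rw [h, h, h2, fourier_lineDerivOp_eq, smul_apply, smulLeftCLM_apply_apply hg]
  fin_cases μ
  · simp [xTilde_zero, freqEquiv, PiLp.inner_apply]
    field_simp
  · simp [xTilde_one, freqEquiv, PiLp.inner_apply]
    field_simp

theorem partialDeriv_moyalMul_eq_integral (f g : 𝓢(Plane, ℂ)) (μ : Fin 2) (x : Plane) :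
    partialDeriv μ (moyalMul θ f g) x =
      ∫ y, symbol θ g y * partialDeriv μ (transRight θ y f) x := by
  set c : ℂ := 1 / (Real.pi * θ) ^ 2 with hc
  set Φ := moyalIntegrand θ hθ.out.ne' f g with hΦ
  have hΦ2 : ∀ x y, c * Φ (x, y) = symbol θ g y * transRight θ y f x := by
    intro x y
    have : symbol θ g y = c * moyalKernel θ hθ.out.ne' g y := rfl
    rw [hΦ, moyalIntegrand_apply, transRight_apply, this, phase]
    ring
  have h1 : HasFDerivAt (moyalMul θ f g) (c • ∫ y, derivFst Φ (x, y)) x := by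
    have h := (hasFDerivAt_partialIntegral Φ x).const_mul c
    rw [show (moyalMul θ f g : Plane → ℂ) = fun x => c * ∫ y, Φ (x, y) from
      funext fun x => moyalMul_apply θ f g x]
    exact h
  rw [partialDeriv_apply, h1.fderiv, _root_.smul_apply,
    ContinuousLinearMap.integral_apply (section_integrable _ x), smul_eq_mul,
    ← integral_const_mul]
  refine integral_congr_ae (Filter.Eventually.of_forall fun y => ?_)
  have h2 : HasFDerivAt (fun x => c * Φ (x, y)) (c • derivFst Φ (x, y)) x :=
    ((Φ.hasFDerivAt (x, y)).comp x (hasFDerivAt_prodMk_left x y)).const_mul c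
  have h3 : HasFDerivAt (fun x => symbol θ g y * transRight θ y f x)
      (symbol θ g y • fderiv ℝ (transRight θ y f) x) x :=
    ((transRight θ y f).hasFDerivAt x).const_mul _
  simp only [hΦ2] at h2
  -- Both are derivatives in `x` of the same function, so uniqueness identifies the integrands with
  -- no explicit computation of `derivFst`.
  have h4 := congrArg (fun A : Plane →L[ℝ] ℂ => A (EuclideanSpace.single μ 1)) (h2.unique h3)
  simpa [partialDeriv_apply] using h4

theorem partialDeriv_moyalMul (f g : 𝓢(Plane, ℂ)) (μ : Fin 2) :
    partialDeriv μ (moyalMul θ f g) =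
      moyalMul θ (partialDeriv μ f) g + moyalMul θ f (partialDeriv μ g) := by
  ext x
  rw [partialDeriv_moyalMul_eq_integral, add_apply, moyalMul_eq_integral_transRight,
    moyalMul_eq_integral_transRight, ← integral_add (integrable_mul_transRight _ _ _)
      (integrable_mul_transRight _ _ _)]
  refine integral_congr_ae (Filter.Eventually.of_forall fun y => ?_)
  simp only [partialDeriv_transRight, symbol_partialDeriv, add_apply, smul_apply, smul_eq_mul]
  ring

/-- Differentiating the phase in `i∂_μ` contributes `x̃_μ(y)`. Added to the factor `x̃_μ(x)` it
gives `x̃_μ(x + y)`, the coordinate at the point where `f` is evaluated. -/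
theorem coordLeft_moyalMul (f g : 𝓢(Plane, ℂ)) (μ : Fin 2) :
    coordLeft θ μ (moyalMul θ f g) = moyalMul θ (coordLeft θ μ f) g := by
  ext x
  rw [coordLeft_eq, add_apply, smul_apply, smul_eq_mul, mulXTilde_apply,
    partialDeriv_moyalMul_eq_integral, moyalMul_eq_integral_transRight,
    moyalMul_eq_integral_transRight, ← integral_const_mul, ← integral_const_mul]
  have h1 := (integrable_mul_transRight (θ := θ) f (symbol θ g) x).const_mul
    (xTilde θ μ x : ℂ)
  have h2 := ((integrable_mul_transRight (θ := θ) f (symbol θ (partialDeriv μ g)) x).add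
    (integrable_mul_transRight (θ := θ) (partialDeriv μ f) (symbol θ g) x)).const_mul I
  rw [← integral_add h1 (h2.congr (Filter.Eventually.of_forall fun y => by
    simp only [partialDeriv_transRight, symbol_partialDeriv, add_apply, smul_apply, smul_eq_mul,
      Pi.add_apply]
    ring))]
  refine integral_congr_ae (Filter.Eventually.of_forall fun y => ?_)
  simp only [partialDeriv_transRight, add_apply, smul_apply, smul_eq_mul, transRight_apply,
    coordLeft_eq, mulXTilde_apply, xTilde_add, ofReal_add]
  linear_combination (-symbol θ g y * xTilde θ μ y * phase θ y x * f (x + y)) * I_sq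

theorem coordRight_moyalMul (f g : 𝓢(Plane, ℂ)) (μ : Fin 2) :
    coordRight θ μ (moyalMul θ f g) = moyalMul θ f (coordRight θ μ g) := by
  rw [← conj_conj (coordRight θ μ _), conj_coordRight, conj_moyalMul, coordLeft_moyalMul,
    conj_moyalMul, conj_conj, conj_coordLeft, conj_conj]

/-- As `coordRight` commutes with `f ⋆ ·`, only the derivative part of `m(x̃_μ)` contributes to its
commutator with `L(f)`. -/
theorem mulXTilde_moyalMul_left (f g : 𝓢(Plane, ℂ)) (μ : Fin 2) :
    mulXTilde θ μ (moyalMul θ f g) =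
      moyalMul θ f (mulXTilde θ μ g) + I • moyalMul θ (partialDeriv μ f) g := by
  rw [mulXTilde_eq_right, coordRight_moyalMul, partialDeriv_moyalMul, mulXTilde_eq_right μ g,
    moyalMul_add, moyalMul_smul, smul_add]
  abel

theorem mulXTilde_moyalMul_right (f g : 𝓢(Plane, ℂ)) (μ : Fin 2) :
    mulXTilde θ μ (moyalMul θ f g) =
      moyalMul θ (mulXTilde θ μ f) g - I • moyalMul θ f (partialDeriv μ g) := by
  rw [mulXTilde_eq_left, coordLeft_moyalMul, partialDeriv_moyalMul, mulXTilde_eq_left μ f,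
    sub_eq_add_neg _ (I • partialDeriv μ f), ← neg_smul, add_moyalMul, smul_moyalMul, smul_add,
    neg_smul]
  abel

/-- Associativity with the unbounded element `x̃_μ` in the middle, obtained by equating the two
expansions of `x̃_μ (f ⋆ g)`. It lets a coordinate acting on a spinor be moved onto the algebra
element. -/
theorem moyalMul_coordLeft (f g : 𝓢(Plane, ℂ)) (μ : Fin 2) :
    moyalMul θ f (coordLeft θ μ g) = moyalMul θ (coordRight θ μ f) g := by
  have h1 := mulXTilde_moyalMul_left (θ := θ) f g μ
  have h2 := mulXTilde_moyalMul_right (θ := θ) f g μ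
  rw [coordLeft_eq, coordRight_eq, moyalMul_add, moyalMul_smul,
    sub_eq_add_neg _ (I • partialDeriv μ f), ← neg_smul, add_moyalMul, smul_moyalMul]
  rw [h1] at h2
  rw [neg_smul, ← sub_eq_add_neg, ← sub_eq_zero]
  rw [← sub_eq_zero] at h2
  rw [← h2]
  abel

end Moyal

namespace Moyal

variable {θ : ℝ}

/-! ### Estimates in `L²` -/

/-- The inclusion of the Schwartz space in `L²(ℝ²)`. -/
noncomputable def toL2 : 𝓢(Plane, ℂ) →L[ℂ] L2Plane := toLpCLM ℂ ℂ 2 (volume : Measure Plane)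

theorem toL2_apply (f : 𝓢(Plane, ℂ)) : toL2 f = f.toLp 2 := rfl

theorem denseRange_toL2 : DenseRange toL2 :=
  denseRange_toLpCLM (F := ℂ) (p := 2) (μ := (volume : Measure Plane)) (by simp)

theorem toL2_injective : Function.Injective toL2 :=
  SchwartzMap.injective_toLp 2 (volume : Measure Plane)

theorem inner_toL2 (f g : 𝓢(Plane, ℂ)) :
    inner ℂ (toL2 f) (toL2 g) = ∫ x, starRingEnd ℂ (f x) * g x := by
  refine (SchwartzMap.inner_toL2_toL2_eq f g volume).trans ?_
  simp [RCLike.inner_apply, mul_comm]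

theorem norm_toL2 (f : 𝓢(Plane, ℂ)) : ‖toL2 f‖ = (∫ x, ‖f x‖ ^ (2 : ℝ)) ^ (2 : ℝ)⁻¹ := by
  rw [toL2_apply, norm_toLp' (by simp) (by simp)]
  simp

theorem norm_toL2_conj (f : 𝓢(Plane, ℂ)) : ‖toL2 (conj f)‖ = ‖toL2 f‖ := by
  simp [norm_toL2, conj_apply]

theorem norm_toL2_transRight (y : Plane) (f : 𝓢(Plane, ℂ)) :
    ‖toL2 (transRight θ y f)‖ = ‖toL2 f‖ := by
  simp only [norm_toL2, transRight_apply, norm_mul, norm_phase, one_mul]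
  rw [integral_add_right_eq_self (fun x => ‖f x‖ ^ (2 : ℝ)) y]

/-- Allows `L²` bounds on integrals of functions to be checked weakly, with scalar integrals only;
the test function is `F` itself. -/
theorem norm_toL2_le_of_inner {F : 𝓢(Plane, ℂ)} {C : ℝ} (hC : 0 ≤ C)
    (h : ∀ φ : 𝓢(Plane, ℂ), ‖inner ℂ (toL2 φ) (toL2 F)‖ ≤ C * ‖toL2 φ‖) : ‖toL2 F‖ ≤ C := by
  rcases (norm_nonneg (toL2 F)).eq_or_lt with h0 | h0
  · rwa [← h0]
  · have h1 := h F
    rw [inner_self_eq_norm_sq_to_K, norm_pow] at h1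
    simp only [coe_algebraMap, norm_real, norm_norm] at h1
    nlinarith

theorem integrable_transRight_tensor (φ k f : 𝓢(Plane, ℂ)) :
    Integrable (fun p : Plane × Plane => conj φ p.1 * k p.2 * transRight θ p.2 f p.1) := by
  obtain ⟨M, -, hM⟩ := exists_norm_le f
  refine integrable_tensor_mul (M := M) ?_ fun p => ?_
  · simp only [transRight_apply]
    exact (continuous_phase_comp θ continuous_snd continuous_fst).mul
      (f.continuous.comp (by fun_prop))
  · simpa [transRight_apply] using hM _

theorem integrable_mul_inner_transRight (φ k f : 𝓢(Plane, ℂ)) :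
    Integrable (fun y => k y * inner ℂ (toL2 φ) (toL2 (transRight θ y f))) := by
  refine (integrable_transRight_tensor (θ := θ) φ k f).integral_prod_right.congr
    (Filter.Eventually.of_forall fun y => ?_)
  simp only [inner_toL2, ← integral_const_mul, conj_apply]
  refine integral_congr_ae (Filter.Eventually.of_forall fun x => ?_)
  simp only
  ring

/-- `coordRight` generates the twisted translations, which form a one-parameter group along each
line. -/
theorem hasDerivAt_transRight (y : Plane) (f : 𝓢(Plane, ℂ)) (x : Plane) (t : ℝ) :
    HasDerivAt (fun t : ℝ => transRight θ (t • y) f x)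
      (transRight θ (t • y) (I • ∑ μ, (y μ : ℂ) • coordRight θ μ f) x) t := by
  have h1 : HasDerivAt (fun t : ℝ => phase θ (t • y) x)
      (((2 * thetaInvForm θ y x : ℝ) * I) * phase θ (t • y) x) t := by
    have h : HasDerivAt (fun t : ℝ => 2 * thetaInvForm θ (t • y) x) (2 * thetaInvForm θ y x) t := by
      simp only [thetaInvForm_smul_left]
      simpa using ((hasDerivAt_id t).mul_const (thetaInvForm θ y x)).const_mul 2
    have h2 := (h.ofReal_comp.mul_const I).cexp
    rw [mul_comm] at h2
    exact h2
  have h3 := h1.mul (hasDerivAt_comp_line f x y t)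
  have h4 : (fun t : ℝ => transRight θ (t • y) f x) =
      (fun t : ℝ => phase θ (t • y) x) * fun t : ℝ => f (x + t • y) :=
    funext fun t => transRight_apply θ _ f x
  rw [h4]
  refine h3.congr_deriv ?_
  -- The form is alternating, so moving `x` along `y` does not change it; this puts the coordinate
  -- at the point where the generator is evaluated.
  have h5 : 2 * thetaInvForm θ y x = 2 * thetaInvForm θ y (x + t • y) := by
    have : thetaInvForm θ y y = 0 := by rw [thetaInvForm_eq]; ring
    rw [thetaInvForm_add_right, thetaInvForm_smul_right, this]; ring
  rw [h5, two_mul_thetaInvForm, fderiv_apply_eq_sum, transRight_apply]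
  simp only [smul_apply, smul_eq_mul, Fin.sum_univ_two, add_apply, coordRight_eq, sub_apply,
    mulXTilde_apply]
  push_cast
  linear_combination (phase θ (t • y) x * ((y 0 : ℂ) * partialDeriv 0 f (x + t • y) +
    (y 1 : ℂ) * partialDeriv 1 f (x + t • y))) * I_sq

/-- Mean value inequality on `[0, 1]` for the matrix coefficients `t ↦ ⟨φ, T_{ty} f⟩`. The twisted
translations being isometric, the derivative is bounded by the norm of the generator applied to `f`.
-/
theorem norm_toL2_transRight_sub_le (y : Plane) (f : 𝓢(Plane, ℂ)) :
    ‖toL2 (transRight θ y f - f)‖ ≤ ∑ μ, |y μ| * ‖toL2 (coordRight θ μ f)‖ := by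
  set w : 𝓢(Plane, ℂ) := I • ∑ μ, (y μ : ℂ) • coordRight θ μ f with hw
  have hwn : ‖toL2 w‖ ≤ ∑ μ, |y μ| * ‖toL2 (coordRight θ μ f)‖ := by
    rw [hw, map_smul, norm_smul, norm_I, one_mul, map_sum]
    refine (norm_sum_le _ _).trans (Finset.sum_le_sum fun μ _ => ?_)
    rw [map_smul, norm_smul, norm_real, Real.norm_eq_abs]
  refine le_trans (norm_toL2_le_of_inner (norm_nonneg (toL2 w)) fun φ => ?_) hwn
  obtain ⟨M, hM0, hM⟩ := exists_norm_le w
  have hcont : ∀ (t : ℝ) (g : 𝓢(Plane, ℂ)),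
      Integrable (fun x => starRingEnd ℂ (φ x) * transRight θ (t • y) g x) := by
    intro t g
    obtain ⟨N, -, hN⟩ := exists_norm_le (transRight θ (t • y) g)
    have h := ((conj φ).integrable (μ := volume)).mul_bdd (c := N)
      (transRight θ (t • y) g).continuous.aestronglyMeasurable (Filter.Eventually.of_forall hN)
    exact h
  have hderiv : ∀ t : ℝ, HasDerivAt
      (fun t : ℝ => inner ℂ (toL2 φ) (toL2 (transRight θ (t • y) f)))
      (inner ℂ (toL2 φ) (toL2 (transRight θ (t • y) w))) t := by
    intro t
    simp only [inner_toL2]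
    refine (hasDerivAt_integral_of_dominated_loc_of_deriv_le (s := Set.univ)
      (F := fun t x => starRingEnd ℂ (φ x) * transRight θ (t • y) f x)
      (F' := fun t x => starRingEnd ℂ (φ x) * transRight θ (t • y) w x)
      (bound := fun x => ‖φ x‖ * M) Filter.univ_mem
      (Filter.Eventually.of_forall fun t => (hcont t f).1) (hcont t f) (hcont t w).1 ?_
      ((φ.integrable (μ := volume)).norm.mul_const M) ?_).2
    · refine Filter.Eventually.of_forall fun x t _ => ?_
      rw [norm_mul, RCLike.norm_conj, transRight_apply, norm_mul, norm_phase, one_mul]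
      exact mul_le_mul_of_nonneg_left (hM _) (norm_nonneg _)
    · exact Filter.Eventually.of_forall fun x t _ => (hasDerivAt_transRight y f x t).const_mul _
  have h01 := norm_image_sub_le_of_norm_deriv_le_segment_01'
    (fun t _ => (hderiv t).hasDerivWithinAt) (C := ‖toL2 w‖ * ‖toL2 φ‖) fun t _ => by
      rw [mul_comm]
      exact (norm_inner_le_norm _ _).trans_eq (by rw [norm_toL2_transRight])
  have h0 : transRight θ (0 : Plane) f = f := by
    ext x; simp [transRight_apply, phase_zero_left]
  rw [one_smul, zero_smul, h0, ← inner_sub_right, ← map_sub] at h01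
  exact h01

theorem inner_transRight (y : Plane) (φ f : 𝓢(Plane, ℂ)) :
    inner ℂ (toL2 φ) (toL2 (transRight θ y f)) =
      inner ℂ (toL2 (transRight θ (-y) φ)) (toL2 f) := by
  simp only [inner_toL2, transRight_apply]
  rw [← integral_add_right_eq_self _ (-y)]
  refine integral_congr_ae (Filter.Eventually.of_forall fun x => ?_)
  simp only [map_mul, conj_phase, neg_neg, neg_add_cancel_right, phase_add_right, phase_neg_right]
  have : phase θ (-y) y = 1 := by rw [← phase_neg_right, phase_neg_right, ← phase_swap, phase_self]
  rw [this]
  ring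

theorem inner_toL2_conj (f g : 𝓢(Plane, ℂ)) :
    inner ℂ (toL2 (conj f)) (toL2 (conj g)) = inner ℂ (toL2 g) (toL2 f) := by
  simp only [inner_toL2, conj_apply, Complex.conj_conj, mul_comm]

theorem inner_mulXTilde (μ : Fin 2) (f g : 𝓢(Plane, ℂ)) :
    inner ℂ (toL2 f) (toL2 (mulXTilde θ μ g)) = inner ℂ (toL2 (mulXTilde θ μ f)) (toL2 g) := by
  simp only [inner_toL2, mulXTilde_apply, map_mul, Complex.conj_ofReal]
  refine integral_congr_ae (Filter.Eventually.of_forall fun x => ?_)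
  simp only
  ring

theorem inner_partialDeriv (μ : Fin 2) (f g : 𝓢(Plane, ℂ)) :
    inner ℂ (toL2 f) (toL2 (partialDeriv μ g)) = -inner ℂ (toL2 (partialDeriv μ f)) (toL2 g) := by
  simp only [inner_toL2, ← conj_apply, conj_partialDeriv]
  exact integral_mul_lineDerivOp_right_eq_neg_left (conj f) g _

variable [hθ : Fact (0 < θ)]

theorem inner_moyalMul (φ f g : 𝓢(Plane, ℂ)) :
    inner ℂ (toL2 φ) (toL2 (moyalMul θ f g)) =
      ∫ y, symbol θ g y * inner ℂ (toL2 φ) (toL2 (transRight θ y f)) := by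
  simp only [inner_toL2, moyalMul_eq_integral_transRight, ← integral_const_mul]
  rw [integral_integral_swap
    ((integrable_transRight_tensor (θ := θ) φ (symbol θ g) f).congr
      (Filter.Eventually.of_forall fun p => by simp only [Function.uncurry, conj_apply]; ring))]
  refine integral_congr_ae (Filter.Eventually.of_forall fun y =>
    integral_congr_ae (Filter.Eventually.of_forall fun x => ?_))
  simp only
  ring

/-- An average of isometries has norm at most the total mass of the weight. -/
theorem norm_toL2_moyalMul_le (f g : 𝓢(Plane, ℂ)) :
    ‖toL2 (moyalMul θ f g)‖ ≤ (∫ y, ‖symbol θ g y‖) * ‖toL2 f‖ := by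
  refine norm_toL2_le_of_inner (by positivity) fun φ => ?_
  rw [inner_moyalMul, mul_assoc, ← integral_mul_const]
  refine norm_integral_le_of_norm_le (((symbol θ g).integrable (μ := volume)).norm.mul_const _)
    (Filter.Eventually.of_forall fun y => ?_)
  rw [norm_mul]
  refine mul_le_mul_of_nonneg_left ((norm_inner_le_norm _ _).trans_eq ?_) (norm_nonneg _)
  rw [norm_toL2_transRight, mul_comm]

theorem integral_norm_symbol_conj (f : 𝓢(Plane, ℂ)) :
    ∫ y, ‖symbol θ (conj f) y‖ = ∫ y, ‖symbol θ f y‖ := by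
  rw [← integral_neg_eq_self]
  simp [symbol_conj]

theorem norm_toL2_moyalMul_le' (f g : 𝓢(Plane, ℂ)) :
    ‖toL2 (moyalMul θ f g)‖ ≤ (∫ y, ‖symbol θ f y‖) * ‖toL2 g‖ := by
  rw [← norm_toL2_conj, conj_moyalMul, ← norm_toL2_conj g, ← integral_norm_symbol_conj]
  exact norm_toL2_moyalMul_le _ _

/-- Right Moyal multiplication by `g` is close to the identity if the symbol of `g` is close to the
unit mass at the origin. -/
theorem norm_toL2_moyalMul_sub_le (f g : 𝓢(Plane, ℂ)) (hg : ∫ y, symbol θ g y = 1) :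
    ‖toL2 (moyalMul θ f g - f)‖ ≤
      ∑ μ, (∫ y, ‖symbol θ g y‖ * ‖y‖) * ‖toL2 (coordRight θ μ f)‖ := by
  have hint : Integrable (fun y => ‖symbol θ g y‖ * ‖y‖) := by
    simpa [mul_comm] using (symbol θ g).integrable_pow_mul volume 1
  refine norm_toL2_le_of_inner (by positivity) fun φ => ?_
  -- Unit mass puts `f` under the same integral, so the error is an average of the differences `T_y
  -- f - f`.
  have h1 : inner ℂ (toL2 φ) (toL2 f) = ∫ y, symbol θ g y * inner ℂ (toL2 φ) (toL2 f) := by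
    rw [integral_mul_const, hg, one_mul]
  rw [map_sub, inner_sub_right, inner_moyalMul, h1,
    ← integral_sub (integrable_mul_inner_transRight _ _ _)
      (((symbol θ g).integrable (μ := volume)).mul_const _), Finset.sum_mul]
  simp only [← integral_mul_const]
  rw [← integral_finsetSum _ fun μ _ => (hint.mul_const _).mul_const _]
  refine norm_integral_le_of_norm_le
    (integrable_finsetSum _ fun μ _ => (hint.mul_const _).mul_const _)
    (Filter.Eventually.of_forall fun y => ?_)
  rw [← mul_sub, ← inner_sub_right, ← map_sub, norm_mul]
  calc _ ≤ ‖symbol θ g y‖ * (‖toL2 φ‖ * ∑ μ, |y μ| * ‖toL2 (coordRight θ μ f)‖) := by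
        gcongr
        exact (norm_inner_le_norm _ _).trans (by gcongr; exact norm_toL2_transRight_sub_le y f)
    _ = ∑ μ, ‖symbol θ g y‖ * |y μ| * ‖toL2 (coordRight θ μ f)‖ * ‖toL2 φ‖ := by
        rw [Finset.mul_sum, Finset.mul_sum]
        exact Finset.sum_congr rfl fun μ _ => by ring
    _ ≤ _ := by
        gcongr with μ
        exact PiLp.norm_apply_le y μ

theorem integral_norm_symbol_mul_norm_conj (f : 𝓢(Plane, ℂ)) :
    ∫ y, ‖symbol θ (conj f) y‖ * ‖y‖ = ∫ y, ‖symbol θ f y‖ * ‖y‖ := by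
  rw [← integral_neg_eq_self]
  simp [symbol_conj]

theorem integral_symbol_conj (f : 𝓢(Plane, ℂ)) :
    ∫ y, symbol θ (conj f) y = starRingEnd ℂ (∫ y, symbol θ f y) := by
  rw [← integral_neg_eq_self]
  simp only [symbol_conj, neg_neg]
  exact integral_conj

theorem norm_toL2_moyalMul_sub_le' (f g : 𝓢(Plane, ℂ)) (hg : ∫ y, symbol θ g y = 1) :
    ‖toL2 (moyalMul θ g f - f)‖ ≤
      ∑ μ, (∫ y, ‖symbol θ g y‖ * ‖y‖) * ‖toL2 (coordLeft θ μ f)‖ := by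
  have h := norm_toL2_moyalMul_sub_le (θ := θ) (conj f) (conj g)
    (by rw [integral_symbol_conj, hg, map_one])
  rw [← conj_moyalMul, ← conj_sub, norm_toL2_conj, integral_norm_symbol_mul_norm_conj] at h
  simpa only [← conj_coordLeft, norm_toL2_conj] using h

theorem inner_moyalMul_right (φ f g : 𝓢(Plane, ℂ)) :
    inner ℂ (toL2 φ) (toL2 (moyalMul θ f g)) =
      inner ℂ (toL2 (moyalMul θ φ (conj g))) (toL2 f) := by
  rw [← inner_conj_symm (toL2 (moyalMul θ φ (conj g))), inner_moyalMul, inner_moyalMul,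
    ← integral_conj, ← integral_neg_eq_self]
  refine integral_congr_ae (Filter.Eventually.of_forall fun y => ?_)
  simp only [map_mul, symbol_conj, Complex.conj_conj, inner_transRight (-y), neg_neg,
    inner_conj_symm]

theorem inner_moyalMul_left (φ f g : 𝓢(Plane, ℂ)) :
    inner ℂ (toL2 φ) (toL2 (moyalMul θ f g)) =
      inner ℂ (toL2 (moyalMul θ (conj f) φ)) (toL2 g) := by
  rw [← inner_toL2_conj, conj_moyalMul, ← inner_conj_symm, inner_moyalMul_right, inner_conj_symm,
    ← inner_toL2_conj, conj_moyalMul, conj_conj]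
  simp only [conj_conj]

/-- Moyal multiplication maps `L²` to bounded functions. -/
theorem norm_moyalMul_apply_le (f g : 𝓢(Plane, ℂ)) (x : Plane) :
    ‖moyalMul θ f g x‖ ≤ ‖toL2 (symbol θ g)‖ * ‖toL2 f‖ := by
  rw [moyalMul_eq_integral_transRight]
  set h : 𝓢(Plane, ℂ) := smulLeftCLM ℂ (phase θ (-x)) (compSubConstCLM ℂ (-x) f) with hh
  -- At fixed `x` the integral over `y` is an `L²` pairing of the symbol with a phased translate of
  -- `f`, whose norm is that of `f`; Cauchy–Schwarz applies.
  have h1 : ∀ y, symbol θ g y * transRight θ y f x =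
      starRingEnd ℂ (conj (symbol θ g) y) * h y := by
    intro y
    rw [hh, smulLeftCLM_apply_apply (hasTemperateGrowth_phase_right θ _), transRight_apply,
      conj_apply, Complex.conj_conj, ← phase_swap]
    simp [add_comm]
  simp only [h1]
  rw [← inner_toL2]
  refine (norm_inner_le_norm _ _).trans_eq ?_
  rw [norm_toL2_conj]
  congr 1
  rw [norm_toL2, norm_toL2]
  congr 1
  rw [← integral_add_right_eq_self (fun y => ‖f y‖ ^ (2 : ℝ)) x]
  refine integral_congr_ae (Filter.Eventually.of_forall fun y => ?_)
  simp only [hh]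
  rw [smulLeftCLM_apply_apply (hasTemperateGrowth_phase_right θ _), smul_eq_mul, norm_mul,
    norm_phase, one_mul, compSubConstCLM_apply, sub_neg_eq_add]

end Moyal

namespace Moyal

variable {θ : ℝ} [hθ : Fact (0 < θ)]

/-! ### Left and right multiplication operators on `L²` -/

theorem continuousLinearMap_ext_toL2 {F : Type} [NormedAddCommGroup F] [NormedSpace ℂ F]
    {S T : L2Plane →L[ℂ] F} (h : ∀ f, S (toL2 f) = T (toL2 f)) : S = T :=
  ContinuousLinearMap.ext fun u =>
    congrFun (denseRange_toL2.equalizer S.continuous T.continuous (funext h)) u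

theorem opNorm_le_of_toL2 {F : Type} [NormedAddCommGroup F] [NormedSpace ℂ F]
    {T : L2Plane →L[ℂ] F} {C : ℝ} (hC : 0 ≤ C) (h : ∀ f, ‖T (toL2 f)‖ ≤ C * ‖toL2 f‖) :
    ‖T‖ ≤ C :=
  T.opNorm_le_bound hC fun u => denseRange_toL2.induction_on u
    (isClosed_le T.continuous.norm (continuous_const.mul continuous_norm)) h

theorem leftMul_toL2 (a f : 𝓢(Plane, ℂ)) : leftMul θ a (toL2 f) = toL2 (moyalMul θ a f) :=
  LinearMap.extendOfNorm_eq denseRange_toL2 ⟨_, norm_toL2_moyalMul_le' a⟩ f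

theorem norm_leftMul_le (a : 𝓢(Plane, ℂ)) : ‖leftMul θ a‖ ≤ ∫ y, ‖symbol θ a y‖ :=
  opNorm_le_of_toL2 (by positivity) fun f => by
    rw [leftMul_toL2]; exact norm_toL2_moyalMul_le' a f

/-- The linear map `ψ ↦ ψ ⋆ b` on Schwartz functions. -/
noncomputable def moyalRight (θ : ℝ) [Fact (0 < θ)] (b : 𝓢(Plane, ℂ)) :
    𝓢(Plane, ℂ) →ₗ[ℂ] 𝓢(Plane, ℂ) where
  toFun ψ := moyalMul θ ψ b
  map_add' f g := add_moyalMul f g b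
  map_smul' c f := smul_moyalMul c f b

/-- The operator on `L²(ℝ²)` extending `ψ ↦ ψ ⋆ b`. -/
noncomputable def rightMul (θ : ℝ) [Fact (0 < θ)] (b : 𝓢(Plane, ℂ)) : L2Plane →L[ℂ] L2Plane :=
  (toL2.toLinearMap ∘ₗ moyalRight θ b).extendOfNorm toL2.toLinearMap

theorem rightMul_toL2 (b f : 𝓢(Plane, ℂ)) : rightMul θ b (toL2 f) = toL2 (moyalMul θ f b) :=
  LinearMap.extendOfNorm_eq denseRange_toL2 ⟨_, fun f => norm_toL2_moyalMul_le f b⟩ f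

theorem norm_rightMul_le (b : 𝓢(Plane, ℂ)) : ‖rightMul θ b‖ ≤ ∫ y, ‖symbol θ b y‖ :=
  opNorm_le_of_toL2 (by positivity) fun f => by
    rw [rightMul_toL2]; exact norm_toL2_moyalMul_le f b

theorem leftMul_add (a b : 𝓢(Plane, ℂ)) : leftMul θ (a + b) = leftMul θ a + leftMul θ b :=
  continuousLinearMap_ext_toL2 fun f => by simp [leftMul_toL2, add_moyalMul]

theorem leftMul_smul (c : ℂ) (a : 𝓢(Plane, ℂ)) : leftMul θ (c • a) = c • leftMul θ a :=
  continuousLinearMap_ext_toL2 fun f => by simp [leftMul_toL2, smul_moyalMul]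

theorem leftMul_sub (a b : 𝓢(Plane, ℂ)) : leftMul θ (a - b) = leftMul θ a - leftMul θ b := by
  rw [sub_eq_add_neg, ← neg_one_smul ℂ, leftMul_add, leftMul_smul, neg_one_smul, ← sub_eq_add_neg]

theorem leftMul_mul (a b : 𝓢(Plane, ℂ)) :
    leftMul θ (moyalMul θ a b) = leftMul θ a ∘L leftMul θ b :=
  continuousLinearMap_ext_toL2 fun f => by simp [leftMul_toL2, moyalMul_assoc]

theorem leftMul_rightMul_comm (a b : 𝓢(Plane, ℂ)) (u : L2Plane) :
    leftMul θ a (rightMul θ b u) = rightMul θ b (leftMul θ a u) := by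
  have : leftMul θ a ∘L rightMul θ b = rightMul θ b ∘L leftMul θ a :=
    continuousLinearMap_ext_toL2 fun f => by simp [leftMul_toL2, rightMul_toL2, moyalMul_assoc]
  exact congrArg (fun T : L2Plane →L[ℂ] L2Plane => T u) this

theorem eq_adjoint_of_toL2 {S T : L2Plane →L[ℂ] L2Plane}
    (h : ∀ f g, inner ℂ (S (toL2 f)) (toL2 g) = inner ℂ (toL2 f) (T (toL2 g))) :
    S = ContinuousLinearMap.adjoint T := by
  rw [ContinuousLinearMap.eq_adjoint_iff]
  intro u v
  refine denseRange_toL2.induction_on₂ ?_ h u v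
  exact isClosed_eq (by fun_prop) (by fun_prop)

theorem leftMul_conj (a : 𝓢(Plane, ℂ)) :
    leftMul θ (conj a) = ContinuousLinearMap.adjoint (leftMul θ a) :=
  eq_adjoint_of_toL2 fun f g => by rw [leftMul_toL2, leftMul_toL2, inner_moyalMul_left]

theorem rightMul_conj (a : 𝓢(Plane, ℂ)) :
    rightMul θ (conj a) = ContinuousLinearMap.adjoint (rightMul θ a) :=
  eq_adjoint_of_toL2 fun f g => by rw [rightMul_toL2, rightMul_toL2, inner_moyalMul_right]

/-! ### Mollifiers -/

/-- Fourier inversion: an algebra element may be prescribed through its symbol. -/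
theorem symbol_bijective : Function.Bijective (symbol θ) := by
  set c : ℂ := 1 / (Real.pi * θ) ^ 2 with hc
  have hθ0 : (θ : ℂ) ≠ 0 := by exact_mod_cast hθ.out.ne'
  have hpi : (Real.pi : ℂ) ≠ 0 := by exact_mod_cast Real.pi_ne_zero
  have hc0 : c ≠ 0 := by
    rw [hc]; exact one_div_ne_zero (pow_ne_zero 2 (mul_ne_zero hpi hθ0))
  have h : ∀ (g : 𝓢(Plane, ℂ)) (y : Plane), symbol θ g y =
      c * (𝓕 g) (freqEquiv θ hθ.out.ne' y) := fun g y => rfl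
  constructor
  · intro f g hfg
    have : 𝓕 f = 𝓕 g := by
      ext y
      have h2 := DFunLike.congr_fun hfg ((freqEquiv θ hθ.out.ne').symm y)
      rw [h, h, ContinuousLinearEquiv.apply_symm_apply] at h2
      exact mul_left_cancel₀ hc0 h2
    have h3 := congrArg (fun k : 𝓢(Plane, ℂ) => (𝓕⁻ k : 𝓢(Plane, ℂ))) this
    simpa using h3
  · intro k
    refine ⟨𝓕⁻ (c⁻¹ • compCLMOfContinuousLinearEquiv ℂ (freqEquiv θ hθ.out.ne').symm k), ?_⟩
    ext y
    rw [h, FourierTransform.fourier_fourierInv_eq]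
    simp [hc0]

/-- `e` is real, and its symbol is a probability density with first moment at most `δ`. -/
structure IsMollifier (θ : ℝ) [Fact (0 < θ)] (δ : ℝ) (e : 𝓢(Plane, ℂ)) : Prop where
  conj_eq : conj e = e
  integral_symbol : ∫ y, symbol θ e y = 1
  integral_norm_symbol : ∫ y, ‖symbol θ e y‖ = 1
  integral_norm_symbol_mul : ∫ y, ‖symbol θ e y‖ * ‖y‖ ≤ δ

/-- The symbol is taken to be a normalized bump in the ball of radius `δ`. It is real and even,
which makes `e` real. -/
theorem exists_isMollifier {δ : ℝ} (hδ : 0 < δ) : ∃ e, IsMollifier θ δ e := by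
  let b : ContDiffBump (0 : Plane) := ⟨δ / 2, δ, by positivity, by linarith⟩
  have hsupp : HasCompactSupport fun y : Plane => ((b.normed volume y : ℝ) : ℂ) :=
    b.hasCompactSupport_normed.comp_left (g := fun t : ℝ => (t : ℂ)) (by simp)
  have hsm : ContDiff ℝ (⊤ : ℕ∞) fun y : Plane => ((b.normed volume y : ℝ) : ℂ) :=
    Complex.ofRealCLM.contDiff.comp b.contDiff_normed
  obtain ⟨e, he⟩ := (symbol_bijective (θ := θ)).2 (hsupp.toSchwartzMap hsm)
  have he' : ∀ y, symbol θ e y = ((b.normed volume y : ℝ) : ℂ) := fun y => by rw [he]; rfl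
  have hn : ∀ y, ‖symbol θ e y‖ = b.normed volume y := fun y => by
    rw [he', norm_real, Real.norm_of_nonneg (b.nonneg_normed y)]
  refine ⟨e, ?_, ?_, ?_, ?_⟩
  · refine (symbol_bijective (θ := θ)).1 (SchwartzMap.ext fun y => ?_)
    rw [symbol_conj, he', he', Complex.conj_ofReal, b.normed_neg]
  · simp only [he']
    exact (integral_ofReal (f := b.normed volume)).trans (by rw [b.integral_normed]; exact ofReal_one)
  · simp only [hn, b.integral_normed]
  · simp only [hn]
    have hint : Integrable (fun y => b.normed (volume : Measure Plane) y) := b.integrable_normed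
    calc _ ≤ ∫ y, b.normed (volume : Measure Plane) y * δ := by
          refine integral_mono_of_nonneg
            (Filter.Eventually.of_forall fun y => mul_nonneg (b.nonneg_normed y) (norm_nonneg _))
            (hint.mul_const δ) (Filter.Eventually.of_forall fun y => ?_)
          simp only
          by_cases hy : ‖y‖ ≤ δ
          · exact mul_le_mul_of_nonneg_left hy (b.nonneg_normed y)
          · have h0 : b.normed (volume : Measure Plane) y = 0 := by
              by_contra hne
              have : y ∈ Function.support (b.normed (volume : Measure Plane)) := hne
              rw [b.support_normed_eq, Metric.mem_ball, dist_zero_right] at this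
              exact hy this.le
            simp [h0]
      _ = δ := by rw [integral_mul_const, b.integral_normed, one_mul]

namespace IsMollifier

variable {δ : ℝ} {e : 𝓢(Plane, ℂ)}

theorem norm_leftMul_le_one (he : IsMollifier θ δ e) : ‖leftMul θ e‖ ≤ 1 :=
  (norm_leftMul_le e).trans_eq he.integral_norm_symbol

theorem norm_rightMul_le_one (he : IsMollifier θ δ e) : ‖rightMul θ e‖ ≤ 1 :=
  (norm_rightMul_le e).trans_eq he.integral_norm_symbol

theorem norm_leftMul_sub_le (he : IsMollifier θ δ e) (f : 𝓢(Plane, ℂ)) :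
    ‖leftMul θ e (toL2 f) - toL2 f‖ ≤ δ * ∑ μ, ‖toL2 (coordLeft θ μ f)‖ := by
  rw [leftMul_toL2, ← map_sub, Finset.mul_sum]
  exact (norm_toL2_moyalMul_sub_le' f e he.integral_symbol).trans
    (Finset.sum_le_sum fun μ _ =>
      mul_le_mul_of_nonneg_right he.integral_norm_symbol_mul (norm_nonneg _))

theorem norm_rightMul_sub_le (he : IsMollifier θ δ e) (f : 𝓢(Plane, ℂ)) :
    ‖rightMul θ e (toL2 f) - toL2 f‖ ≤ δ * ∑ μ, ‖toL2 (coordRight θ μ f)‖ := by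
  rw [rightMul_toL2, ← map_sub, Finset.mul_sum]
  exact (norm_toL2_moyalMul_sub_le f e he.integral_symbol).trans
    (Finset.sum_le_sum fun μ _ =>
      mul_le_mul_of_nonneg_right he.integral_norm_symbol_mul (norm_nonneg _))

theorem nonneg (he : IsMollifier θ δ e) : 0 ≤ δ :=
  le_trans (by positivity) he.integral_norm_symbol_mul

/-- Here the coordinate falls on `a` and not on the vector, which upgrades strong convergence to
convergence in operator norm. -/
theorem norm_leftMul_mul_sub_le (he : IsMollifier θ δ e) (a : 𝓢(Plane, ℂ)) :
    ‖leftMul θ (moyalMul θ e a) - leftMul θ a‖ ≤ δ * ∑ μ, ‖leftMul θ (coordLeft θ μ a)‖ := by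
  have := he.nonneg
  refine opNorm_le_of_toL2 (by positivity) fun f => ?_
  have h := he.norm_leftMul_sub_le (moyalMul θ a f)
  rw [leftMul_mul, _root_.sub_apply, ContinuousLinearMap.comp_apply, leftMul_toL2 a,
    mul_assoc, Finset.sum_mul]
  refine h.trans (mul_le_mul_of_nonneg_left (Finset.sum_le_sum fun μ _ => ?_) this)
  rw [coordLeft_moyalMul, ← leftMul_toL2]
  exact ContinuousLinearMap.le_opNorm _ _

/-- Differentiation multiplies the symbol by `-i x̃_μ(y)`, of modulus at most `2θ⁻¹‖y‖`, so the
first moment controls the integral. This makes the commutators with mollifiers small. -/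
theorem integral_norm_symbol_partialDeriv_le (he : IsMollifier θ δ e) (μ : Fin 2) :
    ∫ y, ‖symbol θ (partialDeriv μ e) y‖ ≤ 2 * θ⁻¹ * δ := by
  have hθ0 : 0 < θ⁻¹ := inv_pos.2 hθ.out
  have hint : Integrable (fun y => ‖symbol θ e y‖ * ‖y‖) := by
    simpa [mul_comm] using (symbol θ e).integrable_pow_mul volume 1
  calc _ ≤ ∫ y, 2 * θ⁻¹ * (‖symbol θ e y‖ * ‖y‖) := by
        refine integral_mono ((symbol θ _).integrable (μ := volume)).norm (hint.const_mul _)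
          fun y => ?_
        simp only [symbol_partialDeriv, norm_mul, norm_neg, norm_real, norm_I, mul_one]
        have : ‖xTilde θ μ y‖ ≤ 2 * θ⁻¹ * ‖y‖ := by
          have h0 := PiLp.norm_apply_le y 0
          have h1 := PiLp.norm_apply_le y 1
          fin_cases μ
          · simp only [Fin.zero_eta, xTilde_zero, norm_neg, norm_mul, Real.norm_of_nonneg hθ0.le,
              Real.norm_ofNat, mul_assoc]
            gcongr
          · simp only [Fin.mk_one, xTilde_one, norm_mul, Real.norm_of_nonneg hθ0.le,
              Real.norm_ofNat, mul_assoc]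
            gcongr
        calc _ ≤ 2 * θ⁻¹ * ‖y‖ * ‖symbol θ e y‖ := by gcongr
          _ = _ := by ring
    _ ≤ _ := by
        rw [integral_const_mul]
        exact mul_le_mul_of_nonneg_left he.integral_norm_symbol_mul (by positivity)

theorem norm_leftMul_partialDeriv_le (he : IsMollifier θ δ e) (μ : Fin 2) :
    ‖leftMul θ (partialDeriv μ e)‖ ≤ 2 * θ⁻¹ * δ :=
  (norm_leftMul_le _).trans (he.integral_norm_symbol_partialDeriv_le μ)

theorem norm_rightMul_partialDeriv_le (he : IsMollifier θ δ e) (μ : Fin 2) :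
    ‖rightMul θ (partialDeriv μ e)‖ ≤ 2 * θ⁻¹ * δ :=
  (norm_rightMul_le _).trans (he.integral_norm_symbol_partialDeriv_le μ)

end IsMollifier

/-- A bounded sequence of operators that converges strongly to the identity on Schwartz functions
converges strongly to the identity on `L²`. -/
theorem tendsto_apply_of_toL2 {T : ℕ → L2Plane →L[ℂ] L2Plane} (hT : ∀ n, ‖T n‖ ≤ 1)
    (h : ∀ f, Filter.Tendsto (fun n => T n (toL2 f)) Filter.atTop (nhds (toL2 f)))
    (u : L2Plane) : Filter.Tendsto (fun n => T n u) Filter.atTop (nhds u) := by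
  rw [Metric.tendsto_atTop]
  intro ε hε
  obtain ⟨f, hf⟩ := denseRange_toL2.exists_dist_lt u (show 0 < ε / 3 by positivity)
  obtain ⟨N, hN⟩ := Metric.tendsto_atTop.1 (h f) (ε / 3) (by positivity)
  refine ⟨N, fun n hn => ?_⟩
  have h1 : dist (T n u) (T n (toL2 f)) ≤ dist u (toL2 f) := by
    rw [dist_eq_norm, dist_eq_norm, ← map_sub]
    exact ((T n).le_of_opNorm_le (hT n) _).trans_eq (one_mul _)
  have h2 := dist_triangle4 (T n u) (T n (toL2 f)) (toL2 f) u
  have h3 := hN n hn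
  rw [dist_comm (toL2 f) u] at h2
  linarith

theorem tendsto_mul_const_zero {δ : ℕ → ℝ} (hδ : Filter.Tendsto δ Filter.atTop (nhds 0)) (C : ℝ) :
    Filter.Tendsto (fun n => δ n * C) Filter.atTop (nhds 0) := by
  simpa using hδ.mul_const C

theorem tendsto_leftMul_mollifier {δ : ℕ → ℝ} {e : ℕ → 𝓢(Plane, ℂ)}
    (he : ∀ n, IsMollifier θ (δ n) (e n)) (hδ : Filter.Tendsto δ Filter.atTop (nhds 0))
    (u : L2Plane) : Filter.Tendsto (fun n => leftMul θ (e n) u) Filter.atTop (nhds u) :=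
  tendsto_apply_of_toL2 (fun n => (he n).norm_leftMul_le_one) (fun f =>
    tendsto_iff_norm_sub_tendsto_zero.2 (squeeze_zero (fun _ => norm_nonneg _)
      (fun n => (he n).norm_leftMul_sub_le f) (tendsto_mul_const_zero hδ _))) u

theorem tendsto_rightMul_mollifier {δ : ℕ → ℝ} {e : ℕ → 𝓢(Plane, ℂ)}
    (he : ∀ n, IsMollifier θ (δ n) (e n)) (hδ : Filter.Tendsto δ Filter.atTop (nhds 0))
    (u : L2Plane) : Filter.Tendsto (fun n => rightMul θ (e n) u) Filter.atTop (nhds u) :=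
  tendsto_apply_of_toL2 (fun n => (he n).norm_rightMul_le_one) (fun f =>
    tendsto_iff_norm_sub_tendsto_zero.2 (squeeze_zero (fun _ => norm_nonneg _)
      (fun n => (he n).norm_rightMul_sub_le f) (tendsto_mul_const_zero hδ _))) u

variable (θ) in
theorem exists_seq_isMollifier : ∃ (δ : ℕ → ℝ) (e : ℕ → 𝓢(Plane, ℂ)),
    (∀ n, IsMollifier θ (δ n) (e n)) ∧ Filter.Tendsto δ Filter.atTop (nhds 0) := by
  have h : ∀ n : ℕ, ∃ e, IsMollifier θ (1 / ((n : ℝ) + 1)) e := fun n =>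
    exists_isMollifier (by positivity)
  choose e he using h
  exact ⟨_, e, he, tendsto_one_div_add_atTop_nhds_zero_nat⟩

/-- `L(a)` determines `a ⋆ e_n`, and these tend to `a` in `L²`. -/
theorem leftMul_injective : Function.Injective (leftMul θ) := by
  intro a b hab
  obtain ⟨δ, e, he, hδ⟩ := exists_seq_isMollifier θ
  refine toL2_injective ?_
  refine tendsto_nhds_unique (tendsto_rightMul_mollifier he hδ (toL2 a)) ?_
  convert tendsto_rightMul_mollifier he hδ (toL2 b) using 2 with n
  rw [rightMul_toL2, rightMul_toL2, ← leftMul_toL2, ← leftMul_toL2, hab]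

end Moyal

namespace Moyal

variable {θ : ℝ}

theorem mulXTilde_eq_half (μ : Fin 2) (f : 𝓢(Plane, ℂ)) :
    mulXTilde θ μ f = (1 / 2 : ℂ) • (coordLeft θ μ f + coordRight θ μ f) := by
  rw [coordLeft_eq, coordRight_eq]
  module

variable [hθ : Fact (0 < θ)]

/-! ### Compactness of `L(a) R(b)` -/

theorem isCompact_closure_of_seq {X : Type} [MetricSpace X] {s : Set X}
    (h : ∀ b : ℕ → X, (∀ n, b n ∈ s) →
      ∃ c, ∃ φ : ℕ → ℕ, StrictMono φ ∧ Filter.Tendsto (b ∘ φ) Filter.atTop (nhds c)) :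
    IsCompact (closure s) := by
  refine IsSeqCompact.isCompact fun w hw => ?_
  have hb : ∀ n : ℕ, ∃ b ∈ s, dist (w n) b < 1 / ((n : ℝ) + 1) := fun n =>
    Metric.mem_closure_iff.1 (hw n) _ (by positivity)
  choose b hbs hb using hb
  obtain ⟨c, φ, hφ, hc⟩ := h b hbs
  have h0 : Filter.Tendsto (fun n => dist (b (φ n)) (w (φ n))) Filter.atTop (nhds 0) := by
    refine squeeze_zero (fun _ => dist_nonneg) (fun n => ?_)
      (tendsto_one_div_add_atTop_nhds_zero_nat.comp hφ.tendsto_atTop)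
    rw [dist_comm]
    exact (hb _).le
  exact ⟨c, mem_closure_of_tendsto hc (Filter.Eventually.of_forall fun n => hbs _), φ, hφ,
    (tendsto_iff_of_dist h0).1 hc⟩

/-- A bounded sequence of a separable Hilbert space has a weakly convergent subsequence. -/
theorem exists_subseq_tendsto_inner {H : Type} [NormedAddCommGroup H] [InnerProductSpace ℂ H]
    [CompleteSpace H] [TopologicalSpace.SeparableSpace H] (v : ℕ → H) (hv : ∀ n, ‖v n‖ ≤ 1) :
    ∃ φ : ℕ → ℕ, StrictMono φ ∧
      ∀ w : H, ∃ c : ℂ, Filter.Tendsto (fun n => inner ℂ (v (φ n)) w) Filter.atTop (nhds c) := by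
  obtain ⟨l, -, φ, hφ, hl⟩ := WeakDual.isSeqCompact_closedBall ℂ H 0 1
    (x := fun n => StrongDual.toWeakDual (InnerProductSpace.toDual ℂ H (v n))) (fun n => by
      simpa using hv n)
  exact ⟨φ, hφ, fun w => ⟨l w, ((WeakDual.eval_continuous w).tendsto l).comp hl⟩⟩

/-- The pointwise bound `|K u (x)| ≤ C ‖u‖₂`. -/
def IsPointwiseBounded (K : 𝓢(Plane, ℂ) →ₗ[ℂ] 𝓢(Plane, ℂ)) : Prop :=
  ∃ C : ℝ, 0 ≤ C ∧ ∀ u x, ‖K u x‖ ≤ C * ‖toL2 u‖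

theorem IsPointwiseBounded.add {K K' : 𝓢(Plane, ℂ) →ₗ[ℂ] 𝓢(Plane, ℂ)}
    (hK : IsPointwiseBounded K) (hK' : IsPointwiseBounded K') : IsPointwiseBounded (K + K') := by
  obtain ⟨C, hC0, hC⟩ := hK
  obtain ⟨C', hC0', hC'⟩ := hK'
  refine ⟨C + C', by positivity, fun u x => ?_⟩
  rw [add_mul]
  exact (norm_add_le _ _).trans (add_le_add (hC u x) (hC' u x))

theorem IsPointwiseBounded.smul {K : 𝓢(Plane, ℂ) →ₗ[ℂ] 𝓢(Plane, ℂ)}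
    (hK : IsPointwiseBounded K) (c : ℂ) : IsPointwiseBounded (c • K) := by
  obtain ⟨C, hC0, hC⟩ := hK
  refine ⟨‖c‖ * C, by positivity, fun u x => ?_⟩
  rw [LinearMap.smul_apply, smul_apply, norm_smul, mul_assoc]
  exact mul_le_mul_of_nonneg_left (hC u x) (norm_nonneg _)

/-- The map `u ↦ a ⋆ u ⋆ b`. -/
noncomputable def moyalSandwich (θ : ℝ) [Fact (0 < θ)] (a b : 𝓢(Plane, ℂ)) :
    𝓢(Plane, ℂ) →ₗ[ℂ] 𝓢(Plane, ℂ) :=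
  moyalLeft θ a ∘ₗ moyalRight θ b

theorem moyalSandwich_apply (a b u : 𝓢(Plane, ℂ)) :
    moyalSandwich θ a b u = moyalMul θ a (moyalMul θ u b) := rfl

theorem isPointwiseBounded_moyalSandwich (a b : 𝓢(Plane, ℂ)) :
    IsPointwiseBounded (moyalSandwich θ a b) := by
  refine ⟨‖toL2 (symbol θ b)‖ * ∫ y, ‖symbol θ a y‖, by positivity, fun u x => ?_⟩
  rw [moyalSandwich_apply, ← moyalMul_assoc, mul_assoc]
  exact (norm_moyalMul_apply_le _ _ x).trans
    (mul_le_mul_of_nonneg_left (norm_toL2_moyalMul_le' a u) (norm_nonneg _))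

/-- Multiplication by `x̃_μ` is the mean of its left and right Moyal multiplications, which are
absorbed by the outer factors. The result again consists of sandwiches, so decay of any polynomial
order can be obtained by iteration. -/
theorem mulXTilde_comp_moyalSandwich (a b : 𝓢(Plane, ℂ)) (μ : Fin 2) :
    mulXTilde θ μ ∘ₗ moyalSandwich θ a b = (1 / 2 : ℂ) •
      (moyalSandwich θ (coordLeft θ μ a) b + moyalSandwich θ a (coordRight θ μ b)) := by
  refine LinearMap.ext fun u => ?_
  simp only [LinearMap.comp_apply, moyalSandwich_apply, mulXTilde_eq_half, LinearMap.smul_apply,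
    LinearMap.add_apply, coordLeft_moyalMul, coordRight_moyalMul]

theorem isPointwiseBounded_mulXTilde (a b : 𝓢(Plane, ℂ)) (μ : Fin 2) :
    IsPointwiseBounded (mulXTilde θ μ ∘ₗ moyalSandwich θ a b) := by
  rw [mulXTilde_comp_moyalSandwich]
  exact ((isPointwiseBounded_moyalSandwich _ _).add (isPointwiseBounded_moyalSandwich _ _)).smul _

theorem isPointwiseBounded_mulXTilde_mulXTilde (a b : 𝓢(Plane, ℂ)) (μ : Fin 2) :
    IsPointwiseBounded (mulXTilde θ μ ∘ₗ mulXTilde θ μ ∘ₗ moyalSandwich θ a b) := by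
  rw [mulXTilde_comp_moyalSandwich, LinearMap.comp_smul, LinearMap.comp_add]
  exact ((isPointwiseBounded_mulXTilde _ _ _).add (isPointwiseBounded_mulXTilde _ _ _)).smul _

theorem exists_moyalSandwich_decay (a b : 𝓢(Plane, ℂ)) : ∃ C : ℝ, 0 ≤ C ∧
    ∀ u x, ‖moyalSandwich θ a b u x‖ ≤ C * (1 + ‖x‖ ^ 2) ^ (-1 : ℝ) * ‖toL2 u‖ := by
  have hθ0 : 0 < θ := hθ.out
  obtain ⟨C, hC0, hC⟩ := isPointwiseBounded_moyalSandwich (θ := θ) a b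
  obtain ⟨C0, hC00, hC0'⟩ := isPointwiseBounded_mulXTilde_mulXTilde (θ := θ) a b 0
  obtain ⟨C1, hC10, hC1'⟩ := isPointwiseBounded_mulXTilde_mulXTilde (θ := θ) a b 1
  -- The factor comes from `|x|² = (θ/2)² (x̃_0² + x̃_1²)`.
  refine ⟨C + (θ / 2) ^ 2 * (C0 + C1), by positivity, fun u x => ?_⟩
  have h0 := hC u x
  have h1 := hC0' u x
  have h2 := hC1' u x
  simp only [LinearMap.comp_apply, mulXTilde_apply, norm_mul, norm_real, ← mul_assoc,
    Real.norm_eq_abs, abs_mul_abs_self] at h1 h2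
  have hx : 1 + ‖x‖ ^ 2 = 1 + (θ / 2) ^ 2 * (xTilde θ 0 x * xTilde θ 0 x +
      xTilde θ 1 x * xTilde θ 1 x) := by
    rw [EuclideanSpace.norm_sq_eq, Fin.sum_univ_two, xTilde_zero, xTilde_one]
    simp only [Real.norm_eq_abs, sq_abs]
    field_simp
    ring
  have hpos : 0 < 1 + ‖x‖ ^ 2 := by positivity
  rw [Real.rpow_neg_one, mul_right_comm, ← div_eq_mul_inv, le_div_iff₀ hpos, hx]
  have := mul_le_mul_of_nonneg_left h1 (sq_nonneg (θ / 2))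
  have := mul_le_mul_of_nonneg_left h2 (sq_nonneg (θ / 2))
  linarith

instance separableSpace_L2Plane : TopologicalSpace.SeparableSpace L2Plane :=
  haveI : Fact ((2 : ℝ≥0∞) ≠ ⊤) := ⟨by simp⟩
  inferInstance

/-- Weak convergence of a subsequence gives pointwise convergence of its images, and the uniform
decay gives convergence in `L²` by dominated convergence. -/
theorem exists_subseq_tendsto_moyalSandwich (a b : 𝓢(Plane, ℂ)) (u : ℕ → 𝓢(Plane, ℂ))
    (hu : ∀ n, ‖toL2 (u n)‖ ≤ 1) : ∃ c, ∃ φ : ℕ → ℕ, StrictMono φ ∧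
      Filter.Tendsto (fun n => toL2 (moyalSandwich θ a b (u (φ n)))) Filter.atTop (nhds c) := by
  obtain ⟨φ, hφ, hw⟩ := exists_subseq_tendsto_inner (fun n => toL2 (u n)) hu
  obtain ⟨C, hC0, hC⟩ := exists_moyalSandwich_decay (θ := θ) a b
  have hpt : ∀ x, ∃ c, Filter.Tendsto (fun n => moyalSandwich θ a b (u (φ n)) x)
      Filter.atTop (nhds c) := by
    intro x
    -- By the pointwise bound, evaluation at `x` after the sandwich extends to a bounded functional
    -- on `L²`, hence is an inner product with a fixed vector and is seen by weak convergence.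
    let ev : 𝓢(Plane, ℂ) →ₗ[ℂ] ℂ :=
      { toFun := fun f => moyalSandwich θ a b f x
        map_add' := fun f g => by simp
        map_smul' := fun c f => by simp }
    let l : L2Plane →L[ℂ] ℂ := ev.extendOfNorm toL2.toLinearMap
    have hl : ∀ f, l (toL2 f) = moyalSandwich θ a b f x := fun f =>
      LinearMap.extendOfNorm_eq denseRange_toL2 ⟨_, fun f => hC f x⟩ f
    obtain ⟨c, hc⟩ := hw ((InnerProductSpace.toDual ℂ L2Plane).symm l)
    refine ⟨starRingEnd ℂ c, ?_⟩
    have h := (Complex.continuous_conj.tendsto c).comp hc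
    refine h.congr fun n => ?_
    rw [Function.comp_apply, inner_conj_symm, InnerProductSpace.toDual_symm_apply, hl]
  have hcau : CauchySeq fun n => toL2 (moyalSandwich θ a b (u (φ n))) := by
    rw [cauchySeq_iff_tendsto_dist_atTop_0]
    -- The squared bound decays like `|x|⁻⁴`, which is integrable in dimension two.
    have hint : Integrable fun x : Plane => ((2 * C) * (1 + ‖x‖ ^ 2) ^ (-1 : ℝ)) ^ (2 : ℝ) := by
      have h : Integrable fun x : Plane => (2 * C) ^ (2 : ℝ) * (1 + ‖x‖ ^ 2) ^ (-(4 : ℝ) / 2) :=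
        (integrable_rpow_neg_one_add_norm_sq (E := Plane) (μ := volume) (r := 4)
          (by norm_num)).const_mul _
      refine h.congr (Filter.Eventually.of_forall fun x => ?_)
      have : 0 ≤ 1 + ‖x‖ ^ 2 := by positivity
      simp only
      rw [Real.mul_rpow (x := 2 * C) (by positivity) (by positivity), ← Real.rpow_mul this]
      norm_num
    have hlim : Filter.Tendsto (fun p : ℕ × ℕ => ∫ x, ‖(moyalSandwich θ a b (u (φ p.1)) -
        moyalSandwich θ a b (u (φ p.2))) x‖ ^ (2 : ℝ)) Filter.atTop (nhds (∫ _ : Plane, 0)) := by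
      refine tendsto_integral_filter_of_dominated_convergence _
        (Filter.Eventually.of_forall fun p => ?_) (Filter.Eventually.of_forall fun p =>
          Filter.Eventually.of_forall fun x => ?_) hint
        (Filter.Eventually.of_forall fun x => ?_)
      · exact ((moyalSandwich θ a b (u (φ p.1)) -
          moyalSandwich θ a b (u (φ p.2))).continuous.norm.rpow_const
            fun _ => Or.inr (by norm_num)).aestronglyMeasurable
      · rw [Real.norm_of_nonneg (by positivity)]
        gcongr
        have h1 := (hC (u (φ p.1)) x).trans
          (mul_le_of_le_one_right (by positivity) (hu (φ p.1)))
        have h2 := (hC (u (φ p.2)) x).trans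
          (mul_le_of_le_one_right (by positivity) (hu (φ p.2)))
        rw [sub_apply]
        exact (norm_sub_le _ _).trans (by linarith)
      · obtain ⟨c, hc⟩ := hpt x
        have h1 : Filter.Tendsto (fun p : ℕ × ℕ => moyalSandwich θ a b (u (φ p.1)) x -
            moyalSandwich θ a b (u (φ p.2)) x) Filter.atTop (nhds (c - c)) := by
          rw [← Filter.prod_atTop_atTop_eq]
          exact (hc.comp Filter.tendsto_fst).sub (hc.comp Filter.tendsto_snd)
        have h2 := h1.norm.rpow_const (p := (2 : ℝ)) (Or.inr (by norm_num))
        simpa using h2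
    rw [integral_zero] at hlim
    have h3 := hlim.rpow_const (p := (2 : ℝ)⁻¹) (Or.inr (by norm_num))
    rw [Real.zero_rpow (by norm_num)] at h3
    refine h3.congr fun p => ?_
    rw [dist_eq_norm, ← map_sub toL2, norm_toL2]
  obtain ⟨c, hc⟩ := cauchySeq_tendsto_of_complete hcau
  exact ⟨c, φ, hφ, hc⟩

/-- Schwartz functions are dense in the open unit ball, so relative compactness need only be tested
on their images. -/
theorem isCompactOperator_leftMul_rightMul (a b : 𝓢(Plane, ℂ)) :
    IsCompactOperator (leftMul θ a ∘L rightMul θ b) := by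
  set T := leftMul θ a ∘L rightMul θ b with hT
  have hTf : ∀ f, T (toL2 f) = toL2 (moyalSandwich θ a b f) := fun f => by
    rw [hT, ContinuousLinearMap.comp_apply, rightMul_toL2, leftMul_toL2, moyalSandwich_apply]
  set s : Set L2Plane := Metric.ball 0 1 ∩ Set.range toL2 with hs
  rw [isCompactOperator_iff_exists_mem_nhds_image_subset_compact]
  refine ⟨Metric.ball 0 1, Metric.ball_mem_nhds 0 one_pos, closure (T '' s), ?_, ?_⟩
  · refine isCompact_closure_of_seq fun w hw => ?_
    have hw' : ∀ n, ∃ f, ‖toL2 f‖ ≤ 1 ∧ T (toL2 f) = w n := fun n => by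
      obtain ⟨_, ⟨h1, f, rfl⟩, h2⟩ := hw n
      exact ⟨f, (mem_ball_zero_iff.1 h1).le, h2⟩
    choose f hf1 hf2 using hw'
    obtain ⟨c, φ, hφ, hc⟩ := exists_subseq_tendsto_moyalSandwich (θ := θ) a b f hf1
    refine ⟨c, φ, hφ, hc.congr fun n => ?_⟩
    rw [Function.comp_apply, ← hf2, hTf]
  · have h1 : Metric.ball (0 : L2Plane) 1 ⊆ closure s :=
      denseRange_toL2.open_subset_closure_inter Metric.isOpen_ball
    exact (Set.image_mono h1).trans (image_closure_subset_closure_image T.continuous)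

end Moyal

namespace LinearPMap

/-! ### Closures of symmetric operators -/

variable {H : Type} [NormedAddCommGroup H] [InnerProductSpace ℂ H] {T : H →ₗ.[ℂ] H}

theorem isClosable_of_isFormalAdjoint [CompleteSpace H] (hd : Dense (T.domain : Set H))
    (hs : T.IsFormalAdjoint T) : T.IsClosable :=
  (adjoint_isClosed hd).isClosable.leIsClosable (hs.le_adjoint hd)

theorem closure_graph_subset (hc : T.IsClosable) {S : Set (H × H)} (hS : _root_.IsClosed S)
    (h : ∀ u v, (u, v) ∈ T.graph → (u, v) ∈ S) : (T.closure.graph : Set (H × H)) ⊆ S := by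
  rw [← hc.graph_closure_eq_closure_graph, Submodule.topologicalClosure_coe]
  exact closure_minimal (fun p hp => h p.1 p.2 hp) hS

theorem graph_le_closure_graph : T.graph ≤ T.closure.graph := le_graph_of_le T.le_closure

theorem inner_of_mem_closure_graph (hc : T.IsClosable) {u w : H}
    (h : ∀ φ ψ, (φ, ψ) ∈ T.graph → inner ℂ ψ u = inner ℂ φ w) {φ ψ : H}
    (hφ : (φ, ψ) ∈ T.closure.graph) : inner ℂ ψ u = inner ℂ φ w :=
  closure_graph_subset hc (S := {p | inner ℂ p.2 u = inner ℂ p.1 w})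
    (isClosed_eq (by fun_prop) (by fun_prop)) h hφ

theorem inner_eq_of_isFormalAdjoint (hs : T.IsFormalAdjoint T) {u v φ ψ : H}
    (h1 : (u, v) ∈ T.graph) (h2 : (φ, ψ) ∈ T.graph) : inner ℂ ψ u = inner ℂ φ v := by
  obtain ⟨a, rfl, rfl⟩ := (mem_graph_iff _).1 h1
  obtain ⟨b, rfl, rfl⟩ := (mem_graph_iff _).1 h2
  exact hs b a

/-- Symmetry passes to the closure in one argument at a time. -/
theorem closure_symmetric (hc : T.IsClosable) (hs : T.IsFormalAdjoint T) {u v φ ψ : H}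
    (h1 : (u, v) ∈ T.closure.graph) (h2 : (φ, ψ) ∈ T.closure.graph) :
    inner ℂ ψ u = inner ℂ φ v := by
  refine inner_of_mem_closure_graph hc (fun φ' ψ' h' => ?_) h2
  have h3 := inner_of_mem_closure_graph hc (u := φ') (w := ψ')
    (fun φ ψ h => inner_eq_of_isFormalAdjoint hs h' h) h1
  rw [← inner_conj_symm, ← h3, inner_conj_symm]

/-- A closed symmetric operator is self-adjoint if bounded operators regularize it. -/
theorem isSelfAdjoint_closure [CompleteSpace H] (hd : Dense (T.domain : Set H))
    (hs : T.IsFormalAdjoint T) {J G B : ℕ → H →L[ℂ] H}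
    (hJadj : ∀ n, ContinuousLinearMap.adjoint (J n) = J n)
    (hG : ∀ n u v, (u, v) ∈ T.graph → (J n u, G n u) ∈ T.closure.graph)
    (hB : ∀ n u v, (u, v) ∈ T.graph → G n u = J n v + B n u)
    (hJ : ∀ u, Filter.Tendsto (fun n => J n u) Filter.atTop (nhds u))
    (hB0 : Filter.Tendsto (fun n => ‖B n‖) Filter.atTop (nhds 0)) :
    IsSelfAdjoint T.closure := by
  have hc := isClosable_of_isFormalAdjoint hd hs
  have hcd : Dense (T.closure.domain : Set H) := hd.mono T.le_closure.1
  have hclosed : _root_.IsClosed (T.closure.graph : Set (H × H)) := hc.closure_isClosed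
  have hG' : ∀ n u, (J n u, G n u) ∈ T.closure.graph := by
    intro n u
    -- Both operators are bounded and the closure has a closed graph, so `J n` maps all of `H` into
    -- the domain, with `G n` equal to the closed operator composed with `J n`.
    have hcl : _root_.IsClosed {u | (J n u, G n u) ∈ T.closure.graph} :=
      hclosed.preimage ((J n).continuous.prodMk (G n).continuous)
    exact hcl.closure_subset_iff.2 (fun x hx => hG n x _ (T.mem_graph ⟨x, hx⟩)) (hd u)
  rw [isSelfAdjoint_def]
  refine le_antisymm ?_ (IsFormalAdjoint.le_adjoint hcd fun x y =>
    closure_symmetric hc hs (T.closure.mem_graph y) (T.closure.mem_graph x))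
  refine le_of_le_graph fun p hp => ?_
  obtain ⟨a, ha1, ha2⟩ := (mem_graph_iff _).1 hp
  have hpair : ∀ φ ψ, (φ, ψ) ∈ T.closure.graph → inner ℂ ψ p.1 = inner ℂ φ p.2 := by
    intro φ ψ h
    obtain ⟨b, rfl, rfl⟩ := (mem_graph_iff _).1 h
    have := adjoint_isFormalAdjoint hcd a b
    rw [ha1, ha2] at this
    rw [← inner_conj_symm, ← this, inner_conj_symm]
  -- Tested on a core vector `φ`: `⟨φ, G p₁⟩ = ⟨Tφ, J p₁⟩ = ⟨J Tφ, p₁⟩ = ⟨Gφ - Bφ, p₁⟩ = ⟨Jφ, p₂⟩ -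
  -- ⟨Bφ, p₁⟩`.
  have key : ∀ n, G n p.1 = J n p.2 - ContinuousLinearMap.adjoint (B n) p.1 := by
    intro n
    refine hd.eq_of_inner_right ℂ fun φ hφ => ?_
    have hg := T.mem_graph ⟨φ, hφ⟩
    have h1 := closure_symmetric hc hs (hG' n p.1) (graph_le_closure_graph hg)
    have h2 := hpair _ _ (hG' n φ)
    have h3 := hB n _ _ hg
    rw [inner_sub_right, ContinuousLinearMap.adjoint_inner_right, ← h1, ← hJadj n,
      ContinuousLinearMap.adjoint_inner_right, ContinuousLinearMap.adjoint_inner_right,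
      ← h2, h3, inner_add_left]
    ring
  have hB1 : Filter.Tendsto (fun n => ContinuousLinearMap.adjoint (B n) p.1) Filter.atTop
      (nhds 0) := by
    refine squeeze_zero_norm (fun n => ?_) (by simpa using hB0.mul_const ‖p.1‖)
    exact (ContinuousLinearMap.le_opNorm _ _).trans_eq
      (by rw [LinearIsometryEquiv.norm_map])
  -- The pairs `(J p₁, G p₁)` lie in the closed graph and converge to the given pair `p` of the
  -- adjoint.
  refine hclosed.mem_of_tendsto ((hJ p.1).prodMk_nhds
    (by simpa using (hJ p.2).sub hB1)) (Filter.Eventually.of_forall fun n => ?_)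
  rw [SetLike.mem_coe, ← key]
  exact hG' n p.1

theorem mem_closure_graph_of_commutator (hc : T.IsClosable) {A C : H →L[ℂ] H}
    (h : ∀ u v, (u, v) ∈ T.graph → (A u, A v + C u) ∈ T.closure.graph) {u v : H}
    (huv : (u, v) ∈ T.closure.graph) : (A u, A v + C u) ∈ T.closure.graph :=
  closure_graph_subset hc (S := {p | (A p.1, A p.2 + C p.1) ∈ T.closure.graph})
    (hc.closure_isClosed.preimage (by fun_prop)) h huv

end LinearPMap

/-! ### The Lipschitz seminorm as the norm of a bounded operator -/

namespace Moyal.TripleData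

variable {A H : Type} [AddCommGroup A] [Module ℂ A] [NormedAddCommGroup H]
  [InnerProductSpace ℂ H] {T : TripleData A H}

/-- `S` is an everywhere defined bounded extension of the commutator, so a bound on the dense domain
is a bound on its norm. -/
theorem commutatorBound_iff (hd : Dense (T.dirac.domain : Set H)) {a : A} {S : H →L[ℂ] H}
    (h : ∀ u v, (u, v) ∈ T.dirac.graph → (T.rep a u, T.rep a v + S u) ∈ T.dirac.graph) (C : ℝ≥0) :
    T.CommutatorBound a C ↔ ‖S‖ ≤ C := by
  have key : ∀ ψ : T.dirac.domain, ∃ h : T.rep a ψ ∈ T.dirac.domain,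
      T.dirac ⟨T.rep a ψ, h⟩ - T.rep a (T.dirac ψ) = S ψ := by
    intro ψ
    obtain ⟨b, hb1, hb2⟩ := (LinearPMap.mem_graph_iff _).1 (h _ _ (T.dirac.mem_graph ψ))
    have hm : T.rep a ψ ∈ T.dirac.domain := by
      rw [show T.rep a ψ = b from hb1.symm]
      exact b.2
    refine ⟨hm, ?_⟩
    rw [show (⟨T.rep a ψ, hm⟩ : T.dirac.domain) = b from Subtype.ext hb1.symm, hb2]
    exact add_sub_cancel_left _ _
  constructor
  · intro hC
    have hcl : IsClosed {u | ‖S u‖ ≤ C * ‖u‖} :=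
      isClosed_le S.continuous.norm (continuous_const.mul continuous_norm)
    refine S.opNorm_le_bound C.2 fun u => ?_
    refine hcl.closure_subset_iff.2 (fun x hx => ?_) (hd u)
    obtain ⟨h1, h2⟩ := key ⟨x, hx⟩
    obtain ⟨h3, h4⟩ := hC ⟨x, hx⟩
    rw [h2] at h4
    exact h4
  · intro hC ψ
    obtain ⟨h1, h2⟩ := key ψ
    refine ⟨h1, ?_⟩
    rw [h2]
    exact S.le_of_opNorm_le hC _

theorem lip_eq (hd : Dense (T.dirac.domain : Set H)) {a : A} {S : H →L[ℂ] H}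
    (h : ∀ u v, (u, v) ∈ T.dirac.graph → (T.rep a u, T.rep a v + S u) ∈ T.dirac.graph) :
    T.lip a = ‖S‖ₑ := by
  simp only [lip, commutatorBound_iff hd h]
  refine le_antisymm (iInf₂_le (α := ℝ≥0∞) ‖S‖₊ le_rfl) (le_iInf₂ fun C hC => ?_)
  exact ENNReal.coe_le_coe.2 hC

end Moyal.TripleData

namespace Moyal

variable {ι : Type}

theorem tendsto_spinors {α : Type} {l : Filter α} {v : α → Spinors ι} {u : Spinors ι}
    (h : ∀ i, Filter.Tendsto (fun n => v n i) l (nhds (u i))) : Filter.Tendsto v l (nhds u) := by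
  have h1 : Filter.Tendsto (fun n => PiLp.continuousLinearEquiv 2 ℂ (fun _ : ι => L2Plane) (v n)) l
      (nhds (PiLp.continuousLinearEquiv 2 ℂ (fun _ : ι => L2Plane) u)) := tendsto_pi_nhds.2 h
  exact ((PiLp.continuousLinearEquiv 2 ℂ
    (fun _ : ι => L2Plane)).symm.continuous.tendsto _).comp h1

theorem spinors_sum_apply {α : Type} (s : Finset α) (f : α → Spinors ι) (i : ι) :
    (∑ a ∈ s, f a) i = ∑ a ∈ s, f a i :=
  map_sum (PiLp.proj (𝕜 := ℂ) 2 (fun _ : ι => L2Plane) i) f s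

/-- The inclusion of the `i`-th component. -/
noncomputable def embed [DecidableEq ι] (i : ι) : L2Plane →L[ℂ] Spinors ι :=
  ((PiLp.continuousLinearEquiv 2 ℂ (fun _ : ι => L2Plane)).symm : _ →L[ℂ] Spinors ι) ∘L
    ContinuousLinearMap.single ℂ (fun _ : ι => L2Plane) i

theorem embed_apply [DecidableEq ι] (i j : ι) (u : L2Plane) : embed i u j = if j = i then u else 0 := by
  change (Pi.single i u : ι → L2Plane) j = _
  rw [Pi.single_apply]

variable [Fintype ι]

/-! ### Matrices of operators on spinors -/

theorem schwartzToSpinors_apply_eq_toL2 (ψ : ι → 𝓢(Plane, ℂ)) (i : ι) :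
    schwartzToSpinors ι ψ i = toL2 (ψ i) := rfl

theorem norm_component_le (u : Spinors ι) (i : ι) : ‖u i‖ ≤ ‖u‖ := PiLp.norm_apply_le u i

theorem dense_range_schwartzToSpinors : DenseRange (schwartzToSpinors ι) := by
  have h1 : DenseRange (Pi.map fun (_ : ι) => (toL2 : 𝓢(Plane, ℂ) → L2Plane)) :=
    DenseRange.piMap fun _ => denseRange_toL2
  have h2 := (PiLp.continuousLinearEquiv 2 ℂ (fun _ : ι => L2Plane)).symm.surjective.denseRange.comp
    h1 (PiLp.continuousLinearEquiv 2 ℂ (fun _ : ι => L2Plane)).symm.continuous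
  exact h2

theorem norm_comp_add_comp_le {E : Type} [NormedAddCommGroup E] [NormedSpace ℂ E]
    {S S' T T' : E →L[ℂ] E} (hS : ‖S‖ ≤ 1) (hT : ‖T'‖ ≤ 1) :
    ‖S ∘L S' + T ∘L T'‖ ≤ ‖S'‖ + ‖T‖ :=
  (norm_add_le _ _).trans (add_le_add
    ((S.opNorm_comp_le S').trans (mul_le_of_le_one_left (norm_nonneg _) hS))
    ((T.opNorm_comp_le T').trans (mul_le_of_le_one_right (norm_nonneg _) hT)))

theorem adjoint_diagonal (S : L2Plane →L[ℂ] L2Plane) :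
    ContinuousLinearMap.adjoint (diagonal S : Spinors ι →L[ℂ] Spinors ι) =
      diagonal (ContinuousLinearMap.adjoint S) := by
  refine ((ContinuousLinearMap.eq_adjoint_iff _ _).2 fun u v => ?_).symm
  simp only [PiLp.inner_apply, diagonal_apply, ContinuousLinearMap.adjoint_inner_left]

theorem norm_diagonal_le (S : L2Plane →L[ℂ] L2Plane) :
    ‖(diagonal S : Spinors ι →L[ℂ] Spinors ι)‖ ≤ ‖S‖ := by
  refine ContinuousLinearMap.opNorm_le_bound _ (norm_nonneg _) fun u => ?_
  rw [PiLp.norm_eq_of_L2, PiLp.norm_eq_of_L2, ← Real.sqrt_sq (norm_nonneg S),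
    ← Real.sqrt_mul (by positivity), Finset.mul_sum]
  refine Real.sqrt_le_sqrt (Finset.sum_le_sum fun i _ => ?_)
  rw [diagonal_apply, ← mul_pow]
  gcongr
  exact S.le_opNorm _

variable {θ : ℝ} {γ δ : Fin 2 → Matrix ι ι ℂ}

theorem mem_graph_diracCore {u v : Spinors ι} : (u, v) ∈ (diracCore θ γ δ).graph ↔
    ∃ ψ, u = schwartzToSpinors ι ψ ∧ v = schwartzToSpinors ι (diracSchwartz θ γ δ ψ) := by
  rw [LinearPMap.mem_graph_iff]
  constructor
  · rintro ⟨⟨_, ψ, rfl⟩, rfl, rfl⟩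
    exact ⟨ψ, rfl, diracCore_apply θ γ δ ψ⟩
  · rintro ⟨ψ, rfl, rfl⟩
    exact ⟨⟨schwartzToSpinors ι ψ, LinearMap.mem_range_self _ ψ⟩, rfl, diracCore_apply θ γ δ ψ⟩

theorem neg_I_smul_partialDeriv (μ : Fin 2) (f : 𝓢(Plane, ℂ)) :
    -I • partialDeriv μ f = (1 / 2 : ℂ) • (coordRight θ μ f - coordLeft θ μ f) := by
  rw [coordLeft_eq, coordRight_eq]
  module

theorem diracSchwartz_eq (ψ : ι → 𝓢(Plane, ℂ)) (i : ι) : diracSchwartz θ γ δ ψ i =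
    ∑ μ, ∑ j, (γ μ i j • (-I • partialDeriv μ (ψ j)) + δ μ i j • mulXTilde θ μ (ψ j)) := by
  simp [diracSchwartz]

theorem dense_domain_diracCore : Dense ((diracCore θ γ δ).domain : Set (Spinors ι)) :=
  dense_range_schwartzToSpinors

theorem isFormalAdjoint_diracCore (hγ : ∀ μ, (γ μ).IsHermitian) (hδ : ∀ μ, (δ μ).IsHermitian) :
    (diracCore θ γ δ).IsFormalAdjoint (diracCore θ γ δ) := by
  rintro ⟨_, φ, rfl⟩ ⟨_, ψ, rfl⟩
  rw [diracCore_apply, diracCore_apply]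
  simp only [PiLp.inner_apply, schwartzToSpinors_apply_eq_toL2, diracSchwartz_eq, map_sum,
    sum_inner, inner_sum, map_add, map_smul, inner_add_left, inner_add_right, inner_smul_left,
    inner_smul_right]
  rw [Finset.sum_comm]
  conv_rhs => rw [Finset.sum_comm]
  refine Finset.sum_congr rfl fun μ _ => ?_
  rw [Finset.sum_comm]
  refine Finset.sum_congr rfl fun i _ => Finset.sum_congr rfl fun j _ => ?_
  have h1 : starRingEnd ℂ (γ μ j i) = γ μ i j := (hγ μ).apply i j
  have h2 : starRingEnd ℂ (δ μ j i) = δ μ i j := (hδ μ).apply i j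
  rw [h1, h2, inner_partialDeriv, inner_mulXTilde]
  simp only [map_neg, conj_I]
  ring

theorem isClosable_diracCore (hγ : ∀ μ, (γ μ).IsHermitian) (hδ : ∀ μ, (δ μ).IsHermitian) :
    (diracCore θ γ δ).IsClosable :=
  LinearPMap.isClosable_of_isFormalAdjoint dense_domain_diracCore (isFormalAdjoint_diracCore hγ hδ)

variable [DecidableEq ι]

theorem norm_embed (i : ι) (u : L2Plane) : ‖embed i u‖ = ‖u‖ :=
  PiLp.norm_single 2 (fun _ : ι => L2Plane) i u

/-- The operator `M ⊗ S` on spinors. -/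
noncomputable def matOp (M : Matrix ι ι ℂ) (S : L2Plane →L[ℂ] L2Plane) :
    Spinors ι →L[ℂ] Spinors ι :=
  ∑ i, ∑ j, M i j • (embed i ∘L S ∘L PiLp.proj 2 (fun _ : ι => L2Plane) j)

theorem matOp_apply (M : Matrix ι ι ℂ) (S : L2Plane →L[ℂ] L2Plane) (u : Spinors ι) (i : ι) :
    matOp M S u i = ∑ j, M i j • S (u j) := by
  simp [matOp, embed_apply]

theorem norm_matOp_le (M : Matrix ι ι ℂ) (S : L2Plane →L[ℂ] L2Plane) :
    ‖matOp M S‖ ≤ (∑ i, ∑ j, ‖M i j‖) * ‖S‖ := by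
  rw [Finset.sum_mul]
  refine (norm_sum_le _ _).trans (Finset.sum_le_sum fun i _ => ?_)
  rw [Finset.sum_mul]
  refine (norm_sum_le _ _).trans (Finset.sum_le_sum fun j _ => ?_)
  rw [norm_smul]
  refine mul_le_mul_of_nonneg_left (ContinuousLinearMap.opNorm_le_bound _ (norm_nonneg _)
    fun u => ?_) (norm_nonneg _)
  simp only [ContinuousLinearMap.comp_apply, norm_embed]
  exact (S.le_opNorm _).trans (mul_le_mul_of_nonneg_left (norm_component_le u j) (norm_nonneg _))

theorem diagonal_eq_sum (S : L2Plane →L[ℂ] L2Plane) : (diagonal S : Spinors ι →L[ℂ] Spinors ι) =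
    ∑ i, embed i ∘L S ∘L PiLp.proj 2 (fun _ : ι => L2Plane) i := by
  ext1 u
  refine PiLp.ext fun i => ?_
  simp [embed_apply, diagonal_apply]

theorem isCompactOperator_diagonal {S : L2Plane →L[ℂ] L2Plane} (hS : IsCompactOperator S) :
    IsCompactOperator (diagonal S : Spinors ι →L[ℂ] Spinors ι) := by
  rw [diagonal_eq_sum]
  have h : ∀ i : ι, embed i ∘L S ∘L PiLp.proj 2 (fun _ : ι => L2Plane) i ∈
      compactOperator (RingHom.id ℂ) (Spinors ι) (Spinors ι) := fun i =>
    (hS.comp_clm (PiLp.proj 2 (fun _ : ι => L2Plane) i)).clm_comp (embed i)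
  exact (compactOperator (RingHom.id ℂ) (Spinors ι) (Spinors ι)).sum_mem fun i _ => h i

/-! ### General Dirac operators -/

variable [hθ : Fact (0 < θ)]

/-- The commutator of a Dirac operator with `L(a)`. -/
noncomputable def leftCommutator (θ : ℝ) [Fact (0 < θ)] (γ δ : Fin 2 → Matrix ι ι ℂ)
    (a : 𝓢(Plane, ℂ)) : Spinors ι →L[ℂ] Spinors ι :=
  ∑ μ, matOp (I • (δ μ - γ μ)) (leftMul θ (partialDeriv μ a))

/-- The commutator of a Dirac operator with right multiplication by `b`. -/
noncomputable def rightCommutator (θ : ℝ) [Fact (0 < θ)] (γ δ : Fin 2 → Matrix ι ι ℂ)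
    (b : 𝓢(Plane, ℂ)) : Spinors ι →L[ℂ] Spinors ι :=
  ∑ μ, matOp (-I • (δ μ + γ μ)) (rightMul θ (partialDeriv μ b))

/-- `[-i∂_μ, L(a)] = -i L(∂_μ a)` and `[m(x̃_μ), L(a)] = i L(∂_μ a)`: the same operator with
opposite signs, whence the coefficient `δ - γ`. -/
theorem diagonal_leftMul_mem_graph (a : 𝓢(Plane, ℂ)) {u v : Spinors ι}
    (h : (u, v) ∈ (diracCore θ γ δ).graph) :
    (diagonal (leftMul θ a) u, diagonal (leftMul θ a) v + leftCommutator θ γ δ a u) ∈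
      (diracCore θ γ δ).graph := by
  obtain ⟨ψ, rfl, rfl⟩ := mem_graph_diracCore.1 h
  refine mem_graph_diracCore.2 ⟨fun i => moyalMul θ a (ψ i), ?_, ?_⟩
  · refine PiLp.ext fun i => ?_
    simp only [diagonal_apply, schwartzToSpinors_apply_eq_toL2, leftMul_toL2]
  · refine PiLp.ext fun i => ?_
    simp only [PiLp.add_apply, diagonal_apply, schwartzToSpinors_apply_eq_toL2, leftCommutator,
      _root_.sum_apply, spinors_sum_apply, matOp_apply, diracSchwartz_eq, map_sum, map_add, map_smul,
      leftMul_toL2, partialDeriv_moyalMul, mulXTilde_moyalMul_left, Matrix.smul_apply,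
      Matrix.sub_apply, ← Finset.sum_add_distrib]
    refine Finset.sum_congr rfl fun μ _ => Finset.sum_congr rfl fun j _ => ?_
    module

/-- For right multiplications the two commutators have equal signs, whence `δ + γ`. -/
theorem diagonal_rightMul_mem_graph (b : 𝓢(Plane, ℂ)) {u v : Spinors ι}
    (h : (u, v) ∈ (diracCore θ γ δ).graph) :
    (diagonal (rightMul θ b) u, diagonal (rightMul θ b) v + rightCommutator θ γ δ b u) ∈
      (diracCore θ γ δ).graph := by
  obtain ⟨ψ, rfl, rfl⟩ := mem_graph_diracCore.1 h
  refine mem_graph_diracCore.2 ⟨fun i => moyalMul θ (ψ i) b, ?_, ?_⟩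
  · refine PiLp.ext fun i => ?_
    simp only [diagonal_apply, schwartzToSpinors_apply_eq_toL2, rightMul_toL2]
  · refine PiLp.ext fun i => ?_
    simp only [PiLp.add_apply, diagonal_apply, schwartzToSpinors_apply_eq_toL2, rightCommutator,
      _root_.sum_apply, spinors_sum_apply, matOp_apply, diracSchwartz_eq, map_sum, map_add, map_smul,
      map_sub, rightMul_toL2, partialDeriv_moyalMul, mulXTilde_moyalMul_right, Matrix.smul_apply,
      Matrix.add_apply, ← Finset.sum_add_distrib]
    refine Finset.sum_congr rfl fun μ _ => Finset.sum_congr rfl fun j _ => ?_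
    module

/-- The bounded operator `D L(e) R(e)`. -/
noncomputable def diracMollified (θ : ℝ) [Fact (0 < θ)] (γ δ : Fin 2 → Matrix ι ι ℂ)
    (e : 𝓢(Plane, ℂ)) : Spinors ι →L[ℂ] Spinors ι :=
  ∑ μ, (matOp ((1 / 2 : ℂ) • (γ μ + δ μ)) (leftMul θ e ∘L rightMul θ (coordRight θ μ e)) +
    matOp ((1 / 2 : ℂ) • (δ μ - γ μ)) (leftMul θ (coordLeft θ μ e) ∘L rightMul θ e))

/-- Writing `-i∂_μ` and `m(x̃_μ)` as half the difference and half the sum of `coordRight` and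
`coordLeft`, each coordinate is absorbed by the copy of `e` on its own side. Mollifying on both
sides is what makes the operator bounded. -/
theorem diracMollified_mem_graph (e : 𝓢(Plane, ℂ)) {u v : Spinors ι}
    (h : (u, v) ∈ (diracCore θ γ δ).graph) :
    (diagonal (leftMul θ e ∘L rightMul θ e) u, diracMollified θ γ δ e u) ∈
      (diracCore θ γ δ).graph := by
  obtain ⟨ψ, rfl, rfl⟩ := mem_graph_diracCore.1 h
  refine mem_graph_diracCore.2 ⟨fun i => moyalMul θ e (moyalMul θ (ψ i) e), ?_, ?_⟩
  · refine PiLp.ext fun i => ?_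
    simp only [diagonal_apply, schwartzToSpinors_apply_eq_toL2, rightMul_toL2, leftMul_toL2,
      ContinuousLinearMap.comp_apply]
  · refine PiLp.ext fun i => ?_
    simp only [schwartzToSpinors_apply_eq_toL2, diracMollified, _root_.sum_apply,
      _root_.add_apply, PiLp.add_apply, spinors_sum_apply, matOp_apply, diracSchwartz_eq, map_sum,
      map_add, map_smul, map_sub, rightMul_toL2, leftMul_toL2, ContinuousLinearMap.comp_apply,
      neg_I_smul_partialDeriv (θ := θ), mulXTilde_eq_half, coordLeft_moyalMul, coordRight_moyalMul,
      Matrix.smul_apply, Matrix.add_apply, Matrix.sub_apply, ← Finset.sum_add_distrib]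
    refine Finset.sum_congr rfl fun μ _ => Finset.sum_congr rfl fun j _ => ?_
    module

theorem norm_leftCommutator_le (γ δ : Fin 2 → Matrix ι ι ℂ) : ∃ C : ℝ, 0 ≤ C ∧
    ∀ (ε : ℝ) (e : 𝓢(Plane, ℂ)), IsMollifier θ ε e → ‖leftCommutator θ γ δ e‖ ≤ C * ε := by
  have : 0 < θ := hθ.out
  refine ⟨∑ μ, (∑ i, ∑ j, ‖(I • (δ μ - γ μ)) i j‖) * (2 * θ⁻¹), by positivity, fun ε e he => ?_⟩
  rw [Finset.sum_mul]
  refine (norm_sum_le _ _).trans (Finset.sum_le_sum fun μ _ => (norm_matOp_le _ _).trans ?_)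
  rw [mul_assoc]
  exact mul_le_mul_of_nonneg_left (he.norm_leftMul_partialDeriv_le μ) (by positivity)

theorem norm_rightCommutator_le (γ δ : Fin 2 → Matrix ι ι ℂ) : ∃ C : ℝ, 0 ≤ C ∧
    ∀ (ε : ℝ) (e : 𝓢(Plane, ℂ)), IsMollifier θ ε e → ‖rightCommutator θ γ δ e‖ ≤ C * ε := by
  have : 0 < θ := hθ.out
  refine ⟨∑ μ, (∑ i, ∑ j, ‖(-I • (δ μ + γ μ)) i j‖) * (2 * θ⁻¹), by positivity, fun ε e he => ?_⟩
  rw [Finset.sum_mul]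
  refine (norm_sum_le _ _).trans (Finset.sum_le_sum fun μ _ => (norm_matOp_le _ _).trans ?_)
  rw [mul_assoc]
  exact mul_le_mul_of_nonneg_left (he.norm_rightMul_partialDeriv_le μ) (by positivity)

/-- Dirac operators with Hermitian coefficients are essentially self-adjoint on Schwartz
spinors. -/
theorem isSelfAdjoint_closure_diracCore (hγ : ∀ μ, (γ μ).IsHermitian)
    (hδ : ∀ μ, (δ μ).IsHermitian) : IsSelfAdjoint (diracCore θ γ δ).closure := by
  obtain ⟨ε, e, he, hε⟩ := exists_seq_isMollifier θ
  obtain ⟨C, hC0, hC⟩ := norm_leftCommutator_le (θ := θ) γ δ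
  obtain ⟨C', hC0', hC'⟩ := norm_rightCommutator_le (θ := θ) γ δ
  refine LinearPMap.isSelfAdjoint_closure dense_domain_diracCore
    (isFormalAdjoint_diracCore hγ hδ)
    (J := fun n => diagonal (leftMul θ (e n) ∘L rightMul θ (e n)))
    (G := fun n => diracMollified θ γ δ (e n))
    (B := fun n => diagonal (leftMul θ (e n)) ∘L rightCommutator θ γ δ (e n) +
      leftCommutator θ γ δ (e n) ∘L diagonal (rightMul θ (e n)))
    (fun n => ?_)
    (fun n u v h => LinearPMap.graph_le_closure_graph (diracMollified_mem_graph (e n) h))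
    (fun n u v h => ?_) (fun u => tendsto_spinors fun i => ?_) ?_
  · rw [adjoint_diagonal, ContinuousLinearMap.adjoint_comp, ← leftMul_conj, ← rightMul_conj,
      (he n).conj_eq]
    congr 1
    ext1 u
    exact (leftMul_rightMul_comm _ _ u).symm
  · have h1 := diagonal_leftMul_mem_graph (e n) (diagonal_rightMul_mem_graph (e n) h)
    -- A graph is single valued, so the two formulas for the Dirac operator applied to `L(e) R(e) u`
    -- agree.
    have h2 := LinearPMap.mem_graph_snd_inj _ (diracMollified_mem_graph (e n) h) h1 rfl
    rw [h2, map_add, add_assoc]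
    rfl
  · refine tendsto_iff_norm_sub_tendsto_zero.2 (squeeze_zero (fun _ => norm_nonneg _) (fun n => ?_)
      (g := fun n => ‖rightMul θ (e n) (u i) - u i‖ + ‖leftMul θ (e n) (u i) - u i‖) ?_)
    · simp only [diagonal_apply, ContinuousLinearMap.comp_apply]
      have h1 : ‖leftMul θ (e n) (rightMul θ (e n) (u i) - u i)‖ ≤
          ‖rightMul θ (e n) (u i) - u i‖ :=
        ((leftMul θ (e n)).le_of_opNorm_le (he n).norm_leftMul_le_one _).trans_eq (one_mul _)
      rw [map_sub] at h1
      exact (norm_sub_le_norm_sub_add_norm_sub _ (leftMul θ (e n) (u i)) _).trans (by gcongr)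
    · simpa using (tendsto_iff_norm_sub_tendsto_zero.1 (tendsto_rightMul_mollifier he hε (u i))).add
        (tendsto_iff_norm_sub_tendsto_zero.1 (tendsto_leftMul_mollifier he hε (u i)))
  · refine squeeze_zero (fun _ => norm_nonneg _) (fun n => ?_)
      (tendsto_mul_const_zero hε (C' + C))
    have h1 : ‖(diagonal (leftMul θ (e n)) : Spinors ι →L[ℂ] Spinors ι)‖ ≤ 1 :=
      (norm_diagonal_le _).trans (he n).norm_leftMul_le_one
    have h2 : ‖(diagonal (rightMul θ (e n)) : Spinors ι →L[ℂ] Spinors ι)‖ ≤ 1 :=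
      (norm_diagonal_le _).trans (he n).norm_rightMul_le_one
    have h3 := norm_comp_add_comp_le (S' := rightCommutator θ γ δ (e n))
      (T := leftCommutator θ γ δ (e n)) h1 h2
    have h5 := hC' _ _ (he n)
    have h6 := hC _ _ (he n)
    linarith

theorem diagonal_leftMul_mem_closure_graph (hγ : ∀ μ, (γ μ).IsHermitian)
    (hδ : ∀ μ, (δ μ).IsHermitian) (a : 𝓢(Plane, ℂ)) {u v : Spinors ι}
    (h : (u, v) ∈ (diracCore θ γ δ).closure.graph) :
    (diagonal (leftMul θ a) u, diagonal (leftMul θ a) v + leftCommutator θ γ δ a u) ∈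
      (diracCore θ γ δ).closure.graph :=
  LinearPMap.mem_closure_graph_of_commutator (isClosable_diracCore hγ hδ)
    (fun _ _ h => LinearPMap.graph_le_closure_graph (diagonal_leftMul_mem_graph a h)) h

end Moyal

namespace Moyal

/-! ### The Dirac operators of the Moyal plane -/

theorem sigma3_eq : sigma3 = Matrix.diagonal ![1, -1] := by
  ext i j
  fin_cases i <;> fin_cases j <;> simp [sigma3, sigma1, sigma2]

theorem isHermitian_sigma (μ : Fin 2) : (sigma μ).IsHermitian := by
  ext i j
  fin_cases μ <;> fin_cases i <;> fin_cases j <;> simp [sigma, sigma1, sigma2]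

theorem isHermitian_sigma3 : sigma3.IsHermitian := by
  rw [sigma3_eq]
  ext i j
  fin_cases i <;> fin_cases j <;> simp

theorem isHermitian_kronecker {ι κ : Type} {M : Matrix ι ι ℂ} {N : Matrix κ κ ℂ}
    (hM : M.IsHermitian) (hN : N.IsHermitian) : (M ⊗ₖ N).IsHermitian := by
  rw [Matrix.IsHermitian, Matrix.conjTranspose_kronecker, hM.eq, hN.eq]

/-- The coefficients of the derivatives in the twisted Dirac operator. -/
noncomputable def twistedGamma (μ : Fin 2) : Matrix (Fin 2 × Fin 2) (Fin 2 × Fin 2) ℂ :=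
  (1 : Matrix (Fin 2) (Fin 2) ℂ) ⊗ₖ sigma μ

/-- The coefficients of the coordinates in the twisted Dirac operator. -/
noncomputable def twistedDelta (ξ : ℝ) (μ : Fin 2) :
    Matrix (Fin 2 × Fin 2) (Fin 2 × Fin 2) ℂ :=
  -((ξ : ℂ) • (sigma3 ⊗ₖ sigma μ))

theorem isHermitian_twistedGamma (μ : Fin 2) : (twistedGamma μ).IsHermitian :=
  isHermitian_kronecker Matrix.isHermitian_one (isHermitian_sigma μ)

theorem isHermitian_twistedDelta (ξ : ℝ) (μ : Fin 2) : (twistedDelta ξ μ).IsHermitian := by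
  have h := isHermitian_kronecker isHermitian_sigma3 (isHermitian_sigma μ)
  rw [Matrix.IsHermitian] at h
  rw [twistedDelta, Matrix.IsHermitian, Matrix.conjTranspose_neg, Matrix.conjTranspose_smul, h]
  simp

/-- The sign of the two blocks of `σ³`. -/
def blockSign : Fin 2 → ℝ := ![1, -1]

theorem sigma3_apply (s t : Fin 2) : sigma3 s t = if s = t then (blockSign s : ℂ) else 0 := by
  rw [sigma3_eq]
  fin_cases s <;> fin_cases t <;> simp [blockSign]

theorem twistedGamma_apply (μ s i t j : Fin 2) :
    twistedGamma μ (s, i) (t, j) = if s = t then sigma μ i j else 0 := by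
  simp [twistedGamma, Matrix.one_apply]

theorem twistedDelta_apply (ξ : ℝ) (μ s i t j : Fin 2) :
    twistedDelta ξ μ (s, i) (t, j) = if s = t then -(ξ * blockSign s : ℂ) * sigma μ i j else 0 := by
  simp only [twistedDelta, Matrix.neg_apply, Matrix.smul_apply, Matrix.kroneckerMap_apply,
    sigma3_apply, smul_eq_mul]
  split_ifs <;> ring

theorem blockSign_eq (s : Fin 2) : blockSign s = 1 ∨ blockSign s = -1 := by
  fin_cases s <;> simp [blockSign]

/-- One of the two blocks of a spinor with four components. -/
noncomputable def block (s : Fin 2) (u : Spinors (Fin 2 × Fin 2)) : Spinors (Fin 2) :=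
  WithLp.toLp 2 fun i => u (s, i)

theorem block_apply (s i : Fin 2) (u : Spinors (Fin 2 × Fin 2)) : block s u i = u (s, i) := rfl

theorem norm_sq_eq_sum_block (u : Spinors (Fin 2 × Fin 2)) : ‖u‖ ^ 2 = ∑ s, ‖block s u‖ ^ 2 := by
  simp only [PiLp.norm_sq_eq_of_L2, block_apply, Fintype.sum_prod_type]

/-- The spinor with four components whose first block is given and whose second block is zero. -/
noncomputable def firstBlock (w : Spinors (Fin 2)) : Spinors (Fin 2 × Fin 2) :=
  WithLp.toLp 2 fun p => if p.1 = 0 then w p.2 else 0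

theorem block_zero_firstBlock (w : Spinors (Fin 2)) : block 0 (firstBlock w) = w :=
  PiLp.ext fun i => by simp [block, firstBlock]

theorem norm_firstBlock (w : Spinors (Fin 2)) : ‖firstBlock w‖ = ‖w‖ := by
  have h : block 1 (firstBlock w) = 0 := PiLp.ext fun i => by simp [block, firstBlock]
  have := norm_sq_eq_sum_block (firstBlock w)
  rw [Fin.sum_univ_two, block_zero_firstBlock, h] at this
  rw [← sq_eq_sq₀ (norm_nonneg _) (norm_nonneg _), this]
  simp

/-! ### Scaling of the commutators and of the distance -/

variable {θ ξ : ℝ} [hθ : Fact (0 < θ)]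

/-- On the eigenspace of `σ³` with sign `s`, the coefficient `δ - γ` equals `-(1 + sξ) σ^μ`, against
`-σ^μ` for the standard operator. -/
theorem block_leftCommutator (a : 𝓢(Plane, ℂ)) (s : Fin 2) (u : Spinors (Fin 2 × Fin 2)) :
    block s (leftCommutator θ twistedGamma (twistedDelta ξ) a u) =
      ((1 + blockSign s * ξ : ℝ) : ℂ) • leftCommutator θ sigma 0 a (block s u) := by
  refine PiLp.ext fun i => ?_
  simp only [block_apply, leftCommutator, _root_.sum_apply, spinors_sum_apply, matOp_apply,
    Fintype.sum_prod_type, PiLp.smul_apply, Matrix.smul_apply, Matrix.sub_apply,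
    twistedGamma_apply, twistedDelta_apply, Finset.smul_sum]
  refine Finset.sum_congr rfl fun μ _ => ?_
  rw [Finset.sum_comm]
  refine Finset.sum_congr rfl fun j _ => ?_
  rw [Finset.sum_eq_single s (fun t _ h => by simp [h.symm]) (by simp)]
  simp only [if_true, Pi.zero_apply, Matrix.zero_apply, ofReal_add, ofReal_mul, ofReal_one]
  module

/-- The norm of a block operator is the larger of the block norms; since `ξ > 0`, the first block
dominates, and spinors supported there attain it. -/
theorem norm_leftCommutator_twisted (hξ : 0 < ξ) (a : 𝓢(Plane, ℂ)) :
    ‖leftCommutator θ twistedGamma (twistedDelta ξ) a‖ =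
      (1 + ξ) * ‖leftCommutator θ sigma 0 a‖ := by
  refine le_antisymm (ContinuousLinearMap.opNorm_le_bound _ (by positivity) fun u => ?_) ?_
  · rw [← sq_le_sq₀ (norm_nonneg _) (by positivity), mul_pow, norm_sq_eq_sum_block,
      norm_sq_eq_sum_block u, Finset.mul_sum]
    refine Finset.sum_le_sum fun s _ => ?_
    rw [block_leftCommutator, norm_smul, norm_real, ← mul_pow, mul_assoc]
    have h1 : ‖1 + blockSign s * ξ‖ ≤ 1 + ξ := by
      rw [Real.norm_eq_abs, abs_le]
      rcases blockSign_eq s with h | h <;> rw [h] <;> constructor <;> linarith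
    gcongr
    exact ContinuousLinearMap.le_opNorm _ _
  · rw [← le_div_iff₀' (by positivity)]
    refine ContinuousLinearMap.opNorm_le_bound _ (by positivity) fun w => ?_
    rw [div_mul_eq_mul_div, le_div_iff₀' (by positivity)]
    have h1 := (leftCommutator θ twistedGamma (twistedDelta ξ) a).le_opNorm (firstBlock w)
    rw [norm_firstBlock] at h1
    refine le_trans ?_ h1
    have h2 := block_leftCommutator (θ := θ) (ξ := ξ) a 0 (firstBlock w)
    rw [block_zero_firstBlock] at h2
    have h3 : ‖block 0 (leftCommutator θ twistedGamma (twistedDelta ξ) a (firstBlock w))‖ =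
        (1 + ξ) * ‖leftCommutator θ sigma 0 a w‖ := by
      rw [h2, norm_smul, norm_real, Real.norm_eq_abs, abs_of_pos] <;> simp [blockSign]
      positivity
    rw [← h3, ← sq_le_sq₀ (norm_nonneg _) (norm_nonneg _), norm_sq_eq_sum_block, Fin.sum_univ_two]
    exact le_add_of_nonneg_right (sq_nonneg _)

theorem dense_domain_twistedDirac (θ ξ : ℝ) :
    Dense ((twistedDirac θ ξ).domain : Set (Spinors (Fin 2 × Fin 2))) :=
  dense_range_schwartzToSpinors.mono (diracCore θ twistedGamma (twistedDelta ξ)).le_closure.1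

theorem dense_domain_standardDirac (θ : ℝ) :
    Dense ((standardDirac θ).domain : Set (Spinors (Fin 2))) :=
  dense_range_schwartzToSpinors.mono (diracCore θ sigma 0).le_closure.1

theorem mem_graph_twistedDirac (a : 𝓢(Plane, ℂ)) {u v : Spinors (Fin 2 × Fin 2)}
    (h : (u, v) ∈ (twistedTriple θ ξ).dirac.graph) :
    ((twistedTriple θ ξ).rep a u, (twistedTriple θ ξ).rep a v +
      leftCommutator θ twistedGamma (twistedDelta ξ) a u) ∈ (twistedTriple θ ξ).dirac.graph :=
  diagonal_leftMul_mem_closure_graph isHermitian_twistedGamma (isHermitian_twistedDelta ξ) a h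

theorem mem_graph_standardDirac (a : 𝓢(Plane, ℂ)) {u v : Spinors (Fin 2)}
    (h : (u, v) ∈ (standardTriple θ).dirac.graph) :
    ((standardTriple θ).rep a u, (standardTriple θ).rep a v +
      leftCommutator θ sigma 0 a u) ∈ (standardTriple θ).dirac.graph :=
  diagonal_leftMul_mem_closure_graph isHermitian_sigma (fun _ => Matrix.isHermitian_zero) a h

theorem lip_standardTriple (a : 𝓢(Plane, ℂ)) :
    (standardTriple θ).lip a = ‖leftCommutator θ sigma 0 a‖ₑ :=
  TripleData.lip_eq (dense_domain_standardDirac θ) fun _ _ => mem_graph_standardDirac a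

theorem lip_twistedTriple (hξ : 0 < ξ) (a : 𝓢(Plane, ℂ)) :
    (twistedTriple θ ξ).lip a = ENNReal.ofReal (1 + ξ) * (standardTriple θ).lip a := by
  rw [lip_standardTriple, TripleData.lip_eq (dense_domain_twistedDirac θ ξ)
    fun _ _ => mem_graph_twistedDirac a, ← ofReal_norm, ← ofReal_norm,
    norm_leftCommutator_twisted hξ, ENNReal.ofReal_mul (by positivity)]

theorem leftCommutator_smul {ι : Type} [Fintype ι] [DecidableEq ι] (γ δ : Fin 2 → Matrix ι ι ℂ)
    (c : ℂ) (a : 𝓢(Plane, ℂ)) :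
    leftCommutator θ γ δ (c • a) = c • leftCommutator θ γ δ a := by
  ext1 u
  refine PiLp.ext fun i => ?_
  simp only [leftCommutator, _root_.sum_apply, spinors_sum_apply, matOp_apply, map_smul,
    leftMul_smul, _root_.smul_apply, PiLp.smul_apply, Finset.smul_sum]
  refine Finset.sum_congr rfl fun μ _ => Finset.sum_congr rfl fun j _ => ?_
  module

theorem lip_standardTriple_smul (c : ℂ) (a : 𝓢(Plane, ℂ)) :
    (standardTriple θ).lip (c • a) = ‖c‖ₑ * (standardTriple θ).lip a := by
  rw [lip_standardTriple, lip_standardTriple, leftCommutator_smul, enorm_smul]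

/-- The seminorms are proportional, so rescaling the test elements by `1 + ξ` matches the two
suprema. -/
theorem dist_twistedTriple (hξ : 0 < ξ) (ω₁ ω₂ : 𝓢(Plane, ℂ) →ₗ[ℂ] ℂ) :
    (twistedTriple θ ξ).dist ω₁ ω₂ =
      ENNReal.ofReal (1 + ξ)⁻¹ * (standardTriple θ).dist ω₁ ω₂ := by
  have hpos : 0 < 1 + ξ := by positivity
  have hne : ((1 + ξ : ℝ) : ℂ) ≠ 0 := by exact_mod_cast hpos.ne'
  have hc : ‖((1 + ξ : ℝ) : ℂ)‖ₑ = ENNReal.ofReal (1 + ξ) := by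
    rw [← ofReal_norm, norm_real, Real.norm_of_nonneg hpos.le]
  have hc' : ‖((1 + ξ : ℝ) : ℂ)⁻¹‖ₑ = ENNReal.ofReal (1 + ξ)⁻¹ := by
    rw [← ofReal_norm, norm_inv, norm_real, Real.norm_of_nonneg hpos.le]
  have hcc : ENNReal.ofReal (1 + ξ) * ENNReal.ofReal (1 + ξ)⁻¹ = 1 := by
    rw [← ENNReal.ofReal_mul hpos.le, mul_inv_cancel₀ hpos.ne', ENNReal.ofReal_one]
  have key : ∀ (c : ℂ) a, ‖ω₁ (c • a) - ω₂ (c • a)‖ₑ = ‖c‖ₑ * ‖ω₁ a - ω₂ a‖ₑ := fun c a => by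
    rw [map_smul, map_smul, ← smul_sub, enorm_smul]
  simp only [TripleData.dist, ENNReal.mul_iSup]
  refine le_antisymm (iSup₂_le fun a ha => ?_) (iSup₂_le fun a ha => ?_)
  · refine le_iSup₂_of_le (((1 + ξ : ℝ) : ℂ) • a) ?_ ?_
    · rwa [lip_standardTriple_smul, hc, ← lip_twistedTriple hξ]
    · rw [key, hc, ← mul_assoc, mul_comm (ENNReal.ofReal _), hcc, one_mul]
  · refine le_iSup₂_of_le (((1 + ξ : ℝ) : ℂ)⁻¹ • a) ?_ ?_
    · rwa [lip_twistedTriple hξ, lip_standardTriple_smul, hc', ← mul_assoc, hcc, one_mul]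
    · rw [key, hc']

/-! ### Triviality of the metric commutant -/

/-- Such a function is constant, and an integrable constant on a space of infinite measure vanishes.
-/
theorem eq_zero_of_partialDeriv_eq_zero {a : 𝓢(Plane, ℂ)} (h : ∀ μ, partialDeriv μ a = 0) :
    a = 0 := by
  have h1 : ∀ x y, a x = a y := by
    refine is_const_of_fderiv_eq_zero (𝕜 := ℝ) a.differentiable fun x => ?_
    ext e
    rw [fderiv_apply_eq_sum]
    simp [h]
  have h2 : Integrable (fun _ : Plane => a 0) :=
    (a.integrable (μ := volume)).congr (Filter.Eventually.of_forall fun x => h1 x 0)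
  rw [integrable_const_iff] at h2
  ext x
  rw [h1 x 0]
  refine h2.resolve_right fun h3 => ?_
  exact absurd h3 (by simp [isFiniteMeasure_iff])

/-- The off-diagonal entries of the commutator are, up to scalars, `L(∂₀a ± i∂₁a)`; spinors with one
nonzero component isolate them. Injectivity of `L` then kills both derivatives. -/
theorem eq_zero_of_leftCommutator_sigma_eq_zero {a : 𝓢(Plane, ℂ)}
    (h : leftCommutator θ sigma 0 a = 0) : a = 0 := by
  have key : ∀ (i : Fin 2) (u : Spinors (Fin 2)), ∑ μ, ∑ j, (I * -sigma μ i j) •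
      leftMul θ (partialDeriv μ a) (u j) = 0 := fun i u => by
    have h1 := congrArg (fun T : Spinors (Fin 2) →L[ℂ] Spinors (Fin 2) => T u i) h
    simpa only [leftCommutator, _root_.sum_apply, spinors_sum_apply, matOp_apply, zero_sub,
      Pi.zero_apply, Matrix.smul_apply, Matrix.neg_apply, smul_eq_mul,
      _root_.zero_apply, PiLp.zero_apply] using h1
  have hz : leftMul θ (0 : 𝓢(Plane, ℂ)) = 0 := by
    simpa using leftMul_smul (θ := θ) 0 (0 : 𝓢(Plane, ℂ))
  have h0 : leftMul θ (partialDeriv 0 a + I • partialDeriv 1 a) = leftMul θ 0 := by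
    rw [hz]
    ext1 u
    have := key 0 (embed 1 u)
    simp [Fin.sum_univ_two, embed_apply, sigma, sigma1, sigma2] at this
    rw [leftMul_add, leftMul_smul, _root_.add_apply, _root_.smul_apply, _root_.zero_apply]
    refine Eq.trans ?_ ((congrArg (fun v => I • v) this).trans (smul_zero I))
    simp only [smul_add, smul_neg, smul_smul, I_mul_I]
    module
  have h1 : leftMul θ (partialDeriv 0 a - I • partialDeriv 1 a) = leftMul θ 0 := by
    rw [hz]
    ext1 u
    have := key 1 (embed 0 u)
    simp [Fin.sum_univ_two, embed_apply, sigma, sigma1, sigma2] at this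
    rw [leftMul_sub, leftMul_smul, _root_.sub_apply, _root_.smul_apply, _root_.zero_apply]
    refine Eq.trans ?_ ((congrArg (fun v => I • v) this).trans (smul_zero I))
    simp only [smul_add, smul_neg, smul_smul, I_mul_I]
    module
  replace h0 := leftMul_injective h0
  replace h1 := leftMul_injective h1
  have e0 : partialDeriv 0 a = 0 := by
    have : (2 : ℂ) • partialDeriv 0 a = 0 := by
      rw [two_smul, ← add_zero (0 : 𝓢(Plane, ℂ)), ← h0]
      nth_rewrite 2 [h0]
      rw [← h1]
      abel
    simpa using this
  refine eq_zero_of_partialDeriv_eq_zero fun μ => ?_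
  fin_cases μ
  · exact e0
  · simpa [e0] using h0

end Moyal

namespace Moyal

variable {θ ξ : ℝ}

/-! ### Compactness of the resolvent -/

theorem partialDeriv_mulXTilde (μ ν : Fin 2) (f : 𝓢(Plane, ℂ)) :
    partialDeriv μ (mulXTilde θ ν f) = mulXTilde θ ν (partialDeriv μ f) +
      (xTilde θ ν (EuclideanSpace.single μ 1) : ℂ) • f := by
  ext x
  refine partialDeriv_eq_of_hasDerivAt ?_
  set e : Plane := EuclideanSpace.single μ 1
  have h1 := hasDerivAt_comp_line f x e 0
  have h2 : HasDerivAt (fun t : ℝ => ((xTilde θ ν (x + t • e) : ℝ) : ℂ))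
      (xTilde θ ν e : ℂ) 0 := by
    have h3 : ∀ t : ℝ, xTilde θ ν (x + t • e) = xTilde θ ν x + t * xTilde θ ν e := fun t => by
      rw [xTilde_add]
      fin_cases ν <;> simp [xTilde_zero, xTilde_one] <;> ring
    simp only [h3]
    refine HasDerivAt.ofReal_comp ?_
    simpa using ((hasDerivAt_id (0 : ℝ)).mul_const (xTilde θ ν e)).const_add (xTilde θ ν x)
  have h4 := h2.mul h1
  simp only [zero_smul, add_zero] at h4
  refine (h4.congr_deriv ?_).congr_of_eventuallyEq (Filter.Eventually.of_forall fun t => ?_)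
  · simp only [add_apply, smul_apply, smul_eq_mul, mulXTilde_apply, partialDeriv_apply, e]
    ring
  · simp only [mulXTilde_apply, Pi.mul_apply]

theorem inner_coordRight (μ : Fin 2) (f g : 𝓢(Plane, ℂ)) :
    inner ℂ (toL2 f) (toL2 (coordRight θ μ g)) = inner ℂ (toL2 (coordRight θ μ f)) (toL2 g) := by
  simp only [coordRight_eq, map_sub, map_smul, inner_sub_left, inner_sub_right, inner_smul_left,
    inner_smul_right, inner_mulXTilde, inner_partialDeriv, conj_I]
  ring

theorem partialDeriv_comm (μ ν : Fin 2) (f : 𝓢(Plane, ℂ)) :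
    partialDeriv μ (partialDeriv ν f) = partialDeriv ν (partialDeriv μ f) := by
  -- Any positive parameter would do: the symbol turns both derivatives into multiplications, which
  -- commute.
  have : Fact ((0 : ℝ) < 1) := ⟨one_pos⟩
  refine (symbol_bijective (θ := 1)).1 (SchwartzMap.ext fun y => ?_)
  simp only [symbol_partialDeriv]
  ring

/-- The canonical commutation relation, with constant `4/θ` from the mixed derivatives of the two
coordinates `x̃_μ`. -/
theorem coordRight_comm (f : 𝓢(Plane, ℂ)) : coordRight θ 0 (coordRight θ 1 f) =
    coordRight θ 1 (coordRight θ 0 f) - (4 * θ⁻¹ * I : ℂ) • f := by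
  simp only [coordRight_eq, map_sub, map_smul, partialDeriv_mulXTilde, smul_sub, smul_add,
    partialDeriv_comm 1 0]
  have h : mulXTilde θ 0 (mulXTilde θ 1 f) = mulXTilde θ 1 (mulXTilde θ 0 f) := by
    ext x
    simp only [mulXTilde_apply]
    ring
  rw [h]
  have h0 : xTilde θ 0 (EuclideanSpace.single 1 1) = -2 * θ⁻¹ := by simp [xTilde_zero]
  have h1 : xTilde θ 1 (EuclideanSpace.single 0 1) = 2 * θ⁻¹ := by simp [xTilde_one]
  rw [h0, h1]
  push_cast
  module

variable [hθ : Fact (0 < θ)]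

/-- A ladder operator controls both coordinates, as for the harmonic oscillator: `‖(X ± iY)f‖²`
differs from `‖Xf‖² + ‖Yf‖²` only by the commutator term `±(4/θ)‖f‖²`. -/
theorem sum_norm_coordRight_le (f : 𝓢(Plane, ℂ)) {c : ℂ} (hc : c = I ∨ c = -I) :
    ∑ μ, ‖toL2 (coordRight θ μ f)‖ ≤
      2 * (‖toL2 (coordRight θ 0 f + c • coordRight θ 1 f)‖ + (1 + 4 * θ⁻¹) * ‖toL2 f‖) := by
  have hθ0 : 0 < θ⁻¹ := inv_pos.2 hθ.out
  set A := toL2 (coordRight θ 0 f) with hA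
  set B := toL2 (coordRight θ 1 f) with hB
  have h1 : inner ℂ A B = inner ℂ B A - (4 * θ⁻¹ * I : ℂ) * ((‖toL2 f‖ ^ 2 : ℝ) : ℂ) := by
    rw [hA, hB, ← inner_coordRight, coordRight_comm, map_sub, inner_sub_right, inner_coordRight,
      map_smul, inner_smul_right, inner_self_eq_norm_sq_to_K]
    simp
  have h2 : (inner ℂ A B).im = -(2 * θ⁻¹ * ‖toL2 f‖ ^ 2) := by
    have h3 := congrArg Complex.im h1
    have h4 : (inner ℂ B A).im = -(inner ℂ A B).im := by
      rw [← inner_conj_symm B A, conj_im]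
    rw [sub_im, h4, show (4 * θ⁻¹ * I : ℂ) * ((‖toL2 f‖ ^ 2 : ℝ) : ℂ) =
      ((4 * θ⁻¹ * ‖toL2 f‖ ^ 2 : ℝ) : ℂ) * I by push_cast; ring, im_ofReal_mul, I_im] at h3
    linarith
  have h5 : ‖A‖ ^ 2 + ‖B‖ ^ 2 ≤ ‖A + c • B‖ ^ 2 + 4 * θ⁻¹ * ‖toL2 f‖ ^ 2 := by
    rw [@norm_add_sq ℂ, inner_smul_right, norm_smul]
    have h3 : 0 ≤ θ⁻¹ * ‖toL2 f‖ ^ 2 := by positivity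
    rcases hc with rfl | rfl
    · simp [h2]
      linarith
    · simp [h2]
      linarith
  have h6 : ‖A‖ ^ 2 + ‖B‖ ^ 2 ≤ (‖A + c • B‖ + (1 + 4 * θ⁻¹) * ‖toL2 f‖) ^ 2 := by
    nlinarith [norm_nonneg (A + c • B), norm_nonneg (toL2 f),
      mul_nonneg (norm_nonneg (A + c • B)) (norm_nonneg (toL2 f)),
      mul_nonneg hθ0.le (mul_nonneg (norm_nonneg (A + c • B)) (norm_nonneg (toL2 f))),
      mul_nonneg hθ0.le (sq_nonneg ‖toL2 f‖), mul_nonneg (sq_nonneg θ⁻¹) (sq_nonneg ‖toL2 f‖),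
      sq_nonneg ‖toL2 f‖]
  have h7 : 0 ≤ ‖A + c • B‖ + (1 + 4 * θ⁻¹) * ‖toL2 f‖ := by positivity
  have h8 : ‖A‖ ≤ ‖A + c • B‖ + (1 + 4 * θ⁻¹) * ‖toL2 f‖ :=
    abs_le_of_sq_le_sq' (by linarith [sq_nonneg ‖B‖]) h7 |>.2
  have h9 : ‖B‖ ≤ ‖A + c • B‖ + (1 + 4 * θ⁻¹) * ‖toL2 f‖ :=
    abs_le_of_sq_le_sq' (by linarith [sq_nonneg ‖A‖]) h7 |>.2
  rw [Fin.sum_univ_two, map_add, map_smul]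
  linarith

/-- Isolates the unbounded part. In block `s`, `γ + δ = (1 - sξ)σ^μ` multiplies `coordRight`, which
passes through `L(a)`. The `coordLeft` part carries `-(1 + sξ)σ^μ` and becomes bounded, as
`moyalMul_coordLeft` moves the coordinate onto `a`. -/
theorem leftMul_diracSchwartz (a : 𝓢(Plane, ℂ)) (ψ : Fin 2 × Fin 2 → 𝓢(Plane, ℂ)) (s k : Fin 2) :
    leftMul θ a (toL2 (diracSchwartz θ twistedGamma (twistedDelta ξ) ψ (s, k))) =
      ∑ μ, ∑ j, (1 / 2 * sigma μ k j) • (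
        ((1 - blockSign s * ξ : ℝ) : ℂ) • toL2 (coordRight θ μ (moyalMul θ a (ψ (s, j)))) -
        ((1 + blockSign s * ξ : ℝ) : ℂ) • leftMul θ (coordRight θ μ a) (toL2 (ψ (s, j)))) := by
  simp only [diracSchwartz_eq, map_sum, Fintype.sum_prod_type, twistedGamma_apply,
    twistedDelta_apply]
  refine Finset.sum_congr rfl fun μ _ => ?_
  rw [Finset.sum_comm]
  refine Finset.sum_congr rfl fun j _ => ?_
  rw [Finset.sum_eq_single s (fun t _ h => by simp [h.symm]) (by simp)]
  simp only [if_true, neg_I_smul_partialDeriv (θ := θ), mulXTilde_eq_half, coordRight_moyalMul,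
    map_add, map_smul, map_sub, leftMul_toL2, moyalMul_coordLeft]
  push_cast
  module

theorem abs_one_sub_blockSign_mul (hξ : 0 < ξ) (s : Fin 2) : |1 - ξ| ≤ |1 - blockSign s * ξ| := by
  rcases blockSign_eq s with h | h <;> rw [h]
  · simp
  · rw [abs_of_pos (show 0 < 1 - -1 * ξ by linarith), abs_le]
    constructor <;> linarith

/-- Dividing by `1 - sξ` is possible in both blocks only for `ξ ≠ 1`; the smaller modulus `|1 - ξ|`
serves for both. -/
theorem norm_coordRight_add_le (hξ : 0 < ξ) (hξ1 : ξ ≠ 1) (a : 𝓢(Plane, ℂ)) :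
    ∃ C : ℝ, 0 ≤ C ∧ ∀ (ψ : Fin 2 × Fin 2 → 𝓢(Plane, ℂ)) (p : Fin 2 × Fin 2),
      ∃ c : ℂ, (c = I ∨ c = -I) ∧
        ‖toL2 (coordRight θ 0 (moyalMul θ a (ψ p)) + c • coordRight θ 1 (moyalMul θ a (ψ p)))‖ ≤
          C * (‖schwartzToSpinors _ ψ‖ +
            ‖schwartzToSpinors _ (diracSchwartz θ twistedGamma (twistedDelta ξ) ψ)‖) := by
  have hpos : 0 < |1 - ξ| := abs_pos.2 (sub_ne_zero.2 hξ1.symm)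
  set M := ‖leftMul θ (coordRight θ 0 a)‖ + ‖leftMul θ (coordRight θ 1 a)‖ with hM
  have hM0 : 0 ≤ M := by positivity
  refine ⟨|1 - ξ|⁻¹ * (2 * ‖leftMul θ a‖ + (1 + ξ) * M), by positivity, fun ψ p => ?_⟩
  obtain ⟨s, j⟩ := p
  set u := schwartzToSpinors _ ψ with hu
  set v := schwartzToSpinors _ (diracSchwartz θ twistedGamma (twistedDelta ξ) ψ) with hv
  -- The matrices `σ^μ` are off-diagonal, so row `1 - j` sees only the component `j`, with entries
  -- `1` and `±i`: a single ladder operator acts on it.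
  obtain ⟨k, hk0, hk1, hk2, hkI⟩ : ∃ k : Fin 2, sigma 0 k j = 1 ∧ (∀ μ, sigma μ k (1 - j) = 0) ∧
      ‖sigma 1 k j‖ = 1 ∧ (sigma 1 k j = I ∨ sigma 1 k j = -I) := by
    refine ⟨1 - j, ?_⟩
    fin_cases j <;> refine ⟨by simp [sigma, sigma1], fun μ => ?_, by simp [sigma, sigma2],
      by simp [sigma, sigma2]⟩ <;> fin_cases μ <;> simp [sigma, sigma1, sigma2]
  refine ⟨sigma 1 k j, hkI, ?_⟩
  have hsum : ∀ g : Fin 2 → L2Plane, (∀ i, i = 1 - j → g i = 0) → ∑ i, g i = g j := fun g hg =>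
    Finset.sum_eq_single j (fun i _ hi => hg i (by
      clear * - hi
      revert hi; revert i j; decide)) (by simp)
  have key := leftMul_diracSchwartz (θ := θ) (ξ := ξ) a ψ s k
  rw [Fin.sum_univ_two, hsum _ (fun i hi => by rw [hi, hk1, mul_zero, zero_smul]),
    hsum _ (fun i hi => by rw [hi, hk1, mul_zero, zero_smul]), hk0] at key
  set f := moyalMul θ a (ψ (s, j)) with hf
  have h1 : ((1 - blockSign s * ξ : ℝ) : ℂ) •
      toL2 (coordRight θ 0 f + sigma 1 k j • coordRight θ 1 f) =
      (2 : ℂ) • leftMul θ a (v (s, k)) + ((1 + blockSign s * ξ : ℝ) : ℂ) •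
        (leftMul θ (coordRight θ 0 a) (u (s, j)) +
          sigma 1 k j • leftMul θ (coordRight θ 1 a) (u (s, j))) := by
    rw [hv, hu, schwartzToSpinors_apply_eq_toL2, schwartzToSpinors_apply_eq_toL2, key, map_add,
      map_smul]
    module
  have h2 := congrArg norm h1
  rw [norm_smul, norm_real, Real.norm_eq_abs] at h2
  have h3 : ‖leftMul θ a (v (s, k))‖ ≤ ‖leftMul θ a‖ * ‖v‖ :=
    (leftMul θ a).le_opNorm_of_le (norm_component_le v _)
  have h4 : ∀ b, ‖leftMul θ b (u (s, j))‖ ≤ ‖leftMul θ b‖ * ‖u‖ := fun b =>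
    (leftMul θ b).le_opNorm_of_le (norm_component_le u _)
  have h5 : |1 + blockSign s * ξ| ≤ 1 + ξ := by
    rw [abs_le]
    rcases blockSign_eq s with h | h <;> rw [h] <;> constructor <;> linarith
  have h6 : |1 - ξ| * ‖toL2 (coordRight θ 0 f + sigma 1 k j • coordRight θ 1 f)‖ ≤
      2 * (‖leftMul θ a‖ * ‖v‖) + (1 + ξ) * (M * ‖u‖) := by
    refine (mul_le_mul_of_nonneg_right (abs_one_sub_blockSign_mul hξ s) (norm_nonneg _)).trans
      (h2.trans_le ((norm_add_le _ _).trans ?_))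
    rw [norm_smul, norm_smul, norm_real, Real.norm_eq_abs, RCLike.norm_ofNat]
    refine add_le_add (by gcongr) (mul_le_mul h5 ((norm_add_le _ _).trans ?_) (norm_nonneg _)
      (by linarith))
    rw [norm_smul, hk2, one_mul, hM, add_mul]
    exact add_le_add (h4 _) (h4 _)
  rw [mul_assoc, le_inv_mul_iff₀ hpos]
  refine h6.trans ?_
  have := norm_nonneg u
  have := norm_nonneg v
  have : 0 ≤ ‖leftMul θ a‖ * ‖u‖ := by positivity
  have : 0 ≤ (1 + ξ) * (M * ‖v‖) := by positivity
  nlinarith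

end Moyal

/-! ### Graph norm estimates and the compact resolvent -/

theorem LinearPMap.norm_apply_le_of_mem_closure_graph {H : Type} [NormedAddCommGroup H]
    [InnerProductSpace ℂ H] {T : H →ₗ.[ℂ] H} (hc : T.IsClosable) {A : H →L[ℂ] H} {C : ℝ}
    (h : ∀ u v, (u, v) ∈ T.graph → ‖A u‖ ≤ C * (‖u‖ + ‖v‖)) {u v : H}
    (huv : (u, v) ∈ T.closure.graph) : ‖A u‖ ≤ C * (‖u‖ + ‖v‖) :=
  closure_graph_subset hc (S := {p | ‖A p.1‖ ≤ C * (‖p.1‖ + ‖p.2‖)})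
    (isClosed_le (by fun_prop) (by fun_prop)) h huv

namespace Moyal

variable {θ ξ : ℝ} [hθ : Fact (0 < θ)]

theorem norm_spinors_le_sum {ι : Type} [Fintype ι] (u : Spinors ι) : ‖u‖ ≤ ∑ i, ‖u i‖ := by
  rw [PiLp.norm_eq_of_L2]
  refine Real.sqrt_le_iff.2 ⟨by positivity, ?_⟩
  exact Finset.sum_sq_le_sq_sum_of_nonneg fun i _ => norm_nonneg _

theorem norm_rightMul_leftMul_sub_le_of_schwartz (hξ : 0 < ξ) (hξ1 : ξ ≠ 1) (a : 𝓢(Plane, ℂ)) :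
    ∃ C : ℝ, 0 ≤ C ∧ ∀ (δ : ℝ) (e : 𝓢(Plane, ℂ)), IsMollifier θ δ e →
      ∀ ψ : Fin 2 × Fin 2 → 𝓢(Plane, ℂ),
        ‖diagonal (rightMul θ e ∘L leftMul θ a - leftMul θ a) (schwartzToSpinors _ ψ)‖ ≤
          δ * C * (‖schwartzToSpinors _ ψ‖ +
            ‖schwartzToSpinors _ (diracSchwartz θ twistedGamma (twistedDelta ξ) ψ)‖) := by
  obtain ⟨C, hC0, hC⟩ := norm_coordRight_add_le (θ := θ) hξ hξ1 a
  have hθ0 : 0 < θ⁻¹ := inv_pos.2 hθ.out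
  set K := 2 * (C + (1 + 4 * θ⁻¹) * ‖leftMul θ a‖) with hK
  -- The factor `4` counts the components of the spinor.
  refine ⟨4 * K, by positivity, fun δ e he ψ => (norm_spinors_le_sum _).trans ?_⟩
  set N := ‖schwartzToSpinors _ ψ‖ +
    ‖schwartzToSpinors _ (diracSchwartz θ twistedGamma (twistedDelta ξ) ψ)‖ with hN
  have hi : ∀ i, ‖diagonal (rightMul θ e ∘L leftMul θ a - leftMul θ a)
      (schwartzToSpinors _ ψ) i‖ ≤ δ * (K * N) := fun i => by
    rw [diagonal_apply, schwartzToSpinors_apply_eq_toL2, _root_.sub_apply,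
      ContinuousLinearMap.comp_apply, leftMul_toL2]
    refine (he.norm_rightMul_sub_le _).trans (mul_le_mul_of_nonneg_left ?_ he.nonneg)
    obtain ⟨c, hc, hc'⟩ := hC ψ i
    refine (sum_norm_coordRight_le _ hc).trans ?_
    have h1 : ‖toL2 (moyalMul θ a (ψ i))‖ ≤ ‖leftMul θ a‖ * N := by
      rw [← leftMul_toL2]
      exact (leftMul θ a).le_opNorm_of_le ((norm_component_le (schwartzToSpinors _ ψ) i).trans
        (le_add_of_nonneg_right (norm_nonneg _)))
    have h2 := mul_le_mul_of_nonneg_left h1 (show 0 ≤ 1 + 4 * θ⁻¹ by positivity)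
    rw [hK]
    linarith
  refine (Finset.sum_le_sum fun i _ => hi i).trans_eq ?_
  rw [Finset.sum_const, Finset.card_univ, Fintype.card_prod, Fintype.card_fin, nsmul_eq_mul]
  push_cast
  ring

/-- On the graph of the twisted Dirac operator, `R(e)` approximates the identity on the range of
`L(a)` uniformly with respect to the graph norm. -/
theorem norm_rightMul_leftMul_sub_le (hξ : 0 < ξ) (hξ1 : ξ ≠ 1) (a : 𝓢(Plane, ℂ)) :
    ∃ C : ℝ, 0 ≤ C ∧ ∀ (δ : ℝ) (e : 𝓢(Plane, ℂ)), IsMollifier θ δ e →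
      ∀ u v, (u, v) ∈ (twistedDirac θ ξ).graph →
        ‖diagonal (rightMul θ e ∘L leftMul θ a - leftMul θ a) u‖ ≤ δ * C * (‖u‖ + ‖v‖) := by
  obtain ⟨C, hC0, hC⟩ := norm_rightMul_leftMul_sub_le_of_schwartz (θ := θ) hξ hξ1 a
  refine ⟨C, hC0, fun δ e he u v huv => ?_⟩
  refine LinearPMap.norm_apply_le_of_mem_closure_graph
    (isClosable_diracCore isHermitian_twistedGamma (isHermitian_twistedDelta ξ))
    (fun u v h => ?_) huv
  obtain ⟨ψ, rfl, rfl⟩ := mem_graph_diracCore.1 h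
  exact hC δ e he ψ

/-- The resolvent is bounded into the graph norm, since `D R φ = φ + z R φ`. -/
theorem exists_graphNorm_resolvent_le {H : Type} [NormedAddCommGroup H] [InnerProductSpace ℂ H]
    {D : H →ₗ.[ℂ] H} {z : ℂ} {R : H →L[ℂ] H} (h : IsResolvent D z R) :
    ∃ C : ℝ, 0 ≤ C ∧ ∀ φ, ∃ v, (R φ, v) ∈ D.graph ∧ ‖R φ‖ + ‖v‖ ≤ C * ‖φ‖ := by
  refine ⟨‖R‖ + (1 + ‖z‖ * ‖R‖), by positivity, fun φ => ?_⟩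
  obtain ⟨hm, hR⟩ := h.1 φ
  refine ⟨D ⟨R φ, hm⟩, D.mem_graph ⟨R φ, hm⟩, ?_⟩
  have h1 := R.le_opNorm φ
  rw [sub_eq_iff_eq_add.1 hR]
  have h2 : ‖φ + z • R φ‖ ≤ ‖φ‖ + ‖z‖ * (‖R‖ * ‖φ‖) := by
    refine (norm_add_le _ _).trans ?_
    rw [norm_smul]
    gcongr
  linarith

/-- `L(a)` composed with the resolvent is the norm limit of the same operators with `R(e_n)`
inserted, which are compact. -/
theorem isCompactOperator_leftMul_resolvent (hξ : 0 < ξ) (hξ1 : ξ ≠ 1) (a : 𝓢(Plane, ℂ)) {z : ℂ}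
    {R : Spinors (Fin 2 × Fin 2) →L[ℂ] Spinors (Fin 2 × Fin 2)}
    (hR : IsResolvent (twistedDirac θ ξ) z R) :
    IsCompactOperator (diagonal (leftMul θ a) ∘L R) := by
  obtain ⟨δ, e, he, hδ⟩ := exists_seq_isMollifier θ
  obtain ⟨C, hC0, hC⟩ := norm_rightMul_leftMul_sub_le (θ := θ) hξ hξ1 a
  obtain ⟨C', hC0', hC'⟩ := exists_graphNorm_resolvent_le hR
  refine isCompactOperator_of_tendsto (l := Filter.atTop)
    (F := fun n => diagonal (leftMul θ a ∘L rightMul θ (e n)) ∘L R) ?_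
    (Filter.Eventually.of_forall fun n =>
      (isCompactOperator_diagonal (isCompactOperator_leftMul_rightMul a (e n))).comp_clm R)
  refine tendsto_iff_norm_sub_tendsto_zero.2 (squeeze_zero (fun _ => norm_nonneg _) (fun n => ?_)
    (tendsto_mul_const_zero hδ (C * C')))
  have := (he n).nonneg
  refine ContinuousLinearMap.opNorm_le_bound _ (by positivity) fun φ => ?_
  obtain ⟨v, hv, hφ⟩ := hC' φ
  -- As left and right multiplications commute, the error is `R(e_n) - 1` acting on the range of
  -- `L(a)`, where the graph norm estimate applies.
  have h1 : (diagonal (leftMul θ a ∘L rightMul θ (e n)) ∘L R - diagonal (leftMul θ a) ∘L R) φ =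
      diagonal (rightMul θ (e n) ∘L leftMul θ a - leftMul θ a) (R φ) :=
    PiLp.ext fun i => congrArg (· - leftMul θ a (R φ i)) (leftMul_rightMul_comm _ _ _)
  rw [h1]
  refine (hC _ _ (he n) _ _ hv).trans ?_
  rw [← mul_assoc, mul_assoc (δ n * C)]
  exact mul_le_mul_of_nonneg_left hφ (by positivity)

/-! ### Assembly of the spectral metric space -/

theorem diagonal_injective {ι : Type} [Fintype ι] [Nonempty ι] :
    Function.Injective (diagonal : (L2Plane →L[ℂ] L2Plane) → (Spinors ι →L[ℂ] Spinors ι)) := by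
  intro S T h
  ext1 u
  exact congrArg (fun A : Spinors ι →L[ℂ] Spinors ι =>
    A (WithLp.toLp 2 fun _ => u) (Classical.arbitrary ι)) h

theorem separableSpace_spinors (ι : Type) [Fintype ι] :
    TopologicalSpace.SeparableSpace (Spinors ι) :=
  (PiLp.continuousLinearEquiv 2 ℂ (fun _ : ι => L2Plane)).symm.surjective.denseRange.separableSpace
    (PiLp.continuousLinearEquiv 2 ℂ (fun _ : ι => L2Plane)).symm.continuous

theorem isSpectralTriple_twistedTriple (hξ : 0 < ξ) (hξ1 : ξ ≠ 1) :
    (twistedTriple θ ξ).IsSpectralTriple where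
  separable := separableSpace_spinors _
  algebra := isInvolutiveAlgebra_moyalMul
  rep_add a b := congrArg diagonal (leftMul_add a b)
  rep_smul z a := congrArg diagonal (leftMul_smul z a)
  rep_mul a b := congrArg diagonal (leftMul_mul a b)
  rep_inv a := (congrArg diagonal (leftMul_conj a)).trans (adjoint_diagonal _).symm
  faithful := diagonal_injective.comp leftMul_injective
  dense_domain := dense_domain_twistedDirac θ ξ
  selfAdjoint := isSelfAdjoint_closure_diracCore isHermitian_twistedGamma
    (isHermitian_twistedDelta ξ)
  domain_invariant a ψ hψ := LinearPMap.mem_domain_of_mem_graph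
    (mem_graph_twistedDirac a (LinearPMap.mem_graph _ (⟨ψ, hψ⟩ : (twistedDirac θ ξ).domain)))
  commutator_bounded a :=
    ⟨‖leftCommutator θ twistedGamma (twistedDelta ξ) a‖₊, (TripleData.commutatorBound_iff
      (dense_domain_twistedDirac θ ξ) (fun _ _ => mem_graph_twistedDirac a) _).2 le_rfl⟩
  compact_resolvent a _ _ hR := isCompactOperator_leftMul_resolvent hξ hξ1 a hR

theorem isSpectralMetricSpace_twistedTriple (hξ : 0 < ξ) (hξ1 : ξ ≠ 1) :
    (twistedTriple θ ξ).IsSpectralMetricSpace where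
  toIsSpectralTriple := isSpectralTriple_twistedTriple hξ hξ1
  nondegenerate := by
    obtain ⟨δ, e, he, hδ⟩ := exists_seq_isMollifier θ
    refine (Submodule.dense_iff_topologicalClosure_eq_top).1 fun u => ?_
    refine mem_closure_of_tendsto (f := fun n => diagonal (leftMul θ (e n)) u)
      (b := Filter.atTop) (tendsto_spinors fun i => tendsto_leftMul_mollifier he hδ (u i))
      (Filter.Eventually.of_forall fun n => Submodule.subset_span ⟨e n, u, rfl⟩)
  commutant_trivial := by
    ext a
    rw [Set.mem_ofPred_eq, TripleData.commutatorBound_iff (dense_domain_twistedDirac θ ξ)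
      (fun _ _ => mem_graph_twistedDirac a), norm_leftCommutator_twisted hξ, NNReal.coe_zero,
      Set.mem_singleton_iff]
    constructor
    · intro h
      refine eq_zero_of_leftCommutator_sigma_eq_zero (θ := θ) (norm_le_zero_iff.1 ?_)
      exact nonpos_of_mul_nonpos_right h (by positivity)
    · rintro rfl
      have h := leftCommutator_smul (θ := θ) sigma 0 (0 : ℂ) (0 : 𝓢(Plane, ℂ))
      rw [zero_smul] at h
      rw [h, norm_smul, norm_zero, zero_mul, mul_zero]

end Moyal

namespace Moyal

variable {θ : ℝ} [hθ : Fact (0 < θ)]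

/-! ### States -/

/-- Positivity of a linear functional on the Moyal algebra. -/
def IsPositive (θ : ℝ) [Fact (0 < θ)] (ω : 𝓢(Plane, ℂ) →ₗ[ℂ] ℂ) : Prop :=
  ∀ a, 0 ≤ (ω (moyalMul θ (conj a) a)).re ∧ (ω (moyalMul θ (conj a) a)).im = 0

theorem norm_leftMul_conj_mul_self (a : 𝓢(Plane, ℂ)) :
    ‖leftMul θ (moyalMul θ (conj a) a)‖ = ‖leftMul θ a‖ * ‖leftMul θ a‖ := by
  rw [leftMul_mul, leftMul_conj]
  exact ContinuousLinearMap.norm_adjoint_comp_self _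

/-- Polarization: `ω` is real on the square of `a + c b`, and `c = 1` and `c = i` give the imaginary
and the real parts. -/
theorem IsPositive.conj_symm {ω : 𝓢(Plane, ℂ) →ₗ[ℂ] ℂ} (hω : IsPositive θ ω)
    (a b : 𝓢(Plane, ℂ)) :
    starRingEnd ℂ (ω (moyalMul θ (conj b) a)) = ω (moyalMul θ (conj a) b) := by
  have key : ∀ c : ℂ, (ω (moyalMul θ (conj a) (c • b)) +
      ω (moyalMul θ (conj (c • b)) a)).im = 0 := fun c => by
    have h1 := (hω (a + c • b)).2
    rw [conj_add, moyalMul_add, add_moyalMul, add_moyalMul, map_add, map_add, map_add, add_im,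
      add_im, add_im, (hω a).2, (hω (c • b)).2] at h1
    rw [add_im]
    linarith
  have h1 := key 1
  have h2 := key I
  rw [one_smul, add_im] at h1
  rw [conj_smul, moyalMul_smul, smul_moyalMul, map_smul, map_smul] at h2
  simp at h2
  apply Complex.ext
  · simp
    linarith
  · simp
    linarith

/-- The form `(a, b) ↦ ω(a† ⋆ b)` of a positive functional. -/
@[reducible] noncomputable def IsPositive.core {ω : 𝓢(Plane, ℂ) →ₗ[ℂ] ℂ} (hω : IsPositive θ ω) :
    PreInnerProductSpace.Core ℂ 𝓢(Plane, ℂ) where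
  inner a b := ω (moyalMul θ (conj a) b)
  conj_inner_symm a b := hω.conj_symm a b
  re_inner_nonneg a := (hω a).1
  add_left a b c := by rw [conj_add, add_moyalMul, map_add]
  smul_left a b c := by rw [conj_smul, smul_moyalMul, map_smul, smul_eq_mul]

theorem IsPositive.norm_sq_le {ω : 𝓢(Plane, ℂ) →ₗ[ℂ] ℂ} (hω : IsPositive θ ω)
    (a b : 𝓢(Plane, ℂ)) : ‖ω (moyalMul θ (conj a) b)‖ ^ 2 ≤
      (ω (moyalMul θ (conj a) a)).re * (ω (moyalMul θ (conj b) b)).re := by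
  have h := @InnerProductSpace.Core.inner_mul_inner_self_le ℂ 𝓢(Plane, ℂ) _ _ _ hω.core a b
  have h2 : ‖ω (moyalMul θ (conj b) a)‖ = ‖ω (moyalMul θ (conj a) b)‖ := by
    rw [← hω.conj_symm, RCLike.norm_conj]
  change ‖ω (moyalMul θ (conj a) b)‖ * ‖ω (moyalMul θ (conj b) a)‖ ≤ _ at h
  rw [h2, ← sq] at h
  exact h

theorem IsState.isPositive {ω : 𝓢(Plane, ℂ) →ₗ[ℂ] ℂ} (hω : IsState θ ω) : IsPositive θ ω :=
  hω.nonneg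

theorem IsState.norm_le {ω : 𝓢(Plane, ℂ) →ₗ[ℂ] ℂ} (hω : IsState θ ω) (b : 𝓢(Plane, ℂ)) :
    ‖ω b‖ ≤ ‖leftMul θ b‖ := by
  rcases (norm_nonneg (leftMul θ b)).eq_or_lt with h0 | h0
  · have h1 : leftMul θ b = leftMul θ 0 := by
      rw [norm_eq_zero.1 h0.symm]
      simpa using (leftMul_smul (θ := θ) 0 (0 : 𝓢(Plane, ℂ))).symm
    rw [← h0, leftMul_injective h1, map_zero, norm_zero]
  · have h1 := hω.norm_eq_one.1 ⟨((‖leftMul θ b‖⁻¹ : ℝ) : ℂ) • b, by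
      rw [leftMul_smul, norm_smul, norm_real, Real.norm_of_nonneg (by positivity),
        inv_mul_cancel₀ h0.ne'], rfl⟩
    rwa [map_smul, norm_smul, norm_real, Real.norm_of_nonneg (by positivity),
      inv_mul_le_iff₀ h0, mul_one] at h1

theorem IsMollifier.norm_leftMul_mul_self_le_one {δ : ℝ} {e : 𝓢(Plane, ℂ)}
    (he : IsMollifier θ δ e) : ‖leftMul θ (moyalMul θ (conj e) e)‖ ≤ 1 := by
  rw [norm_leftMul_conj_mul_self]
  exact mul_le_one₀ he.norm_leftMul_le_one (norm_nonneg _) he.norm_leftMul_le_one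

/-- The algebra has no unit, so convergence to `1` along an approximate unit replaces `ω(1) = 1`.
Unlike the norm condition it is linear in `ω`, hence passes to mixtures. -/
theorem isState_of_tendsto {ω : 𝓢(Plane, ℂ) →ₗ[ℂ] ℂ} {δ : ℕ → ℝ} {e : ℕ → 𝓢(Plane, ℂ)}
    (he : ∀ n, IsMollifier θ (δ n) (e n)) (h1 : IsPositive θ ω) (h2 : ∀ a, ‖ω a‖ ≤ ‖leftMul θ a‖)
    (h3 : Filter.Tendsto (fun n => ω (moyalMul θ (conj (e n)) (e n))) Filter.atTop (nhds 1)) :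
    IsState θ ω where
  nonneg := h1
  norm_eq_one := by
    refine ⟨?_, fun r hr => ?_⟩
    · rintro _ ⟨a, ha, rfl⟩
      exact (h2 a).trans ha
    · have h4 := h3.norm
      rw [norm_one] at h4
      exact le_of_tendsto' h4 fun n => hr ⟨_, (he n).norm_leftMul_mul_self_le_one, rfl⟩

/-- By Cauchy–Schwarz, `|ω(e_n ⋆ a)|² ≤ ω(e_n ⋆ e_n)` for `‖L(a)‖ ≤ 1`. The left side tends to
`|ω(a)|²`, which can be chosen arbitrarily close to `1`. -/
theorem IsState.tendsto {ω : 𝓢(Plane, ℂ) →ₗ[ℂ] ℂ} (hω : IsState θ ω) {δ : ℕ → ℝ}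
    {e : ℕ → 𝓢(Plane, ℂ)} (he : ∀ n, IsMollifier θ (δ n) (e n))
    (hδ : Filter.Tendsto δ Filter.atTop (nhds 0)) :
    Filter.Tendsto (fun n => ω (moyalMul θ (conj (e n)) (e n))) Filter.atTop (nhds 1) := by
  have hre : ∀ n, ω (moyalMul θ (conj (e n)) (e n)) =
      ((ω (moyalMul θ (conj (e n)) (e n))).re : ℂ) := fun n =>
    Complex.ext rfl (hω.nonneg (e n)).2
  have hle : ∀ n, (ω (moyalMul θ (conj (e n)) (e n))).re ≤ 1 := fun n =>
    (re_le_norm _).trans ((hω.norm_le _).trans (he n).norm_leftMul_mul_self_le_one)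
  suffices h : Filter.Tendsto (fun n => (ω (moyalMul θ (conj (e n)) (e n))).re)
      Filter.atTop (nhds 1) by
    have h' := (continuous_ofReal.tendsto 1).comp h
    rw [ofReal_one] at h'
    exact h'.congr fun n => (hre n).symm
  refine tendsto_order.2 ⟨fun r hr => ?_, fun r hr => Filter.Eventually.of_forall fun n =>
    (hle n).trans_lt hr⟩
  -- Replacing `r` by a positive `r'` permits the square root: `a` is chosen with `|ω(a)|` above
  -- `√r'`.
  obtain ⟨r', hr', hr1⟩ : ∃ r', max r 0 < r' ∧ r' < 1 := exists_between (max_lt hr one_pos)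
  have hs0 : 0 < r' := (le_max_right _ _).trans_lt hr'
  have hs : Real.sqrt r' < 1 := (Real.sqrt_lt' one_pos).2 (by simpa using hr1)
  obtain ⟨_, ⟨a, ha, rfl⟩, hra, -⟩ := hω.norm_eq_one.exists_between hs
  have hlim : Filter.Tendsto (fun n => ‖ω (moyalMul θ (e n) a)‖) Filter.atTop (nhds ‖ω a‖) := by
    refine Filter.Tendsto.norm (tendsto_iff_norm_sub_tendsto_zero.2
      (squeeze_zero (fun _ => norm_nonneg _) (fun n => ?_)
        (tendsto_mul_const_zero hδ (∑ μ, ‖leftMul θ (coordLeft θ μ a)‖))))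
    rw [← map_sub]
    refine (hω.norm_le _).trans ?_
    rw [leftMul_sub]
    exact (he n).norm_leftMul_mul_sub_le a
  filter_upwards [hlim.eventually_const_lt hra] with n hn
  have h1 := hω.isPositive.norm_sq_le (e n) a
  rw [(he n).conj_eq] at h1 ⊢
  have h2 : (ω (moyalMul θ (conj a) a)).re ≤ 1 := by
    refine (re_le_norm _).trans ((hω.norm_le _).trans ?_)
    rw [norm_leftMul_conj_mul_self]
    exact mul_le_one₀ ha (norm_nonneg _) ha
  have h3 : 0 ≤ (ω (moyalMul θ (e n) (e n))).re := by
    have := (hω.nonneg (e n)).1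
    rwa [(he n).conj_eq] at this
  have h4 : r' < ‖ω (moyalMul θ (e n) a)‖ ^ 2 := by
    rw [← Real.sq_sqrt hs0.le]
    gcongr
  exact (le_max_left r 0).trans_lt (hr'.trans (h4.trans_le (h1.trans
    (mul_le_of_le_one_right h3 h2))))

/-- The point with parameter `t` of the segment between two functionals. -/
noncomputable def segmentMap (ω₁ ω₂ : 𝓢(Plane, ℂ) →ₗ[ℂ] ℂ) (t : ℝ) : 𝓢(Plane, ℂ) →ₗ[ℂ] ℂ :=
  ((1 - t : ℝ) : ℂ) • ω₁ + (t : ℂ) • ω₂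

theorem segmentMap_apply (ω₁ ω₂ : 𝓢(Plane, ℂ) →ₗ[ℂ] ℂ) (t : ℝ) (a : 𝓢(Plane, ℂ)) :
    segmentMap ω₁ ω₂ t a = ((1 - t : ℝ) : ℂ) * ω₁ a + (t : ℂ) * ω₂ a := rfl

theorem IsState.segmentMap {ω₁ ω₂ : 𝓢(Plane, ℂ) →ₗ[ℂ] ℂ} (h₁ : IsState θ ω₁)
    (h₂ : IsState θ ω₂) {t : ℝ} (ht0 : 0 ≤ t) (ht1 : t ≤ 1) :
    IsState θ (segmentMap ω₁ ω₂ t) := by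
  obtain ⟨δ, e, he, hδ⟩ := exists_seq_isMollifier θ
  have ht : 0 ≤ 1 - t := by linarith
  refine isState_of_tendsto he (fun a => ?_) (fun a => ?_) ?_
  · obtain ⟨h1, h2⟩ := h₁.nonneg a
    obtain ⟨h3, h4⟩ := h₂.nonneg a
    rw [segmentMap_apply, add_re, add_im, re_ofReal_mul, re_ofReal_mul, im_ofReal_mul,
      im_ofReal_mul, h2, h4]
    exact ⟨by positivity, by simp⟩
  · rw [segmentMap_apply]
    refine (norm_add_le _ _).trans ?_
    rw [norm_mul, norm_mul, norm_real, norm_real, Real.norm_of_nonneg ht, Real.norm_of_nonneg ht0]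
    have h1 := mul_le_mul_of_nonneg_left (h₁.norm_le a) ht
    have h2 := mul_le_mul_of_nonneg_left (h₂.norm_le a) ht0
    linarith
  · have h := ((h₁.tendsto he hδ).const_mul ((1 - t : ℝ) : ℂ)).add
      ((h₂.tendsto he hδ).const_mul (t : ℂ))
    have h1 : ((1 - t : ℝ) : ℂ) * 1 + (t : ℂ) * 1 = 1 := by push_cast; ring
    rw [h1] at h
    exact h

/-! ### Vector states and countable mixtures -/

/-- The vector functional `a ↦ ⟨u, L(a) u⟩`. -/
noncomputable def vectorState (θ : ℝ) [Fact (0 < θ)] (u : L2Plane) : 𝓢(Plane, ℂ) →ₗ[ℂ] ℂ where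
  toFun a := inner ℂ u (leftMul θ a u)
  map_add' a b := by rw [leftMul_add, _root_.add_apply, inner_add_right]
  map_smul' c a := by
    rw [leftMul_smul, _root_.smul_apply, inner_smul_right, RingHom.id_apply, smul_eq_mul]

theorem vectorState_apply (u : L2Plane) (a : 𝓢(Plane, ℂ)) :
    vectorState θ u a = inner ℂ u (leftMul θ a u) := rfl

theorem vectorState_conj_mul_self (u : L2Plane) (a : 𝓢(Plane, ℂ)) :
    vectorState θ u (moyalMul θ (conj a) a) = ((‖leftMul θ a u‖ ^ 2 : ℝ) : ℂ) := by
  rw [vectorState_apply, leftMul_mul, leftMul_conj, ContinuousLinearMap.comp_apply,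
    ContinuousLinearMap.adjoint_inner_right, inner_self_eq_norm_sq_to_K]
  simp

theorem isState_vectorState {u : L2Plane} (hu : ‖u‖ = 1) : IsState θ (vectorState θ u) := by
  obtain ⟨δ, e, he, hδ⟩ := exists_seq_isMollifier θ
  refine isState_of_tendsto he (fun a => ?_) (fun a => ?_) ?_
  · rw [vectorState_conj_mul_self]
    exact ⟨by rw [ofReal_re]; positivity, ofReal_im _⟩
  · rw [vectorState_apply]
    refine (norm_inner_le_norm _ _).trans ?_
    rw [hu, one_mul]
    exact ((leftMul θ a).le_opNorm u).trans_eq (by rw [hu, mul_one])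
  · have h := (continuous_ofReal.tendsto _).comp
      (((tendsto_leftMul_mollifier he hδ u).norm).pow 2)
    rw [hu, one_pow, ofReal_one] at h
    exact h.congr fun n => (vectorState_conj_mul_self u (e n)).symm

theorem hasSum_half_pow : HasSum (fun n : ℕ => (1 / 2 : ℝ) ^ (n + 1)) 1 := by
  have h := hasSum_geometric_two.mul_left (1 / 2)
  simpa [pow_succ'] using h

theorem summable_mixture {ω : ℕ → 𝓢(Plane, ℂ) →ₗ[ℂ] ℂ} (hω : ∀ n, IsState θ (ω n))
    (a : 𝓢(Plane, ℂ)) : Summable fun n => (((1 / 2 : ℝ) ^ (n + 1) : ℝ) : ℂ) * ω n a := by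
  refine Summable.of_norm_bounded (hasSum_half_pow.summable.mul_right ‖leftMul θ a‖) fun n => ?_
  rw [norm_mul, norm_real, Real.norm_of_nonneg (by positivity)]
  exact mul_le_mul_of_nonneg_left ((hω n).norm_le a) (by positivity)

/-- The mixture `∑ 2⁻⁽ⁿ⁺¹⁾ ωₙ` of a sequence of states. -/
noncomputable def mixture {ω : ℕ → 𝓢(Plane, ℂ) →ₗ[ℂ] ℂ} (hω : ∀ n, IsState θ (ω n)) :
    𝓢(Plane, ℂ) →ₗ[ℂ] ℂ where
  toFun a := ∑' n, (((1 / 2 : ℝ) ^ (n + 1) : ℝ) : ℂ) * ω n a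
  map_add' a b := by
    rw [← (summable_mixture hω a).tsum_add (summable_mixture hω b)]
    simp only [map_add, mul_add]
  map_smul' c a := by
    rw [RingHom.id_apply, smul_eq_mul, ← tsum_mul_left]
    refine tsum_congr fun n => ?_
    rw [map_smul, smul_eq_mul]
    ring

theorem hasSum_mixture {ω : ℕ → 𝓢(Plane, ℂ) →ₗ[ℂ] ℂ} (hω : ∀ n, IsState θ (ω n))
    (a : 𝓢(Plane, ℂ)) :
    HasSum (fun n => (((1 / 2 : ℝ) ^ (n + 1) : ℝ) : ℂ) * ω n a) (mixture hω a) :=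
  (summable_mixture hω a).hasSum

theorem isState_mixture {ω : ℕ → 𝓢(Plane, ℂ) →ₗ[ℂ] ℂ} (hω : ∀ n, IsState θ (ω n)) :
    IsState θ (mixture hω) := by
  obtain ⟨δ, e, he, hδ⟩ := exists_seq_isMollifier θ
  refine isState_of_tendsto he (fun a => ?_) (fun a => ?_) ?_
  · have h := hasSum_mixture hω (moyalMul θ (conj a) a)
    constructor
    · refine (hasSum_re h).nonneg fun n => ?_
      rw [re_ofReal_mul]
      exact mul_nonneg (by positivity) ((hω n).nonneg a).1
    · refine (hasSum_im h).unique ?_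
      convert hasSum_zero with n
      rw [im_ofReal_mul, ((hω n).nonneg a).2, mul_zero]
  · have h1 := hasSum_half_pow.mul_right ‖leftMul θ a‖
    rw [one_mul] at h1
    refine tsum_of_norm_bounded h1 fun n => ?_
    rw [norm_mul, norm_real, Real.norm_of_nonneg (by positivity)]
    exact mul_le_mul_of_nonneg_left ((hω n).norm_le a) (by positivity)
  · have h1 : ∑' n : ℕ, (((1 / 2 : ℝ) ^ (n + 1) : ℝ) : ℂ) * 1 = 1 := by
      have := (hasSum_ofReal.2 hasSum_half_pow : HasSum _ ((1 : ℝ) : ℂ)).tsum_eq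
      simpa using this
    rw [← h1]
    refine tendsto_tsum_of_dominated_convergence (bound := fun n => (1 / 2 : ℝ) ^ (n + 1))
      hasSum_half_pow.summable (fun n => ((hω n).tendsto he hδ).const_mul _)
      (Filter.Eventually.of_forall fun m n => ?_)
    rw [norm_mul, norm_real, Real.norm_of_nonneg (by positivity)]
    exact mul_le_of_le_one_right (pow_nonneg one_half_pos.le _)
      (((hω n).norm_le _).trans (he m).norm_leftMul_mul_self_le_one)

/-- Every component contributes at most its weight, and the `n`-th at most half of `2⁻⁽ⁿ⁺¹⁾`; the
deficit is `2⁻⁽ⁿ⁺²⁾`. -/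
theorem re_mixture_le {ω : ℕ → 𝓢(Plane, ℂ) →ₗ[ℂ] ℂ} (hω : ∀ n, IsState θ (ω n))
    {a : 𝓢(Plane, ℂ)} (ha : ‖leftMul θ a‖ ≤ 1) {n : ℕ} (hn : (ω n a).re ≤ 1 / 2) :
    (mixture hω a).re ≤ 1 - (1 / 2) ^ (n + 2) := by
  have h1 := hasSum_re (hasSum_mixture hω a)
  have h2 : HasSum (fun m : ℕ => (1 / 2 : ℝ) ^ (m + 1) - if m = n then (1 / 2 : ℝ) ^ (n + 2) else 0)
      (1 - (1 / 2) ^ (n + 2)) := hasSum_half_pow.sub (hasSum_ite_eq n _)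
  refine hasSum_le (fun m => ?_) h1 h2
  rw [re_ofReal_mul]
  split_ifs with h
  · subst h
    rw [pow_succ _ (m + 1)]
    have : 0 < (1 / 2 : ℝ) ^ (m + 1) := by positivity
    nlinarith
  · rw [sub_zero]
    exact mul_le_of_le_one_right (by positivity)
      ((re_le_norm _).trans (((hω m).norm_le a).trans ha))

end Moyal

namespace Moyal

/-! ### States at infinite distance -/

/-- Under `x ↦ s x` the `L¹` norm shrinks faster than the `L²` norm, so their ratio can be made
arbitrarily small. -/
theorem exists_dilation (f : 𝓢(Plane, ℂ)) {s : ℝ} (hs : 0 < s) : ∃ g : 𝓢(Plane, ℂ),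
    ∫ x, ‖g x‖ = (s ^ 2)⁻¹ * ∫ x, ‖f x‖ ∧ ‖toL2 g‖ = s⁻¹ * ‖toL2 f‖ := by
  let g : 𝓢(Plane, ℂ) := compCLMOfContinuousLinearEquiv ℂ
    (ContinuousLinearEquiv.smulLeft (Units.mk0 s hs.ne') : Plane ≃L[ℝ] Plane) f
  have hg : ∀ x, g x = f (s • x) := fun x => rfl
  have hdim : Module.finrank ℝ Plane = 2 := by simp
  have habs : |(s ^ 2)⁻¹| = (s ^ 2)⁻¹ := abs_of_pos (by positivity)
  refine ⟨g, ?_, ?_⟩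
  · simp only [hg]
    rw [Measure.integral_comp_smul volume (fun x => ‖f x‖), hdim, habs, smul_eq_mul]
  · rw [norm_toL2, norm_toL2]
    simp only [hg]
    rw [Measure.integral_comp_smul volume (fun x => ‖f x‖ ^ (2 : ℝ)), hdim, habs, smul_eq_mul,
      Real.mul_rpow (by positivity) (by positivity), Real.inv_rpow (by positivity),
      ← Real.rpow_natCast, ← Real.rpow_mul hs.le]
    norm_num

theorem exists_toL2_ne_zero : ∃ f : 𝓢(Plane, ℂ), toL2 f ≠ 0 := by
  have : Fact ((0 : ℝ) < 1) := ⟨one_pos⟩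
  obtain ⟨e, he⟩ := exists_isMollifier (θ := 1) one_pos
  refine ⟨e, fun h => ?_⟩
  have h0 : e = 0 := toL2_injective (by rw [h, map_zero])
  have h1 := he.integral_symbol
  rw [h0, map_zero] at h1
  simp at h1

variable {θ : ℝ} [hθ : Fact (0 < θ)]

/-- Pairs `ψ` in `L¹` with the bounded function `e ⋆ ψ`, so that concentrated vectors give small
expectation values. -/
theorem norm_inner_leftMul_le (e ψ : 𝓢(Plane, ℂ)) :
    ‖inner ℂ (toL2 ψ) (leftMul θ e (toL2 ψ))‖ ≤
      ‖toL2 (symbol θ (conj e))‖ * ‖toL2 ψ‖ * ∫ x, ‖ψ x‖ := by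
  have h1 : ∀ x, ‖moyalMul θ e ψ x‖ ≤ ‖toL2 (symbol θ (conj e))‖ * ‖toL2 ψ‖ := fun x => by
    rw [← norm_toL2_conj ψ, ← RCLike.norm_conj, ← conj_apply, conj_moyalMul]
    exact norm_moyalMul_apply_le _ _ x
  rw [leftMul_toL2, inner_toL2, mul_comm, ← integral_mul_const]
  refine norm_integral_le_of_norm_le ((ψ.integrable (μ := volume)).norm.mul_const _)
    (Filter.Eventually.of_forall fun x => ?_)
  rw [norm_mul, RCLike.norm_conj]
  exact mul_le_mul_of_nonneg_left (h1 x) (norm_nonneg _)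

theorem exists_toL2_norm_inner_le (e : 𝓢(Plane, ℂ)) :
    ∃ ψ : 𝓢(Plane, ℂ), ‖toL2 ψ‖ = 1 ∧
      ‖inner ℂ (toL2 ψ) (leftMul θ e (toL2 ψ))‖ ≤ 1 / 2 := by
  obtain ⟨f, hf⟩ := exists_toL2_ne_zero
  have hn : 0 < ‖toL2 f‖ := norm_pos_iff.2 hf
  set K := ‖toL2 (symbol θ (conj e))‖ with hK
  set N := ∫ x, ‖f x‖ with hN
  have hN0 : 0 ≤ N := integral_nonneg fun x => norm_nonneg _
  -- After normalization the bound is `K N / (s ‖f‖)`; this `s` makes it at most `1/2`, and the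
  -- added `1` keeps `s` positive.
  set s := 2 * K * N / ‖toL2 f‖ + 1 with hs
  have hs0 : 0 < s := by positivity
  obtain ⟨g, hg1, hg2⟩ := exists_dilation f hs0
  have hg0 : 0 < ‖toL2 g‖ := by rw [hg2]; positivity
  refine ⟨((‖toL2 g‖⁻¹ : ℝ) : ℂ) • g, ?_, ?_⟩
  · rw [map_smul, norm_smul, norm_real, Real.norm_of_nonneg (by positivity),
      inv_mul_cancel₀ hg0.ne']
  · rw [map_smul, map_smul, inner_smul_left, inner_smul_right, norm_mul, norm_mul,
      RCLike.norm_conj, norm_real, Real.norm_of_nonneg (by positivity)]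
    have h1 := norm_inner_leftMul_le (θ := θ) e g
    rw [hg1, ← hK, ← hN] at h1
    rw [← mul_assoc, ← mul_inv, inv_mul_le_iff₀ (by positivity)]
    refine h1.trans ?_
    have h2 : K * N ≤ 1 / 2 * (s * ‖toL2 f‖) := by
      rw [hs, add_mul, div_mul_cancel₀ _ hn.ne']
      linarith
    have h3 : K * ((s ^ 2)⁻¹ * N) ≤ ‖toL2 g‖ * (1 / 2) := by
      rw [hg2]
      calc K * ((s ^ 2)⁻¹ * N) = (s ^ 2)⁻¹ * (K * N) := by ring
        _ ≤ (s ^ 2)⁻¹ * (1 / 2 * (s * ‖toL2 f‖)) := by gcongr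
        _ = s⁻¹ * ‖toL2 f‖ * (1 / 2) := by field_simp
    calc K * ‖toL2 g‖ * ((s ^ 2)⁻¹ * N) = ‖toL2 g‖ * (K * ((s ^ 2)⁻¹ * N)) := by ring
      _ ≤ ‖toL2 g‖ * (‖toL2 g‖ * (1 / 2)) := by gcongr
      _ = _ := by ring

theorem lip_standardTriple_mollifier_le : ∃ C : ℝ, 0 < C ∧
    ∀ (ε : ℝ) (e : 𝓢(Plane, ℂ)), IsMollifier θ ε e →
      (standardTriple θ).lip e ≤ ENNReal.ofReal (C * ε) := by
  obtain ⟨C, hC0, hC⟩ := norm_leftCommutator_le (θ := θ) sigma 0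
  refine ⟨C + 1, by positivity, fun ε e he => ?_⟩
  rw [lip_standardTriple, ← ofReal_norm]
  refine ENNReal.ofReal_le_ofReal ((hC ε e he).trans ?_)
  have := he.nonneg
  gcongr
  linarith

theorem enorm_sub_le_dist_standardTriple {ω₁ ω₂ : 𝓢(Plane, ℂ) →ₗ[ℂ] ℂ} {a : 𝓢(Plane, ℂ)} {r : ℝ}
    (hr : 0 < r) (ha : (standardTriple θ).lip a ≤ ENNReal.ofReal r) :
    ENNReal.ofReal (r⁻¹ * ‖ω₁ a - ω₂ a‖) ≤ (standardTriple θ).dist ω₁ ω₂ := by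
  have hn : ‖((r⁻¹ : ℝ) : ℂ)‖ = r⁻¹ := by rw [norm_real, Real.norm_of_nonneg (by positivity)]
  refine le_iSup₂_of_le (((r⁻¹ : ℝ) : ℂ) • a) ?_ ?_
  · rw [lip_standardTriple_smul, ← ofReal_norm, hn]
    refine (mul_le_mul_right ha _).trans_eq ?_
    rw [← ENNReal.ofReal_mul (by positivity), inv_mul_cancel₀ hr.ne', ENNReal.ofReal_one]
  · rw [map_smul, map_smul, ← smul_sub, ← ofReal_norm, norm_smul, hn]

theorem exists_norm_one_sub_vectorState_le : ∃ (ω : 𝓢(Plane, ℂ) →ₗ[ℂ] ℂ) (K : ℝ), IsState θ ω ∧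
    ∀ (ε : ℝ) (e : 𝓢(Plane, ℂ)), IsMollifier θ ε e → ‖1 - ω e‖ ≤ ε * K := by
  -- Used only for the existence of a Schwartz function of norm one.
  obtain ⟨ψ, hψ, -⟩ := exists_toL2_norm_inner_le (θ := θ) 0
  refine ⟨vectorState θ (toL2 ψ), ∑ μ, ‖toL2 (coordLeft θ μ ψ)‖, isState_vectorState hψ,
    fun ε e he => ?_⟩
  have h1 : (1 : ℂ) = inner ℂ (toL2 ψ) (toL2 ψ) := by
    rw [inner_self_eq_norm_sq_to_K, hψ]
    simp
  rw [vectorState_apply, h1, ← inner_sub_right]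
  refine (norm_inner_le_norm _ _).trans ?_
  rw [hψ, one_mul, norm_sub_rev]
  exact he.norm_leftMul_sub_le ψ

/-- There are states at infinite distance. -/
theorem exists_dist_eq_top : ∃ ω₁ ω₂ : 𝓢(Plane, ℂ) →ₗ[ℂ] ℂ, IsState θ ω₁ ∧ IsState θ ω₂ ∧
    (standardTriple θ).dist ω₁ ω₂ = ⊤ := by
  obtain ⟨C, hC0, hC⟩ := lip_standardTriple_mollifier_le (θ := θ)
  obtain ⟨ω₁, K, hω₁, hK⟩ := exists_norm_one_sub_vectorState_le (θ := θ)
  -- The rate `8⁻ⁿ` must beat the mixture weights. The two states differ on `e n` by at least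
  -- `2⁻⁽ⁿ⁺²⁾ - K 8⁻ⁿ`, and dividing by the seminorm bound `C 8⁻ⁿ` leaves `(4ⁿ/4 - K)/C`, which is
  -- unbounded.
  have hpos : ∀ n : ℕ, 0 < ((1 / 8 : ℝ) ^ n) := fun n => by positivity
  choose e he using fun n => exists_isMollifier (θ := θ) (hpos n)
  choose ψ hψ1 hψ2 using fun n => exists_toL2_norm_inner_le (θ := θ) (e n)
  have hω : ∀ n, IsState θ (vectorState θ (toL2 (ψ n))) := fun n => isState_vectorState (hψ1 n)
  refine ⟨ω₁, mixture hω, hω₁, isState_mixture hω, ?_⟩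
  have key : ∀ n : ℕ, ENNReal.ofReal (C⁻¹ * (4 ^ n / 4 - K)) ≤
      (standardTriple θ).dist ω₁ (mixture hω) := fun n => by
    refine le_trans (ENNReal.ofReal_le_ofReal ?_) (enorm_sub_le_dist_standardTriple
      (mul_pos hC0 (hpos n)) (hC _ _ (he n)))
    have h1 : (mixture hω (e n)).re ≤ 1 - (1 / 2) ^ (n + 2) :=
      re_mixture_le hω (he n).norm_leftMul_le_one ((re_le_norm _).trans (hψ2 n))
    have h2 : (1 - ω₁ (e n)).re ≤ (1 / 8) ^ n * K := (re_le_norm _).trans (hK _ _ (he n))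
    have h3 := re_le_norm (ω₁ (e n) - mixture hω (e n))
    rw [sub_re] at h2 h3
    rw [one_re] at h2
    have h4 : (1 / 2 : ℝ) ^ (n + 2) - (1 / 8) ^ n * K ≤ ‖ω₁ (e n) - mixture hω (e n)‖ := by
      linarith
    have h5 : (1 / 2 : ℝ) ^ (n + 2) = (1 / 8) ^ n * (4 ^ n / 4) := by
      rw [pow_add, show (1 / 2 : ℝ) = 1 / 8 * 4 by norm_num, mul_pow]
      ring
    rw [h5, ← mul_sub] at h4
    rw [mul_inv, mul_assoc]
    refine mul_le_mul_of_nonneg_left ?_ (by positivity)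
    rwa [le_inv_mul_iff₀ (hpos n)]
  refine ENNReal.eq_top_of_forall_nnreal_le fun r => ?_
  obtain ⟨n, hn⟩ := pow_unbounded_of_one_lt (4 * (C * r + K)) (show (1 : ℝ) < 4 by norm_num)
  refine le_trans ?_ (key n)
  rw [← ENNReal.ofReal_coe_nnreal]
  refine ENNReal.ofReal_le_ofReal ?_
  rw [le_inv_mul_iff₀ hC0]
  linarith

end Moyal

namespace Moyal

/-! ### The topology of the spectral distance -/

theorem dist_segmentMap {H : Type} [NormedAddCommGroup H] [InnerProductSpace ℂ H]
    (T : TripleData 𝓢(Plane, ℂ) H) (ω₁ ω₂ : 𝓢(Plane, ℂ) →ₗ[ℂ] ℂ) (s t : ℝ) :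
    T.dist (segmentMap ω₁ ω₂ s) (segmentMap ω₁ ω₂ t) = ‖s - t‖ₑ * T.dist ω₁ ω₂ := by
  simp only [TripleData.dist, ENNReal.mul_iSup]
  refine iSup_congr fun a => iSup_congr fun _ => ?_
  have h : segmentMap ω₁ ω₂ s a - segmentMap ω₁ ω₂ t a =
      ((t - s : ℝ) : ℂ) * (ω₁ a - ω₂ a) := by
    rw [segmentMap_apply, segmentMap_apply]
    push_cast
    ring
  rw [h, enorm_mul, ← ofReal_norm, norm_real, ofReal_norm, ← enorm_neg, neg_sub]

section

variable {θ : ℝ} [hθ : Fact (0 < θ)] {H : Type} [NormedAddCommGroup H] [InnerProductSpace ℂ H]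
  {T : TripleData 𝓢(Plane, ℂ) H}

/-- The segment between two states. -/
noncomputable def stateSegment (ω₁ ω₂ : StateSpace θ T) (t : unitInterval) : StateSpace θ T :=
  ⟨segmentMap ω₁.1 ω₂.1 t, ω₁.2.segmentMap ω₂.2 t.2.1 t.2.2⟩

theorem edist_stateSegment (ω₁ ω₂ : StateSpace θ T) (s t : unitInterval) :
    edist (stateSegment ω₁ ω₂ s) (stateSegment ω₁ ω₂ t) = ‖(s : ℝ) - t‖ₑ * edist ω₁ ω₂ :=
  dist_segmentMap T ω₁.1 ω₂.1 s t

theorem stateSegment_zero (ω₁ ω₂ : StateSpace θ T) : stateSegment ω₁ ω₂ 0 = ω₁ :=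
  Subtype.ext (by simp [stateSegment, segmentMap])

theorem stateSegment_one (ω₁ ω₂ : StateSpace θ T) : stateSegment ω₁ ω₂ 1 = ω₂ :=
  Subtype.ext (by simp [stateSegment, segmentMap])

theorem joined_of_edist_ne_top {ω₁ ω₂ : StateSpace θ T} (h : edist ω₁ ω₂ ≠ ⊤) :
    Joined ω₁ ω₂ := by
  have hc : Continuous (stateSegment ω₁ ω₂) := by
    refine LipschitzWith.continuous (K := (edist ω₁ ω₂).toNNReal) fun s t => ?_
    rw [edist_stateSegment, ENNReal.coe_toNNReal h, mul_comm, Subtype.edist_eq, edist_eq_enorm_sub]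
  exact ⟨⟨⟨stateSegment ω₁ ω₂, hc⟩, stateSegment_zero ω₁ ω₂, stateSegment_one ω₁ ω₂⟩⟩

/-- A ball of infinite radius is both open and closed, so it contains the component of its centre.
-/
theorem edist_ne_top_of_mem_connectedComponent {ω₁ ω₂ : StateSpace θ T}
    (h : ω₂ ∈ connectedComponent ω₁) : edist ω₁ ω₂ ≠ ⊤ := by
  have hclopen : IsClopen (Metric.eball ω₁ ⊤) :=
    ⟨Metric.isClosed_eball_top, Metric.isOpen_eball⟩
  have h1 := hclopen.connectedComponent_subset (x := ω₁)
    (Metric.mem_eball_self ENNReal.zero_lt_top) h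
  rw [edist_comm]
  exact h1.ne

theorem isPathConnected_connectedComponent (ω : StateSpace θ T) :
    IsPathConnected (connectedComponent ω) := by
  have h : connectedComponent ω = pathComponent ω := by
    refine Set.Subset.antisymm (fun ω' h' => ?_) (pathComponent_subset_component ω)
    exact joined_of_edist_ne_top (edist_ne_top_of_mem_connectedComponent h')
  rw [h]
  exact isPathConnected_pathComponent

/-- Distinct points of a segment with endpoints at infinite distance are themselves at infinite
distance, so they lie in different components. -/
theorem infinite_connectedComponents {ω₁ ω₂ : StateSpace θ T} (h : edist ω₁ ω₂ = ⊤) :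
    Infinite (ConnectedComponents (StateSpace θ T)) := by
  let t : ℕ → unitInterval := fun n => ⟨((n : ℝ) + 1)⁻¹, by positivity, inv_le_one_of_one_le₀
    (by linarith [Nat.cast_nonneg (α := ℝ) n])⟩
  refine Infinite.of_injective
    (fun n => (ConnectedComponents.mk (stateSegment ω₁ ω₂ (t n)) :
      ConnectedComponents (StateSpace θ T))) fun m n hmn => ?_
  by_contra hne
  have h1 := ConnectedComponents.coe_eq_coe.1 hmn
  have h2 : stateSegment ω₁ ω₂ (t n) ∈ connectedComponent (stateSegment ω₁ ω₂ (t m)) :=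
    h1 ▸ mem_connectedComponent
  refine edist_ne_top_of_mem_connectedComponent h2 ?_
  rw [edist_stateSegment, h, ENNReal.mul_top]
  rw [ne_eq, enorm_eq_zero, sub_eq_zero]
  intro h3
  have h4 : ((m : ℝ) + 1)⁻¹ = ((n : ℝ) + 1)⁻¹ := h3
  rw [inv_inj, add_left_inj, Nat.cast_inj] at h4
  exact hne h4

end

theorem infinite_connectedComponents_twistedTriple {θ ξ : ℝ} [Fact (0 < θ)] (hξ : 0 < ξ) :
    Infinite (ConnectedComponents (StateSpace θ (twistedTriple θ ξ))) := by
  obtain ⟨ω₁, ω₂, h₁, h₂, h⟩ := exists_dist_eq_top (θ := θ)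
  refine infinite_connectedComponents (ω₁ := ⟨ω₁, h₁⟩) (ω₂ := ⟨ω₂, h₂⟩) ?_
  refine (dist_twistedTriple hξ ω₁ ω₂).trans ?_
  rw [h, ENNReal.mul_top]
  simpa using by positivity

end Moyal

theorem mainTheorem5 (θ ξ : ℝ) [Fact (0 < θ)] (hξ : 0 < ξ) (hξ1 : ξ ≠ 1) :
    -- `L(a)` is a bounded operator on `L²(ℝ²)` that acts on `𝓢` by `ψ ↦ a ⋆ ψ`
    (∀ a ψ : 𝓢(Plane, ℂ), leftMul θ a (ψ.toLp 2) = (moyalMul θ a ψ).toLp 2) ∧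
    (twistedTriple θ ξ).IsSpectralMetricSpace ∧
    Infinite (ConnectedComponents (StateSpace θ (twistedTriple θ ξ))) ∧
    (∀ ω : StateSpace θ (twistedTriple θ ξ), IsPathConnected (connectedComponent ω)) ∧
    ∀ ω₁ ω₂ : 𝓢(Plane, ℂ) →ₗ[ℂ] ℂ, IsState θ ω₁ → IsState θ ω₂ →
      (twistedTriple θ ξ).dist ω₁ ω₂ =
        ENNReal.ofReal (1 + ξ)⁻¹ * (standardTriple θ).dist ω₁ ω₂ := by
  refine ⟨leftMul_toL2, isSpectralMetricSpace_twistedTriple hξ hξ1,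
    infinite_connectedComponents_twistedTriple hξ, isPathConnected_connectedComponent,
    fun ω₁ ω₂ _ _ => dist_twistedTriple hξ ω₁ ω₂⟩
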